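/- Let $M$ be a smooth $4$-manifold with an orientation, a Minkowski-type metric of signature $(+,-,-,-)$ and a polarization (a smooth choice of the Future light cone at each point), and let $SM$ be its spinor bundle: a smooth complex rank $2$ bundle with a smooth nowhere zero skew-symmetric form $\mathbf d$ (the spin-metric), where each orthonormal spinor frame ($\mathbf d(\Psi_1,\Psi_2)=1$) is smoothly associated with a positively polarized right orthonormal tangent frame $\Upsilon_0,\dots,\Upsilon_3$ in such a way that a change of spinor frames with the matrix $\mathfrak S\in SL(2,\mathbb C)$ changes the associated tangent frame by $S=\varphi(\mathfrak S)$, $\varphi:SL(2,\mathbb C)\to SO^+(1,3,\mathbb R)$ being the canonical homomorphism. A spin-tensor of type $(\alpha,\beta|\nu,\gamma|m,n)$ at $p\in M$ is an element of $S_p^{\otimes\alpha}\otimes (S_p^*)^{\otimes\beta}\otimes (S_p^{\dagger *})^{\otimes\nu}\otimes (S_p^\dagger)^{\otimes\gamma}\otimes(\mathbb C\otimes T_pM)^{\otimes m}\otimes(\mathbb C\otimes T_p^*M)^{\otimes n}$, where $S_p^\dagger$ is the space of semilinear functionals on $S_p$; $\tau$ is complex conjugation of spin-tensors, which exchanges barred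 and non-barred indices. Let $N$ be the composite bundle whose points are $q=(p,\mathbf S[1],\dots,\mathbf S[J])$, where $\mathbf S[P]$ is a spin-tensor of a given type $(\alpha_P,\beta_P|\nu_P,\gamma_P|m_P,n_P)$ at $p$. An extended spin-tensorial field assigns to each $q\in N$ a spin-tensor of a fixed type at $p$. An equipped chart is a chart with coordinates $x^0,\dots,x^3$ together with a smooth orthonormal spinor frame $\Psi_1,\Psi_2$ over its domain, and with the associated tangent frame $\Upsilon_i=\sum_k\Upsilon^k_i\,\partial/\partial x^k$, $[\Upsilon_i,\Upsilon_j]=\sum_k c^k_{ij}\Upsilon_k$. In it, the components of extended fields are functions of $x^k$ and of the components of $\mathbf S[1],\dots,\mathbf S[J]$; fields are smooth if these functions are. For two equipped charts with the frames $\tilde\Psi_i=\sum_j\mathfrak S^j_i\Psi_j$, $\tilde\Upsilon_i=\sum_j S^j_i\Upsilon_j$, put $\mathfrak T=\mathfrak S^{-1}$, $T=S^{-1}$, $\vartheta^k_{ij}=\sum_a\mathfrak S^k_a\,\Upsilon_i(\mathfrak T^a_j)$, $\theta^k_{ij}=\sum_a S^k_a\,\Upsilon_i(T^a_j)$. An extended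 spinor connection $(\mathrm A,\bar{\mathrm A},\Gamma)$ is given in each equipped chart by smooth complex functions $\mathrm A^k_{ji}$, $\bar{\mathrm A}^k_{ji}$, $\Gamma^k_{ji}$ of these variables such that $$\mathrm A^k_{ji}=\sum\mathfrak S^k_a\mathfrak T^b_iT^c_j\tilde{\mathrm A}^a_{cb}+\vartheta^k_{ji},\quad \bar{\mathrm A}^k_{ji}=\sum\overline{\mathfrak S^k_a}\,\overline{\mathfrak T^b_i}\,T^c_j\tilde{\bar{\mathrm A}}{}^a_{cb}+\overline{\vartheta^k_{ji}},\quad \Gamma^k_{ji}=\sum S^k_aT^b_iT^c_j\tilde\Gamma^a_{cb}+\theta^k_{ji}.$$ For extended fields $\mathfrak F,\bar{\mathfrak F},\mathbf F$ of types $(1,1|0,0|0,0)$, $(0,0|1,1|0,0)$, $(0,0|0,0|1,1)$, the degenerate differentiation $D(\mathfrak F,\bar{\mathfrak F},\mathbf F)$ acts on the components of a spin-tensor $Z$ by adding, for each upper index $a$ of $Z$, the term $+\sum_v F^{a}_{v}Z^{\dots v\dots}$ and, for each lower index $b$ of $Z$, the term $-\sum_w F^{w}_{b}Z_{\dots w\dots}$,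 where $F$ is $\mathfrak F$, $\bar{\mathfrak F}$ or $\mathbf F$ according to whether the index is spinor, barred spinor or space-time. The native multivariate differentiation along a field $\mathbf Y$ of the type of $\mathbf S[P]$ is $\nabla_{\mathbf Y}[P]Z=\sum_b Y^b\,\partial Z/\partial S^b[P]$, and along a field $\mathbf Y$ of the type of $\tau(\mathbf S[P])$ the barred one is $\bar\nabla_{\mathbf Y}[P]Z=\sum_b Y^b\,\partial Z/\partial(\tau\mathbf S[P])^b$, where $b$ runs over multi-indices and $\partial/\partial S^b$, $\partial/\partial\overline{S^b}$ are the usual complex (Wirtinger) derivatives. Let $D_j$ denote the algebraic action on components of $D(\mathrm A_j,\bar{\mathrm A}_j,\Gamma_j)$, where $\mathrm A_j=(\mathrm A^k_{ji})_{k,i}$ etc., and for a function $f$ of the local variables let $$H_jf=\sum_k\Upsilon^k_j\frac{\partial f}{\partial x^k}-\sum_{P=1}^J\sum_b(D_j\mathbf S[P])^b\frac{\partial f}{\partial S^b[P]}-\sum_{P=1}^J\sum_b(D_j\,\tau\mathbf S[P])^b\frac{\partial f}{\partial(\tau\mathbf S[P])^b}.$$ The spatial covariant differentiation is $\nabla_{\mathbf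 X}Z=\sum_jX^j\nabla_jZ$, $\nabla_jZ=H_jZ+D_jZ$ (with $H_j$ applied to each component of $Z$). Then the following holds. (a) The operations $\nabla_{\mathbf X}Z$, $\nabla_{\mathbf Y}[P]Z$, $\bar\nabla_{\mathbf Y}[P]Z$ (for smooth $Z$), $D(\mathfrak F,\bar{\mathfrak F},\mathbf F)Z$, $\tau Z$ and the contractions in (c) do not depend on the choice of equipped charts. The functions $$T^k_{ij}=\Gamma^k_{ij}-\Gamma^k_{ji}-c^k_{ij}$$ are the components of a smooth extended field $\mathbf T$ (the torsion) of type $(0,0|0,0|1,2)$. (b) The functions $$\mathfrak R^p_{qij}=H_i\mathrm A^p_{jq}-H_j\mathrm A^p_{iq}+\sum_h\left(\mathrm A^p_{ih}\mathrm A^h_{jq}-\mathrm A^p_{jh}\mathrm A^h_{iq}\right)-\sum_kc^k_{ij}\mathrm A^p_{kq}$$ and the functions $\bar{\mathfrak R}^p_{qij}$ and $R^p_{qij}$, given by the same formula with $\mathrm A$ replaced by $\bar{\mathrm A}$ and $\Gamma$ respectively (the operators $H_i,H_j$ remaining the same), are the components of smooth extended fields $\mathfrak R$, $\bar{\mathfrak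 R}$, $\mathbf R$ of types $(1,1|0,0|0,2)$, $(0,0|1,1|0,2)$, $(0,0|0,0|1,3)$. (c) For all smooth extended fields $\mathbf X,\mathbf Y$ of type $(0,0|0,0|1,0)$, let $\mathfrak N=\mathfrak R(\mathbf X,\mathbf Y)$, $\bar{\mathfrak N}=\bar{\mathfrak R}(\mathbf X,\mathbf Y)$, $\mathbf N=\mathbf R(\mathbf X,\mathbf Y)$, i.e. $\mathfrak N^p_q=\sum_{i,j}\mathfrak R^p_{qij}X^iY^j$ etc.; let $\mathbf U=\nabla_{\mathbf X}\mathbf Y-\nabla_{\mathbf Y}\mathbf X-\mathbf T(\mathbf X,\mathbf Y)$ with $\mathbf T(\mathbf X,\mathbf Y)^k=\sum_{i,j}T^k_{ij}X^iY^j$; and let $\mathbf U[Q]=-D(\mathfrak N,\bar{\mathfrak N},\mathbf N)\mathbf S[Q]$, $\bar{\mathbf U}[Q]=-D(\mathfrak N,\bar{\mathfrak N},\mathbf N)\,\tau(\mathbf S[Q])$. Then on smooth extended spin-tensorial fields of every type $$[\nabla_{\mathbf X},\nabla_{\mathbf Y}]=\nabla_{\mathbf U}+\sum_{Q=1}^J\nabla_{\mathbf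 U[Q]}[Q]+\sum_{Q=1}^J\bar\nabla_{\bar{\mathbf U}[Q]}[Q]+D(\mathfrak N,\bar{\mathfrak N},\mathbf N).$$ -/

import Mathlib

open Bundle Module
open scoped Manifold ContDiff TensorProduct BigOperators

namespace SpinExt

noncomputable section

/-! ### The underlying real bundle of a complex vector bundle -/

section RealBundle

variable {B : Type*} [TopologicalSpace B] {F : Type*} [NormedAddCommGroup F] [NormedSpace ℂ F]
  {E : B → Type*} [TopologicalSpace (TotalSpace F E)] [∀ x, AddCommGroup (E x)]
  [∀ x, Module ℂ (E x)] [∀ x, TopologicalSpace (E x)] [FiberBundle F E]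

set_option linter.unusedSectionVars false in
theorem isLinear_real (e : Trivialization F (π F E)) [e.IsLinear ℂ] : e.IsLinear ℝ where
  linear := fun b hb =>
    { map_add := (e.linear ℂ hb).map_add
      map_smul := fun c x => by
        have h := (e.linear ℂ hb).map_smul (c : ℂ) x
        simpa using h }

/-- A complex vector bundle is a real vector bundle. -/
instance realVectorBundle [VectorBundle ℂ F E] : VectorBundle ℝ F E where
  trivialization_linear' e _ := isLinear_real e
  continuousOn_coordChange' e e' he he' := by
    have := isLinear_real e
    have := isLinear_real e'
    have h := (ContinuousLinearMap.restrictScalarsL ℂ F F ℝ ℝ).continuous.comp_continuousOn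
      (continuousOn_coordChange ℂ e e')
    refine h.congr fun b hb => ?_
    ext x
    simp only [Function.comp, ContinuousLinearEquiv.coe_coe]
    rw [Trivialization.coordChangeL_apply _ _ hb]
    exact (Trivialization.coordChangeL_apply (R := ℂ) _ _ hb _).symm

end RealBundle

/-! ### Spin-tensors at a point -/

/-- The six kinds of indices of a spin-tensor: upper and lower spinor indices, upper and lower
barred spinor indices, upper and lower space-time indices. -/
inductive Kind
  | spinor | cospinor | barSpinor | barCospinor | vector | covector
  deriving DecidableEq

instance : Fintype Kind where
  elems := {.spinor, .cospinor, .barSpinor, .barCospinor, .vector, .covector}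
  complete := fun k => by cases k <;> decide

/-- The range of an index of the given kind. -/
def Kind.dim : Kind → ℕ
  | .spinor => 2
  | .cospinor => 2
  | .barSpinor => 2
  | .barCospinor => 2
  | .vector => 4
  | .covector => 4

/-- Complex conjugation exchanges barred and non-barred indices. -/
def Kind.conj : Kind → Kind
  | .spinor => .barSpinor
  | .cospinor => .barCospinor
  | .barSpinor => .spinor
  | .barCospinor => .cospinor
  | .vector => .vector
  | .covector => .covector

/-- The type of a spin-tensor: the number of indices of each kind. -/
abbrev SType := Kind → ℕ

/-- The type `(α, β | ν, γ | m, n)`. -/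
def mkType (α β ν γ m n : ℕ) : SType
  | .spinor => α
  | .cospinor => β
  | .barSpinor => ν
  | .barCospinor => γ
  | .vector => m
  | .covector => n

/-- The type `(ν, γ | α, β | m, n)` conjugate to the type `t = (α, β | ν, γ | m, n)`. -/
def conjType (t : SType) : SType := fun k => t k.conj

/-- The multi-indices numbering the components of spin-tensors of type `t`. -/
abbrev Idx (t : SType) := ∀ k : Kind, Fin (t k) → Fin k.dim

/-- The multi-index of type `(α, β | ν, γ | m, n)` with the given six groups of indices. -/
def mkIdx {α β ν γ m n : ℕ} (i : Fin α → Fin 2) (j : Fin β → Fin 2) (i' : Fin ν → Fin 2)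
    (j' : Fin γ → Fin 2) (h : Fin m → Fin 4) (k : Fin n → Fin 4) : Idx (mkType α β ν γ m n)
  | .spinor => i
  | .cospinor => j
  | .barSpinor => i'
  | .barCospinor => j'
  | .vector => h
  | .covector => k

/-- Exchange of the barred and the non-barred groups of indices. -/
def swapIdx {t : SType} (a : Idx (conjType t)) : Idx t
  | .spinor => a .barSpinor
  | .cospinor => a .barCospinor
  | .barSpinor => a .spinor
  | .barCospinor => a .cospinor
  | .vector => a .vector
  | .covector => a .covector

/-- Replace the `μ`-th index of kind `k` by `v`. -/
def replaceIdx {t : SType} (a : Idx t) (k : Kind) (μ : Fin (t k)) (v : Fin k.dim) : Idx t :=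
  Function.update a k (Function.update (a k) μ v)

/-- The components of `τ X`: barred and non-barred indices are exchanged and the components
are conjugated. -/
def tauComp {t : SType} (X : Idx t → ℂ) : Idx (conjType t) → ℂ :=
  fun a => starRingEnd ℂ (X (swapIdx a))

/-- The matrix acting on an index of a given kind: upper indices are acted upon by the matrix
itself, lower indices by minus its transpose. -/
def kindMatrix (𝔖 𝔖' : Matrix (Fin 2) (Fin 2) ℂ) (S : Matrix (Fin 4) (Fin 4) ℂ) :
    ∀ k : Kind, Matrix (Fin k.dim) (Fin k.dim) ℂ
  | .spinor => 𝔖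
  | .cospinor => -𝔖.transpose
  | .barSpinor => 𝔖'
  | .barCospinor => -𝔖'.transpose
  | .vector => S
  | .covector => -S.transpose

/-- The components of `D(𝔖, 𝔖', S) X`. Here `𝔖 a v` is the component with upper index `a` and
lower index `v`; the sum over all indices of `X` consists of `+ 𝔖^a_v X^{..v..}` for each upper
index `a` of `X` and of `- 𝔖^w_b X_{..w..}` for each lower index `b` of `X`. -/
def degComp (𝔖 𝔖' : Matrix (Fin 2) (Fin 2) ℂ) (S : Matrix (Fin 4) (Fin 4) ℂ) {t : SType}
    (X : Idx t → ℂ) : Idx t → ℂ :=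
  fun a => ∑ k : Kind, ∑ μ : Fin (t k), ∑ v : Fin k.dim,
    kindMatrix 𝔖 𝔖' S k (a k μ) v * X (replaceIdx a k μ v)

/-- The basis of the Hermitian conjugate space (the space of semilinear functionals) formed by
the functionals `v ↦ conj (b.coord i v)`. -/
def hermBasis {V : Type*} [AddCommGroup V] [Module ℂ V] (b : Basis (Fin 2) ℂ V) :
    Basis (Fin 2) ℂ (V →ₛₗ[starRingEnd ℂ] ℂ) :=
  Basis.ofEquivFun
    { toFun := fun f i => f (b i)
      map_add' := fun _ _ => rfl
      map_smul' := fun _ _ => rfl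
      invFun := fun c =>
        { toFun := fun v => ∑ i, starRingEnd ℂ (b.repr v i) * c i
          map_add' := fun v w => by
            simp [add_mul, Finset.sum_add_distrib]
          map_smul' := fun r v => by
            simp [mul_assoc, mul_add] }
      left_inv := fun f => by
        ext v
        conv_rhs => rw [← b.sum_repr v]
        simp [-Basis.sum_repr]
      right_inv := fun c => by
        funext i
        have h : ∀ j, starRingEnd ℂ (b.repr (b i) j) * c j = if i = j then c j else 0 := by
          intro j
          rw [Basis.repr_self, Finsupp.single_apply]
          split_ifs <;> simp
        show ∑ j, starRingEnd ℂ (b.repr (b i) j) * c j = c i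
        simp_rw [h]
        simp }

section Point

universe u v

variable {M : Type u} [TopologicalSpace M] [ChartedSpace (EuclideanSpace ℝ (Fin 4)) M]
  (S : M → Type v) [∀ p, AddCommGroup (S p)] [∀ p, Module ℂ (S p)]

/-- The vector space over `p` corresponding to an index of a given kind: `S_p`, its dual `S_p^*`,
the dual `S_p^{†*}` of the Hermitian conjugate space, the Hermitian conjugate space `S_p^†`, the
complexified tangent space, and the complexified cotangent space. -/
def IndexSpace (p : M) : Kind → Type v
  | .spinor => S p
  | .cospinor => Dual ℂ (S p)
  | .barSpinor => Dual ℂ (S p →ₛₗ[starRingEnd ℂ] ℂ)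
  | .barCospinor => S p →ₛₗ[starRingEnd ℂ] ℂ
  | .vector => ULift.{v} (ℂ ⊗[ℝ] TangentSpace (𝓡 4) p)
  | .covector => ULift.{v} (ℂ ⊗[ℝ] Dual ℝ (TangentSpace (𝓡 4) p))

instance (p : M) (k : Kind) : AddCommGroup (IndexSpace S p k) := by
  cases k
  · exact inferInstanceAs (AddCommGroup (S p))
  · exact inferInstanceAs (AddCommGroup (Dual ℂ (S p)))
  · exact inferInstanceAs (AddCommGroup (Dual ℂ (S p →ₛₗ[starRingEnd ℂ] ℂ)))
  · exact inferInstanceAs (AddCommGroup (S p →ₛₗ[starRingEnd ℂ] ℂ))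
  · exact inferInstanceAs (AddCommGroup (ULift.{v} (ℂ ⊗[ℝ] TangentSpace (𝓡 4) p)))
  · exact inferInstanceAs (AddCommGroup (ULift.{v} (ℂ ⊗[ℝ] Dual ℝ (TangentSpace (𝓡 4) p))))

instance (p : M) (k : Kind) : Module ℂ (IndexSpace S p k) := by
  cases k
  · exact inferInstanceAs (Module ℂ (S p))
  · exact inferInstanceAs (Module ℂ (Dual ℂ (S p)))
  · exact inferInstanceAs (Module ℂ (Dual ℂ (S p →ₛₗ[starRingEnd ℂ] ℂ)))
  · exact inferInstanceAs (Module ℂ (S p →ₛₗ[starRingEnd ℂ] ℂ))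
  · exact inferInstanceAs (Module ℂ (ULift.{v} (ℂ ⊗[ℝ] TangentSpace (𝓡 4) p)))
  · exact inferInstanceAs (Module ℂ (ULift.{v} (ℂ ⊗[ℝ] Dual ℝ (TangentSpace (𝓡 4) p))))

/-- The space of spin-tensors of type `t` at `p`: the tensor product over `ℂ` of the spaces
corresponding to all indices. -/
abbrev SpinTensor (t : SType) (p : M) := ⨂[ℂ] s : (Σ k : Kind, Fin (t k)), IndexSpace S p s.1

variable {S}

/-- The basis of the space corresponding to an index of a given kind, given by a basis `Ψ` of the
spinor space and a basis `Υ` of the tangent space. -/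
def indexBasis {p : M} (Ψ : Basis (Fin 2) ℂ (S p)) (Υ : Basis (Fin 4) ℝ (TangentSpace (𝓡 4) p)) :
    ∀ k : Kind, Basis (Fin k.dim) ℂ (IndexSpace S p k)
  | .spinor => Ψ
  | .cospinor => Ψ.dualBasis
  | .barSpinor => (hermBasis Ψ).dualBasis
  | .barCospinor => hermBasis Ψ
  | .vector => (Υ.baseChange ℂ).map ULift.moduleEquiv.symm
  | .covector => (Υ.dualBasis.baseChange ℂ).map ULift.moduleEquiv.symm

/-- The basis of the space of spin-tensors formed by tensor products of basic vectors. -/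
def spinTensorBasis {p : M} (Ψ : Basis (Fin 2) ℂ (S p))
    (Υ : Basis (Fin 4) ℝ (TangentSpace (𝓡 4) p)) (t : SType) :
    Basis (Idx t) ℂ (SpinTensor S t p) :=
  (Basis.piTensorProduct fun s : (Σ k : Kind, Fin (t k)) => indexBasis Ψ Υ s.1).reindex
    (Equiv.piCurry fun (k : Kind) (_ : Fin (t k)) => Fin k.dim)

end Point

/-! ### Space-time with a spinor structure -/

/-- The Pauli matrices together with the unit matrix. -/
def pauli : Fin 4 → Matrix (Fin 2) (Fin 2) ℂ :=
  ![!![1, 0; 0, 1], !![0, 1; 1, 0], !![0, -Complex.I; Complex.I, 0], !![1, 0; 0, -1]]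

/-- The canonical homomorphism from `SL(2, ℂ)` to the special orthochronous Lorentz group:
`φ(𝔖)^i_j = ½ tr(σ_i 𝔖 σ_j 𝔖†)`. -/
def lorentz (𝔖 : Matrix (Fin 2) (Fin 2) ℂ) : Matrix (Fin 4) (Fin 4) ℝ :=
  fun i j => ((1 / 2 : ℂ) * (pauli i * 𝔖 * pauli j * 𝔖.conjTranspose).trace).re

/-- The Minkowski matrix. -/
def minkowski : Matrix (Fin 4) (Fin 4) ℝ := Matrix.diagonal ![1, -1, -1, -1]

section Geometry

universe u v

variable (M : Type u) [TopologicalSpace M] [ChartedSpace (EuclideanSpace ℝ (Fin 4)) M]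
  [IsManifold (𝓡 4) ∞ M]
  (S : M → Type v) [∀ p, AddCommGroup (S p)] [∀ p, Module ℂ (S p)]
  [∀ p, TopologicalSpace (S p)] [TopologicalSpace (TotalSpace (Fin 2 → ℂ) S)]
  [FiberBundle (Fin 2 → ℂ) S] [VectorBundle ℂ (Fin 2 → ℂ) S]
  [ContMDiffVectorBundle ∞ (Fin 2 → ℂ) S (𝓡 4)]

variable {M} in
/-- A vector field is smooth on a set. -/
def SmoothVectorOn (V : ∀ p : M, TangentSpace (𝓡 4) p) (U : Set M) : Prop :=
  ContMDiffOn (𝓡 4) (𝓡 4).tangent ∞ (fun p => (⟨p, V p⟩ : TangentBundle (𝓡 4) M)) U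

variable {M S} in
/-- A section of the spinor bundle is smooth on a set. -/
def SmoothSpinorOn (ψ : ∀ p : M, S p) (U : Set M) : Prop :=
  ContMDiffOn (𝓡 4) ((𝓡 4).prod 𝓘(ℝ, Fin 2 → ℂ)) ∞
    (fun p => (⟨p, ψ p⟩ : TotalSpace (Fin 2 → ℂ) S)) U

/-- A space-time structure on `M` (a Minkowski-type metric, an orientation, and a polarization)
together with the structure of a spinor bundle on the two-dimensional complex bundle `S`. -/
structure SpinorSpacetime where
  /-- the metric tensor -/
  g : ∀ p : M, TangentSpace (𝓡 4) p →ₗ[ℝ] TangentSpace (𝓡 4) p →ₗ[ℝ] ℝ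
  g_smooth : ∀ (U : Set M) (V W : ∀ p : M, TangentSpace (𝓡 4) p), IsOpen U →
    SmoothVectorOn V U → SmoothVectorOn W U →
      ContMDiffOn (𝓡 4) 𝓘(ℝ, ℝ) ∞ (fun p => g p (V p) (W p)) U
  g_minkowski : ∀ p, ∃ b : Basis (Fin 4) ℝ (TangentSpace (𝓡 4) p),
    ∀ i j, g p (b i) (b j) = minkowski i j
  /-- the orientation -/
  orientation : ∀ p : M, Orientation ℝ (TangentSpace (𝓡 4) p) (Fin 4)
  orientation_smooth : ∀ p₀ : M, ∃ (U : Set M)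
    (b : ∀ p : M, Basis (Fin 4) ℝ (TangentSpace (𝓡 4) p)), IsOpen U ∧ p₀ ∈ U ∧
      (∀ i, SmoothVectorOn (fun p => b p i) U) ∧ ∀ p ∈ U, (b p).orientation = orientation p
  /-- the polarization: the interior of the Future light cone at each point -/
  future : ∀ p : M, Set (TangentSpace (𝓡 4) p)
  future_smooth : ∀ p₀ : M, ∃ (U : Set M) (W : ∀ p : M, TangentSpace (𝓡 4) p),
    IsOpen U ∧ p₀ ∈ U ∧ SmoothVectorOn W U ∧
      ∀ p ∈ U, 0 < g p (W p) (W p) ∧ future p = {v | 0 < g p v v ∧ 0 < g p (W p) v}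
  /-- the spin-metric tensor -/
  d : ∀ p : M, S p →ₗ[ℂ] S p →ₗ[ℂ] ℂ
  d_smooth : ∀ (U : Set M) (φ ψ : ∀ p : M, S p), IsOpen U →
    SmoothSpinorOn φ U → SmoothSpinorOn ψ U →
      ContMDiffOn (𝓡 4) 𝓘(ℝ, ℂ) ∞ (fun p => d p (φ p) (ψ p)) U
  d_skew : ∀ p φ ψ, d p φ ψ = -d p ψ φ
  d_ne_zero : ∀ p, d p ≠ 0
  /-- the tangent frame associated with an orthonormal spinor frame -/
  assoc : ∀ p : M, Basis (Fin 2) ℂ (S p) → Basis (Fin 4) ℝ (TangentSpace (𝓡 4) p)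
  assoc_future : ∀ p Ψ, d p (Ψ 0) (Ψ 1) = 1 → assoc p Ψ 0 ∈ future p
  assoc_right : ∀ p Ψ, d p (Ψ 0) (Ψ 1) = 1 → (assoc p Ψ).orientation = orientation p
  assoc_orthonormal : ∀ p Ψ, d p (Ψ 0) (Ψ 1) = 1 →
    ∀ i j, g p (assoc p Ψ i) (assoc p Ψ j) = minkowski i j
  assoc_smooth : ∀ (U : Set M) (Ψ : ∀ p : M, Basis (Fin 2) ℂ (S p)), IsOpen U →
    (∀ i, SmoothSpinorOn (fun p => Ψ p i) U) → (∀ p ∈ U, d p (Ψ p 0) (Ψ p 1) = 1) →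
      ∀ i, SmoothVectorOn (fun p => assoc p (Ψ p) i) U
  assoc_lorentz : ∀ p Ψ Ψ', d p (Ψ 0) (Ψ 1) = 1 → d p (Ψ' 0) (Ψ' 1) = 1 →
    (assoc p Ψ).toMatrix (assoc p Ψ') = lorentz (Ψ.toMatrix Ψ')

variable {M S}
variable (𝓢 : SpinorSpacetime M S)

/-- An equipped local chart: a chart together with a smooth orthonormal spinor frame over its
domain. (The values of the frame outside of the domain are irrelevant.) -/
structure EquippedChart where
  chart : OpenPartialHomeomorph M (EuclideanSpace ℝ (Fin 4))
  chart_mem : chart ∈ IsManifold.maximalAtlas (𝓡 4) ∞ M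
  spinFrame : ∀ p : M, Basis (Fin 2) ℂ (S p)
  spinFrame_smooth : ∀ i, SmoothSpinorOn (fun p => spinFrame p i) chart.source
  spinFrame_orthonormal : ∀ p ∈ chart.source, 𝓢.d p (spinFrame p 0) (spinFrame p 1) = 1

variable {𝓢}

namespace EquippedChart

/-- The tangent frame of an equipped chart. -/
def tanFrame (e : EquippedChart 𝓢) (p : M) : Basis (Fin 4) ℝ (TangentSpace (𝓡 4) p) :=
  𝓢.assoc p (e.spinFrame p)

/-- The frame of spin-tensors of an equipped chart. -/
def basis (e : EquippedChart 𝓢) (t : SType) (p : M) : Basis (Idx t) ℂ (SpinTensor S t p) :=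
  spinTensorBasis (e.spinFrame p) (e.tanFrame p) t

/-- The coefficient `Υ^k_j` of the expansion of the frame vector `Υ_j` in the coordinate vectors,
at the point with coordinates `x`. -/
def upsilon (e : EquippedChart 𝓢) (j k : Fin 4) (x : EuclideanSpace ℝ (Fin 4)) : ℝ :=
  (show EuclideanSpace ℝ (Fin 4) from
    mfderiv (𝓡 4) (𝓡 4) e.chart (e.chart.symm x) (e.tanFrame (e.chart.symm x) j)) k

/-- The derivative of a scalar function on `M` along the frame vector `Υ_j`. -/
def lieD (e : EquippedChart 𝓢) (j : Fin 4) (f : M → ℂ) (p : M) : ℂ :=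
  ∑ k : Fin 4, (e.upsilon j k (e.chart p) : ℂ) *
    fderiv ℝ (fun x => f (e.chart.symm x)) (e.chart p) (EuclideanSpace.single k 1)

/-- The structural functions `c^k_{ij}` of the tangent frame, `[Υ_i, Υ_j] = ∑ c^k_{ij} Υ_k`. -/
def structC (e : EquippedChart 𝓢) (k i j : Fin 4) (p : M) : ℝ :=
  (e.tanFrame p).repr (VectorField.mlieBracket (𝓡 4) (fun x => e.tanFrame x i)
    (fun x => e.tanFrame x j) p) k

/-- The transition matrix `𝔖`: the `i`-th vector of the spinor frame of `e'` is
`∑ j, 𝔖 j i • Ψ_j`, where `Ψ_j` are the vectors of the spinor frame of `e`. -/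
def spinTrans (e e' : EquippedChart 𝓢) (p : M) : Matrix (Fin 2) (Fin 2) ℂ :=
  (e.spinFrame p).toMatrix (e'.spinFrame p)

/-- The transition matrix of the tangent frames, with complex entries. -/
def tanTrans (e e' : EquippedChart 𝓢) (p : M) : Matrix (Fin 4) (Fin 4) ℂ :=
  ((e.tanFrame p).toMatrix (e'.tanFrame p)).map (fun r : ℝ => (r : ℂ))

/-- The parameters `ϑ^k_{ij} = ∑ a, 𝔖^k_a L_{Υ_i}(𝔗^a_j)` of the spinor frames, where `𝔗` is
inverse to `𝔖`. -/
def spinTheta (e e' : EquippedChart 𝓢) (k : Fin 2) (i : Fin 4) (j : Fin 2) (p : M) : ℂ :=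
  ∑ a : Fin 2, spinTrans e e' p k a * e.lieD i (fun p' => spinTrans e' e p' a j) p

/-- The parameters `θ^k_{ij} = ∑ a, S^k_a L_{Υ_i}(T^a_j)` of the tangent frames, where `T` is
inverse to `S`. -/
def tanTheta (e e' : EquippedChart 𝓢) (k i j : Fin 4) (p : M) : ℂ :=
  ∑ a : Fin 4, tanTrans e e' p k a * e.lieD i (fun p' => tanTrans e' e p' a j) p

end EquippedChart

/-! ### Composite spin-tensorial bundles and extended spin-tensorial fields -/

variable (S) in
/-- The composite spin-tensorial bundle: its points are lists `(p, S[1], …, S[J])` consisting of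
a point `p` and of spin-tensors `S[P]` of types `ty P` at this point. -/
abbrev Composite {J : ℕ} (ty : Fin J → SType) := Σ p : M, ∀ P : Fin J, SpinTensor S (ty P) p

/-- The space where the local coordinates `x^k` and the components of `S[1], …, S[J]` vary. -/
abbrev Coord {J : ℕ} (ty : Fin J → SType) :=
  EuclideanSpace ℝ (Fin 4) × (∀ P : Fin J, Idx (ty P) → ℂ)

variable (S) in
/-- Extended spin-tensorial fields of type `t`. Smoothness is the separate property
`ExtField.Smooth`. -/
abbrev ExtField {J : ℕ} (ty : Fin J → SType) (t : SType) :=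
  ∀ q : Composite S ty, SpinTensor S t q.1

variable {J : ℕ} {ty : Fin J → SType} {t : SType}

namespace EquippedChart

/-- The local coordinates of a point of the composite bundle. -/
def coord (e : EquippedChart 𝓢) (q : Composite S ty) : Coord ty :=
  (e.chart q.1, fun P => (e.basis (ty P) q.1).equivFun (q.2 P))

/-- The point of the composite bundle with given local coordinates. -/
def point (e : EquippedChart 𝓢) (z : Coord ty) : Composite S ty :=
  ⟨e.chart.symm z.1, fun P => (e.basis (ty P) (e.chart.symm z.1)).equivFun.symm (z.2 P)⟩

variable (ty) in
/-- The set of the values of the local coordinates. -/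
def dom (e : EquippedChart 𝓢) : Set (Coord ty) := {z | z.1 ∈ e.chart.target}

end EquippedChart

/-- The components of an extended spin-tensorial field in an equipped chart, as functions of the
local coordinates. -/
def ExtField.rep (X : ExtField S ty t) (e : EquippedChart 𝓢) : Coord ty → Idx t → ℂ :=
  fun z => (e.basis t (e.point z).1).equivFun (X (e.point z))

variable (𝓢) in
/-- Smooth extended spin-tensorial fields: the components in equipped charts are smooth. -/
def ExtField.Smooth (X : ExtField S ty t) : Prop :=
  ∀ e : EquippedChart 𝓢, ContDiffOn ℝ ∞ (X.rep e) (e.dom ty)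

/-- The field `X` is represented by the functions `F e` in each equipped chart `e`. -/
def IsRep (F : EquippedChart 𝓢 → Coord ty → Idx t → ℂ) (X : ExtField S ty t) : Prop :=
  ∀ e : EquippedChart 𝓢, ∀ z ∈ e.dom ty, X.rep e z = F e z

open Classical in
/-- The field given by its components `F e` in equipped charts: its value at a point is defined
by means of a chosen equipped chart around this point. If the functions `F e` transform as the
components of a spin-tensor, then `IsRep F (ofLocal F)` holds, i.e. the choice does not matter. -/
def ofLocal (F : EquippedChart 𝓢 → Coord ty → Idx t → ℂ) : ExtField S ty t := fun q =>
  if h : ∃ e : EquippedChart 𝓢, q.1 ∈ e.chart.source then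
    (h.choose.basis t q.1).equivFun.symm (F h.choose (h.choose.coord q))
  else 0

/-- The native field `S[P]`. -/
def nativeField (P : Fin J) : ExtField S ty (ty P) := fun q => q.2 P

/-! ### Partial derivatives in local coordinates -/

/-- `∂f/∂x^k`. -/
def dX (k : Fin 4) (f : Coord ty → ℂ) (z : Coord ty) : ℂ :=
  fderiv ℝ f z (EuclideanSpace.single k 1, 0)

/-- The coordinate increment which adds `c` to the component of `S[P]` with multi-index `a`. -/
def incr (P : Fin J) (a : Idx (ty P)) (c : ℂ) : Coord ty :=
  (0, Pi.single P (Pi.single a c))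

/-- The complex derivative `∂f/∂S^a[P]`. -/
def dS (P : Fin J) (a : Idx (ty P)) (f : Coord ty → ℂ) (z : Coord ty) : ℂ :=
  (1 / 2) * (fderiv ℝ f z (incr P a 1) - Complex.I * fderiv ℝ f z (incr P a Complex.I))

/-- The complex derivative with respect to the conjugate of `S^a[P]`. -/
def dSbar (P : Fin J) (a : Idx (ty P)) (f : Coord ty → ℂ) (z : Coord ty) : ℂ :=
  (1 / 2) * (fderiv ℝ f z (incr P a 1) + Complex.I * fderiv ℝ f z (incr P a Complex.I))

/-- `∑ k, Υ^k_j ∂f/∂x^k`. -/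
def EquippedChart.frameD (e : EquippedChart 𝓢) (j : Fin 4) (f : Coord ty → ℂ) (z : Coord ty) : ℂ :=
  ∑ k : Fin 4, (e.upsilon j k z.1 : ℂ) * dX k f z

/-! ### Degenerate and native multivariate differentiations -/

/-- The type `(0,0|0,0|1,0)` of vector fields. -/
abbrev tyVector : SType := mkType 0 0 0 0 1 0

/-- The type `(1,1|0,0|0,0)` of operator fields in spinors. -/
abbrev tySpinOp : SType := mkType 1 1 0 0 0 0

/-- The type `(0,0|1,1|0,0)` of operator fields in barred spinors. -/
abbrev tyBarOp : SType := mkType 0 0 1 1 0 0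

/-- The type `(0,0|0,0|1,1)` of operator fields in vectors. -/
abbrev tyVecOp : SType := mkType 0 0 0 0 1 1

/-- The component `X^j` of a vector. -/
def vecComp (X : Idx tyVector → ℂ) (j : Fin 4) : ℂ := X (mkIdx ![] ![] ![] ![] ![j] ![])

/-- The matrix (upper index, lower index) of a spin-tensor of type `(1,1|0,0|0,0)`. -/
def spinOpMatrix (X : Idx tySpinOp → ℂ) : Matrix (Fin 2) (Fin 2) ℂ :=
  fun p q => X (mkIdx ![p] ![q] ![] ![] ![] ![])

/-- The matrix (upper index, lower index) of a spin-tensor of type `(0,0|1,1|0,0)`. -/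
def barOpMatrix (X : Idx tyBarOp → ℂ) : Matrix (Fin 2) (Fin 2) ℂ :=
  fun p q => X (mkIdx ![] ![] ![p] ![q] ![] ![])

/-- The matrix (upper index, lower index) of a spin-tensor of type `(0,0|0,0|1,1)`. -/
def vecOpMatrix (X : Idx tyVecOp → ℂ) : Matrix (Fin 4) (Fin 4) ℂ :=
  fun p q => X (mkIdx ![] ![] ![] ![] ![p] ![q])

/-- The local expression of `D(𝔖, 𝔖', R) X`. -/
def degLocal (𝔖 : ExtField S ty tySpinOp) (𝔖' : ExtField S ty tyBarOp) (R : ExtField S ty tyVecOp)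
    (X : ExtField S ty t) (e : EquippedChart 𝓢) (z : Coord ty) : Idx t → ℂ :=
  degComp (spinOpMatrix (𝔖.rep e z)) (barOpMatrix (𝔖'.rep e z)) (vecOpMatrix (R.rep e z))
    (X.rep e z)

variable (𝓢) in
/-- The degenerate differentiation `D(𝔖, 𝔖', R)`. -/
def deg (𝔖 : ExtField S ty tySpinOp) (𝔖' : ExtField S ty tyBarOp) (R : ExtField S ty tyVecOp)
    (X : ExtField S ty t) : ExtField S ty t :=
  ofLocal (𝓢 := 𝓢) (degLocal 𝔖 𝔖' R X)

/-- The local expression of `τ X`. -/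
def tauLocal (X : ExtField S ty t) (e : EquippedChart 𝓢) (z : Coord ty) : Idx (conjType t) → ℂ :=
  tauComp (X.rep e z)

variable (𝓢) in
/-- The canonical semilinear isomorphism `τ` applied to an extended field. -/
def tau (X : ExtField S ty t) : ExtField S ty (conjType t) :=
  ofLocal (𝓢 := 𝓢) (tauLocal X)

/-- The local expression of the `P`-th native multivariate derivative of `Z` along `Y`. -/
def vertLocal (P : Fin J) (Y : ExtField S ty (ty P)) (Z : ExtField S ty t)
    (e : EquippedChart 𝓢) (z : Coord ty) : Idx t → ℂ :=
  fun a => ∑ b : Idx (ty P), Y.rep e z b * dS P b (fun w => Z.rep e w a) z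

variable (𝓢) in
/-- The `P`-th native multivariate differentiation along `Y`. -/
def vert (P : Fin J) (Y : ExtField S ty (ty P)) (Z : ExtField S ty t) : ExtField S ty t :=
  ofLocal (𝓢 := 𝓢) (vertLocal P Y Z)

/-- The local expression of the `P`-th barred native multivariate derivative of `Z` along `Y`. -/
def vertBarLocal (P : Fin J) (Y : ExtField S ty (conjType (ty P))) (Z : ExtField S ty t)
    (e : EquippedChart 𝓢) (z : Coord ty) : Idx t → ℂ :=
  fun a => ∑ b : Idx (conjType (ty P)),
    Y.rep e z b * dSbar P (swapIdx b) (fun w => Z.rep e w a) z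

variable (𝓢) in
/-- The `P`-th barred native multivariate differentiation along `Y`. -/
def vertBar (P : Fin J) (Y : ExtField S ty (conjType (ty P))) (Z : ExtField S ty t) :
    ExtField S ty t :=
  ofLocal (𝓢 := 𝓢) (vertBarLocal P Y Z)

/-! ### Extended spinor connections and spatial covariant differentiations -/

variable (𝓢 ty) in
/-- Extended spinor connections. In each equipped chart a connection is given by components
`A^k_{ji} = A e z j k i`, `Ā^k_{ji} = A' e z j k i`, `Γ^k_{ji} = Γ e z j k i`, which are smooth
functions of the local coordinates `z` and which obey the transformation laws. -/
structure SpinorConnection where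
  A : EquippedChart 𝓢 → Coord ty → Fin 4 → Matrix (Fin 2) (Fin 2) ℂ
  A' : EquippedChart 𝓢 → Coord ty → Fin 4 → Matrix (Fin 2) (Fin 2) ℂ
  Γ : EquippedChart 𝓢 → Coord ty → Fin 4 → Matrix (Fin 4) (Fin 4) ℂ
  A_smooth : ∀ e j k i, ContDiffOn ℝ ∞ (fun z => A e z j k i) (e.dom ty)
  A'_smooth : ∀ e j k i, ContDiffOn ℝ ∞ (fun z => A' e z j k i) (e.dom ty)
  Γ_smooth : ∀ e j k i, ContDiffOn ℝ ∞ (fun z => Γ e z j k i) (e.dom ty)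
  A_trans : ∀ (e e' : EquippedChart 𝓢) (q : Composite S ty),
    q.1 ∈ e.chart.source → q.1 ∈ e'.chart.source → ∀ j k i,
      A e (e.coord q) j k i =
        ∑ b : Fin 2, ∑ a : Fin 2, ∑ c : Fin 4,
          e.spinTrans e' q.1 k a * e'.spinTrans e q.1 b i * e'.tanTrans e q.1 c j *
            A e' (e'.coord q) c a b
        + e.spinTheta e' k j i q.1
  A'_trans : ∀ (e e' : EquippedChart 𝓢) (q : Composite S ty),
    q.1 ∈ e.chart.source → q.1 ∈ e'.chart.source → ∀ j k i,
      A' e (e.coord q) j k i =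
        ∑ b : Fin 2, ∑ a : Fin 2, ∑ c : Fin 4,
          starRingEnd ℂ (e.spinTrans e' q.1 k a) * starRingEnd ℂ (e'.spinTrans e q.1 b i) *
            e'.tanTrans e q.1 c j * A' e' (e'.coord q) c a b
        + starRingEnd ℂ (e.spinTheta e' k j i q.1)
  Γ_trans : ∀ (e e' : EquippedChart 𝓢) (q : Composite S ty),
    q.1 ∈ e.chart.source → q.1 ∈ e'.chart.source → ∀ j k i,
      Γ e (e.coord q) j k i =
        ∑ b : Fin 4, ∑ a : Fin 4, ∑ c : Fin 4,
          e.tanTrans e' q.1 k a * e'.tanTrans e q.1 b i * e'.tanTrans e q.1 c j *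
            Γ e' (e'.coord q) c a b
        + e.tanTheta e' k j i q.1

namespace SpinorConnection

variable (C : SpinorConnection 𝓢 ty)

/-- The action of `A_j`, `Ā_j`, `Γ_j` on all indices of a spin-tensor. -/
def act (e : EquippedChart 𝓢) (j : Fin 4) (z : Coord ty) {t : SType} (X : Idx t → ℂ) :
    Idx t → ℂ :=
  degComp (C.A e z j) (C.A' e z j) (C.Γ e z j) X

/-- The sum of the terms with the derivatives `∂f/∂S[P]` in the spatial covariant derivative,
without the minus sign. -/
def fiberD (e : EquippedChart 𝓢) (j : Fin 4) (f : Coord ty → ℂ) (z : Coord ty) : ℂ :=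
  ∑ P : Fin J, ∑ b : Idx (ty P), C.act e j z (z.2 P) b * dS P b f z

/-- The sum of the terms with the derivatives with respect to the conjugates of the components of
`S[P]` in the spatial covariant derivative, without the minus sign. -/
def fiberDbar (e : EquippedChart 𝓢) (j : Fin 4) (f : Coord ty → ℂ) (z : Coord ty) : ℂ :=
  ∑ P : Fin J, ∑ b : Idx (conjType (ty P)),
    C.act e j z (tauComp (z.2 P)) b * dSbar P (swapIdx b) f z

/-- The spatial covariant derivative `∇_j` in local coordinates. -/
def nablaComp (e : EquippedChart 𝓢) (j : Fin 4) (Z : Coord ty → Idx t → ℂ) (z : Coord ty) :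
    Idx t → ℂ :=
  fun a => e.frameD j (fun w => Z w a) z - C.fiberD e j (fun w => Z w a) z
    - C.fiberDbar e j (fun w => Z w a) z + C.act e j z (Z z) a

/-- The local expression `∑ j, X^j ∇_j Z` of `∇_X Z`. -/
def nablaLocal (X : ExtField S ty tyVector) (Z : ExtField S ty t) (e : EquippedChart 𝓢)
    (z : Coord ty) : Idx t → ℂ :=
  fun a => ∑ j : Fin 4, vecComp (X.rep e z) j * C.nablaComp e j (Z.rep e) z a

/-- The spatial covariant differentiation `∇_X`. -/
def nabla (X : ExtField S ty tyVector) (Z : ExtField S ty t) : ExtField S ty t :=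
  ofLocal (C.nablaLocal X Z)

/-! ### Torsion and curvature -/

/-- The components `T^k_{ij} = Γ^k_{ij} - Γ^k_{ji} - c^k_{ij}` of the torsion. -/
def torsionComp (e : EquippedChart 𝓢) (z : Coord ty) (k i j : Fin 4) : ℂ :=
  C.Γ e z i k j - C.Γ e z j k i - (e.structC k i j (e.chart.symm z.1) : ℂ)

/-- The components `R^p_{qij}` of the curvature of one of the three parts `B = A`, `B = Ā`, or
`B = Γ` of the connection, `B^p_{jq}(z) = B z j p q`. -/
def curvComp {n : ℕ} (B : Coord ty → Fin 4 → Matrix (Fin n) (Fin n) ℂ) (e : EquippedChart 𝓢)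
    (z : Coord ty) (p q : Fin n) (i j : Fin 4) : ℂ :=
  e.frameD i (fun w => B w j p q) z - e.frameD j (fun w => B w i p q) z
    + ∑ h : Fin n, (B z i p h * B z j h q - B z j p h * B z i h q)
    - C.fiberD e i (fun w => B w j p q) z - C.fiberDbar e i (fun w => B w j p q) z
    + C.fiberD e j (fun w => B w i p q) z + C.fiberDbar e j (fun w => B w i p q) z
    - ∑ k : Fin 4, (e.structC k i j (e.chart.symm z.1) : ℂ) * B z k p q

/-- The torsion in an equipped chart, as a spin-tensor of type `(0,0|0,0|1,2)`. -/
def torsionLocal (e : EquippedChart 𝓢) (z : Coord ty) : Idx (mkType 0 0 0 0 1 2) → ℂ :=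
  fun a => C.torsionComp e z (a .vector (0 : Fin 1)) (a .covector (0 : Fin 2))
    (a .covector (1 : Fin 2))

/-- The torsion field. -/
def torsion : ExtField S ty (mkType 0 0 0 0 1 2) := ofLocal C.torsionLocal

/-- The components of the spin-curvature tensor of type `(1,1|0,0|0,2)`. -/
def curvSLocal (e : EquippedChart 𝓢) (z : Coord ty) : Idx (mkType 1 1 0 0 0 2) → ℂ :=
  fun a => C.curvComp (C.A e) e z (a .spinor (0 : Fin 1)) (a .cospinor (0 : Fin 1))
    (a .covector (0 : Fin 2)) (a .covector (1 : Fin 2))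

/-- The first curvature spin-tensor. -/
def curvS : ExtField S ty (mkType 1 1 0 0 0 2) := ofLocal C.curvSLocal

/-- The components of the barred spin-curvature tensor of type `(0,0|1,1|0,2)`. -/
def curvS'Local (e : EquippedChart 𝓢) (z : Coord ty) : Idx (mkType 0 0 1 1 0 2) → ℂ :=
  fun a => C.curvComp (C.A' e) e z (a .barSpinor (0 : Fin 1)) (a .barCospinor (0 : Fin 1))
    (a .covector (0 : Fin 2)) (a .covector (1 : Fin 2))

/-- The second curvature spin-tensor. -/
def curvS' : ExtField S ty (mkType 0 0 1 1 0 2) := ofLocal C.curvS'Local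

/-- The components of the third curvature spin-tensor of type `(0,0|0,0|1,3)`. -/
def curvRLocal (e : EquippedChart 𝓢) (z : Coord ty) : Idx (mkType 0 0 0 0 1 3) → ℂ :=
  fun a => C.curvComp (C.Γ e) e z (a .vector (0 : Fin 1)) (a .covector (0 : Fin 3))
    (a .covector (1 : Fin 3)) (a .covector (2 : Fin 3))

/-- The third curvature spin-tensor. -/
def curvR : ExtField S ty (mkType 0 0 0 0 1 3) := ofLocal C.curvRLocal

end SpinorConnection

/-! ### Contractions with two vector fields -/

/-- The local expression of `C(T ⊗ X ⊗ Y)`. -/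
def evalTorsionLocal (T : ExtField S ty (mkType 0 0 0 0 1 2)) (X Y : ExtField S ty tyVector)
    (e : EquippedChart 𝓢) (z : Coord ty) : Idx tyVector → ℂ :=
  fun a => ∑ i : Fin 4, ∑ j : Fin 4,
    T.rep e z (mkIdx ![] ![] ![] ![] ![a .vector (0 : Fin 1)] ![i, j])
      * vecComp (X.rep e z) i * vecComp (Y.rep e z) j

variable (𝓢) in
/-- The vector field `T(X, Y)`. -/
def evalTorsion (T : ExtField S ty (mkType 0 0 0 0 1 2)) (X Y : ExtField S ty tyVector) :
    ExtField S ty tyVector :=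
  ofLocal (𝓢 := 𝓢) (evalTorsionLocal T X Y)

/-- The local expression of `R(X, Y)` for `R` of type `(1,1|0,0|0,2)`. -/
def evalSLocal (R : ExtField S ty (mkType 1 1 0 0 0 2)) (X Y : ExtField S ty tyVector)
    (e : EquippedChart 𝓢) (z : Coord ty) : Idx tySpinOp → ℂ :=
  fun a => ∑ i : Fin 4, ∑ j : Fin 4,
    R.rep e z (mkIdx ![a .spinor (0 : Fin 1)] ![a .cospinor (0 : Fin 1)] ![] ![] ![] ![i, j])
      * vecComp (X.rep e z) i * vecComp (Y.rep e z) j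

variable (𝓢) in
/-- The field `R(X, Y)` of type `(1,1|0,0|0,0)`. -/
def evalS (R : ExtField S ty (mkType 1 1 0 0 0 2)) (X Y : ExtField S ty tyVector) :
    ExtField S ty tySpinOp :=
  ofLocal (𝓢 := 𝓢) (evalSLocal R X Y)

/-- The local expression of `R(X, Y)` for `R` of type `(0,0|1,1|0,2)`. -/
def evalS'Local (R : ExtField S ty (mkType 0 0 1 1 0 2)) (X Y : ExtField S ty tyVector)
    (e : EquippedChart 𝓢) (z : Coord ty) : Idx tyBarOp → ℂ :=
  fun a => ∑ i : Fin 4, ∑ j : Fin 4,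
    R.rep e z
        (mkIdx ![] ![] ![a .barSpinor (0 : Fin 1)] ![a .barCospinor (0 : Fin 1)] ![] ![i, j])
      * vecComp (X.rep e z) i * vecComp (Y.rep e z) j

variable (𝓢) in
/-- The field `R(X, Y)` of type `(0,0|1,1|0,0)`. -/
def evalS' (R : ExtField S ty (mkType 0 0 1 1 0 2)) (X Y : ExtField S ty tyVector) :
    ExtField S ty tyBarOp :=
  ofLocal (𝓢 := 𝓢) (evalS'Local R X Y)

/-- The local expression of `R(X, Y)` for `R` of type `(0,0|0,0|1,3)`. -/
def evalRLocal (R : ExtField S ty (mkType 0 0 0 0 1 3)) (X Y : ExtField S ty tyVector)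
    (e : EquippedChart 𝓢) (z : Coord ty) : Idx tyVecOp → ℂ :=
  fun a => ∑ i : Fin 4, ∑ j : Fin 4,
    R.rep e z
        (mkIdx ![] ![] ![] ![] ![a .vector (0 : Fin 1)] ![a .covector (0 : Fin 1), i, j])
      * vecComp (X.rep e z) i * vecComp (Y.rep e z) j

variable (𝓢) in
/-- The field `R(X, Y)` of type `(0,0|0,0|1,1)`. -/
def evalR (R : ExtField S ty (mkType 0 0 0 0 1 3)) (X Y : ExtField S ty tyVector) :
    ExtField S ty tyVecOp :=
  ofLocal (𝓢 := 𝓢) (evalRLocal R X Y)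

end Geometry

end

end SpinExt

open SpinExt

/-!
The whole theorem is a statement about matrices and complex vector fields in local coordinates. In
an equipped chart the composite bundle has the complex coordinates `x^k`, `S^a[P]`, `(τS[P])^b`, and
a differentiation along a complex tangent vector is determined by its values on these coordinates
(`vec_ext`).

Components of spin-tensors transform by tensor products of the transition matrices of the frames
(`tAct`), and a degenerate differentiation acts on them by the Leibniz rule (`lAct`). The latter is
the representation of a Lie algebra obtained by differentiating the former: it is equivariant
(`tAct_lAct`), it respects commutators (`lAct_commutator`), and it appears in the derivative of a
transformed family of components (`derComp_tAct`). So the three kinds of connection components,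
together with their negative transposes for lower indices, can be treated as one family of matrices
indexed by the kinds of indices (`SpinorConnection.conn`).

The operators `H_j` are complex vector fields, the horizontal lifts of the frame vectors `Υ_j`. The
transformation law of the connection says precisely that a change of equipped charts maps them to
each other as it maps the frame vectors (`SpinorConnection.push_H`); the inhomogeneous term of the
law also cancels the derivatives of the transition matrices in `∇_j Z = H_j Z + D_j Z`
(`SpinorConnection.nabla_isTensorial`). Vertical vectors transform as spin-tensors
(`push_vertical`), which settles the native differentiations.

The coordinates `S[P]` and `τS[P]` are parallel along `H_j`, and the frame vectors commute by the
structure functions `c^k_ij`, hence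
`[H_i, H_j] = ∑ c^k_ij H_k + V_ij`
with the vertical field `V_ij` given by the action of minus the curvature
(`SpinorConnection.der_H_commutator`). Applied to functions of `x` this relation gives the law of
transformation of the structure functions (`SpinorConnection.structC_trans`), from which the
torsion and, by the identity `curvature_gauge` in a noncommutative ring, the curvatures are
tensorial. Applied to the components of a field it gives the Ricci identity
`[∇_i, ∇_j] Z = ∑ c^k_ij ∇_k Z + V_ij Z + R_ij Z` (`SpinorConnection.nablaComp_commutator`).
Contraction with `X` and `Y`, where the derivatives of the components of `X` and `Y` combine with
`c^k_ij` to the components of `∇_X Y - ∇_Y X - T(X, Y)` (`SpinorConnection.vecComp_torsion_rep`),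
yields the commutation relationship.

Transition matrices are smooth because those of spinor frames are values of the spin-metric
(`EquippedChart.spinTrans_eq`) and those of tangent frames are their images under the canonical
homomorphism; the structure functions are smooth because they are values of the Minkowski metric
(`EquippedChart.structC_eq`).
-/

namespace SpinExt

noncomputable section

set_option linter.unusedSectionVars false

section

/-! ### Tensor products of matrices -/

section Family

variable {ι : Type*} [Fintype ι] [DecidableEq ι] {d : ι → Type*} [∀ s, Fintype (d s)]
  [∀ s, DecidableEq (d s)]

/-- The tensor product of the matrices `G s`, acting on families of numbers indexed by
multi-indices. -/
def famAct (G : ∀ s, Matrix (d s) (d s) ℂ) (X : (∀ s, d s) → ℂ) : (∀ s, d s) → ℂ :=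
  fun a => ∑ b, (∏ s, G s (a s) (b s)) * X b

theorem famAct_mul (G H : ∀ s, Matrix (d s) (d s) ℂ) (X : (∀ s, d s) → ℂ) :
    famAct (fun s => G s * H s) X = famAct G (famAct H X) := by
  funext a
  simp only [famAct, Matrix.mul_apply, Finset.prod_univ_sum, Finset.mul_sum, Finset.sum_mul,
    Fintype.piFinset_univ]
  rw [Finset.sum_comm]
  refine Finset.sum_congr rfl fun c _ => Finset.sum_congr rfl fun b _ => ?_
  rw [Finset.prod_mul_distrib, mul_assoc]

theorem famAct_one (X : (∀ s, d s) → ℂ) : famAct (fun _ => 1) X = X := by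
  funext a
  rw [famAct, Finset.sum_eq_single a]
  · simp
  · intro b _ hb
    obtain ⟨s, hs⟩ := Function.ne_iff.1 hb
    rw [Finset.prod_eq_zero (Finset.mem_univ s), zero_mul]
    exact Matrix.one_apply_ne hs.symm
  · simp

/-- A matrix acting on the single index `s`. -/
def slotAct (s : ι) (m : Matrix (d s) (d s) ℂ) (X : (∀ s, d s) → ℂ) : (∀ s, d s) → ℂ :=
  fun a => ∑ v, m (a s) v * X (Function.update a s v)

/-- The action on one index is the tensor product of the given matrix with unit matrices. -/
theorem slotAct_eq (s : ι) (m : Matrix (d s) (d s) ℂ) (X : (∀ s, d s) → ℂ) :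
    slotAct s m X = famAct (Function.update (fun _ => 1) s m) X := by
  funext a
  refine Fintype.sum_of_injective (fun v => Function.update a s v)
    (Function.update_injective a s) _ _ ?_ ?_
  · intro b hb
    have : ∃ s', s' ≠ s ∧ a s' ≠ b s' := by
      by_contra! h
      exact hb ⟨b s, by
        funext s'
        by_cases hs : s' = s
        · subst hs; simp
        · simp [Function.update_of_ne hs, h s' hs]⟩
    obtain ⟨s', hs', hab⟩ := this
    rw [Finset.prod_eq_zero (Finset.mem_univ s'), zero_mul]
    rw [Function.update_of_ne hs']
    exact Matrix.one_apply_ne hab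
  · intro v
    rw [Finset.prod_eq_single s]
    · simp
    · intro s' _ hs'
      simp [Function.update_of_ne hs']
    · simp

theorem update_mul_family (s : ι) (G H : ∀ s, Matrix (d s) (d s) ℂ)
    (m n : Matrix (d s) (d s) ℂ) :
    (fun s' => Function.update G s m s' * Function.update H s n s') =
      Function.update (fun s' => G s' * H s') s (m * n) := by
  funext s'
  by_cases h : s' = s
  · subst h; simp
  · simp [Function.update_of_ne h]

theorem slotAct_famAct (s : ι) (m : Matrix (d s) (d s) ℂ) (G : ∀ s, Matrix (d s) (d s) ℂ)
    (X : (∀ s, d s) → ℂ) :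
    slotAct s m (famAct G X) = famAct (Function.update G s (m * G s)) X := by
  rw [slotAct_eq, ← famAct_mul]
  conv_lhs => rw [← Function.update_eq_self s G]
  rw [update_mul_family]
  simp

theorem famAct_slotAct (s : ι) (m : Matrix (d s) (d s) ℂ) (G : ∀ s, Matrix (d s) (d s) ℂ)
    (X : (∀ s, d s) → ℂ) :
    famAct G (slotAct s m X) = famAct (Function.update G s (G s * m)) X := by
  rw [slotAct_eq, ← famAct_mul]
  conv_lhs => rw [← Function.update_eq_self s G]
  rw [update_mul_family]
  simp

theorem slotAct_mul (s : ι) (m n : Matrix (d s) (d s) ℂ) (X : (∀ s, d s) → ℂ) :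
    slotAct s (m * n) X = slotAct s m (slotAct s n X) := by
  rw [slotAct_eq s n, slotAct_famAct, slotAct_eq]
  simp

theorem slotAct_comm {s s' : ι} (h : s ≠ s') (m : Matrix (d s) (d s) ℂ)
    (n : Matrix (d s') (d s') ℂ) (X : (∀ s, d s) → ℂ) :
    slotAct s m (slotAct s' n X) = slotAct s' n (slotAct s m X) := by
  rw [slotAct_eq s' n, slotAct_famAct, slotAct_eq s m, slotAct_famAct]
  simp [Function.update_of_ne h, Function.update_of_ne h.symm, Function.update_comm h]

theorem slotAct_sub (s : ι) (m n : Matrix (d s) (d s) ℂ) (X : (∀ s, d s) → ℂ) :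
    slotAct s (m - n) X = slotAct s m X - slotAct s n X := by
  funext a; simp [slotAct, sub_mul]

theorem slotAct_sum_right {κ : Type*} (u : Finset κ) (s : ι) (m : Matrix (d s) (d s) ℂ)
    (X : κ → (∀ s, d s) → ℂ) :
    slotAct s m (∑ i ∈ u, X i) = ∑ i ∈ u, slotAct s m (X i) := by
  funext a
  simp only [slotAct, Finset.sum_apply, Finset.mul_sum]
  rw [Finset.sum_comm]

/-- The action of a family of matrices by the Leibniz rule is a representation of the Lie algebra
of such families: matrices acting on different indices commute. -/
theorem sum_slotAct_commutator (g h : ∀ s, Matrix (d s) (d s) ℂ) (X : (∀ s, d s) → ℂ) :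
    ∑ s, slotAct s (g s * h s - h s * g s) X =
      ∑ s, slotAct s (g s) (∑ s', slotAct s' (h s') X)
        - ∑ s, slotAct s (h s) (∑ s', slotAct s' (g s') X) := by
  simp only [slotAct_sum_right]
  -- in the double sum over pairs of indices only the diagonal terms do not cancel
  rw [Finset.sum_comm (f := fun s s' => slotAct s (h s) (slotAct s' (g s') X)),
    ← Finset.sum_sub_distrib]
  refine Finset.sum_congr rfl fun s _ => ?_
  rw [← Finset.sum_sub_distrib, Finset.sum_eq_single s]
  · rw [slotAct_sub, slotAct_mul, slotAct_mul]
  · intro s' _ hs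
    rw [slotAct_comm hs, sub_self]
  · simp

end Family

/-! ### Matrices acting on spin-tensors -/

/-- A square matrix for each kind of indices. -/
abbrev KindMat := ∀ k : Kind, Matrix (Fin k.dim) (Fin k.dim) ℂ

variable {t : SType}

/-- The components `X_a` as a family indexed by functions on the set of all indices. -/
def flat (X : Idx t → ℂ) : (∀ s : (Σ k : Kind, Fin (t k)), Fin s.1.dim) → ℂ :=
  fun b => X (Sigma.curry b)

/-- The action of the tensor products of the matrices `G k` on the components of spin-tensors: the
law of transformation of these components under changes of frames. -/
def tAct (G : KindMat) (X : Idx t → ℂ) : Idx t → ℂ :=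
  fun a => ∑ b : Idx t, (∏ k, ∏ μ, G k (a k μ) (b k μ)) * X b

/-- The derivative of `tAct` at the identity: the action of matrices `g k` on the components of
spin-tensors by the Leibniz rule. -/
def lAct (g : KindMat) (X : Idx t → ℂ) : Idx t → ℂ :=
  fun a => ∑ k : Kind, ∑ μ : Fin (t k), ∑ v : Fin k.dim, g k (a k μ) v * X (replaceIdx a k μ v)

theorem degComp_eq_lAct (𝔖 𝔖' : Matrix (Fin 2) (Fin 2) ℂ) (S : Matrix (Fin 4) (Fin 4) ℂ)
    (X : Idx t → ℂ) : degComp 𝔖 𝔖' S X = lAct (kindMatrix 𝔖 𝔖' S) X := rfl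

theorem flat_injective : Function.Injective (flat (t := t)) := by
  intro X Y h
  funext a
  have := congrFun h (Sigma.uncurry a)
  simpa [flat] using this

theorem flat_tAct (G : KindMat) (X : Idx t → ℂ) :
    flat (tAct G X) = famAct (fun s => G s.1) (flat X) := by
  funext a
  simp only [flat, tAct, famAct]
  rw [← (Equiv.piCurry fun (k : Kind) (_ : Fin (t k)) => Fin k.dim).sum_comp]
  refine Finset.sum_congr rfl fun b _ => ?_
  rw [Fintype.prod_sigma]
  rfl

/-- The action by the Leibniz rule is the sum over all indices of the actions on a single index. -/
theorem flat_lAct (g : KindMat) (X : Idx t → ℂ) :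
    flat (lAct g X) = ∑ s : (Σ k : Kind, Fin (t k)), slotAct s (g s.1) (flat X) := by
  funext a
  simp only [flat, lAct, Finset.sum_apply, slotAct]
  rw [Fintype.sum_sigma]
  refine Finset.sum_congr rfl fun k _ => Finset.sum_congr rfl fun μ _ =>
    Finset.sum_congr rfl fun v _ => ?_
  congr 2
  exact (Sigma.curry_update (γ := fun (k : Kind) (_ : Fin (t k)) => Fin k.dim) ⟨k, μ⟩ a v).symm

theorem flat_sub (X Y : Idx t → ℂ) : flat (X - Y) = flat X - flat Y := rfl

theorem tAct_mul (G H : KindMat) (X : Idx t → ℂ) : tAct (G * H) X = tAct G (tAct H X) := by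
  apply flat_injective
  rw [flat_tAct, flat_tAct, flat_tAct, ← famAct_mul]
  rfl

theorem tAct_one (X : Idx t → ℂ) : tAct 1 X = X := by
  apply flat_injective
  rw [flat_tAct]
  exact famAct_one _

theorem tAct_add (G : KindMat) (X Y : Idx t → ℂ) : tAct G (X + Y) = tAct G X + tAct G Y := by
  funext a; simp [tAct, mul_add, Finset.sum_add_distrib]

theorem tAct_neg (G : KindMat) (X : Idx t → ℂ) : tAct G (-X) = -tAct G X := by
  funext a; simp [tAct]

theorem tAct_zero (G : KindMat) : tAct G (0 : Idx t → ℂ) = 0 := by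
  funext a; simp [tAct]

theorem tAct_smul (G : KindMat) (c : ℂ) (X : Idx t → ℂ) : tAct G (c • X) = c • tAct G X := by
  funext a; simp [tAct, Finset.mul_sum, mul_left_comm]

theorem tAct_sum {κ : Type*} (u : Finset κ) (G : KindMat) (X : κ → Idx t → ℂ) :
    tAct G (∑ i ∈ u, X i) = ∑ i ∈ u, tAct G (X i) := by
  funext a
  simp only [tAct, Finset.sum_apply, Finset.mul_sum]
  rw [Finset.sum_comm]

theorem lAct_add_left (g h : KindMat) (X : Idx t → ℂ) : lAct (g + h) X = lAct g X + lAct h X := by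
  funext a; simp [lAct, add_mul, Finset.sum_add_distrib]

theorem lAct_neg_left (g : KindMat) (X : Idx t → ℂ) : lAct (-g) X = -lAct g X := by
  funext a; simp [lAct]

theorem lAct_sub_left (g h : KindMat) (X : Idx t → ℂ) : lAct (g - h) X = lAct g X - lAct h X := by
  rw [sub_eq_add_neg, lAct_add_left, lAct_neg_left, sub_eq_add_neg]

theorem lAct_smul_left (c : ℂ) (g : KindMat) (X : Idx t → ℂ) : lAct (c • g) X = c • lAct g X := by
  funext a; simp [lAct, Finset.mul_sum, mul_assoc]

theorem lAct_zero_left (X : Idx t → ℂ) : lAct 0 X = 0 := by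
  funext a; simp [lAct]

theorem lAct_sum_left {κ : Type*} (u : Finset κ) (g : κ → KindMat) (X : Idx t → ℂ) :
    lAct (∑ i ∈ u, g i) X = ∑ i ∈ u, lAct (g i) X := by
  classical
  induction u using Finset.induction_on with
  | empty => simp [lAct_zero_left]
  | insert i u hi ih => rw [Finset.sum_insert hi, Finset.sum_insert hi, lAct_add_left, ih]

/-- The action by the Leibniz rule is a representation of the Lie algebra of families of matrices.
-/
theorem lAct_commutator (g h : KindMat) (X : Idx t → ℂ) :
    lAct (g * h - h * g) X = lAct g (lAct h X) - lAct h (lAct g X) := by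
  apply flat_injective
  simp only [flat_sub, flat_lAct]
  exact sum_slotAct_commutator (d := fun s : (Σ k : Kind, Fin (t k)) => Fin s.1.dim)
    (fun s => g s.1) (fun s => h s.1) (flat X)

/-- The action by the Leibniz rule is equivariant with respect to changes of frames. -/
theorem tAct_lAct {G G' : KindMat} (hG : G' * G = 1) (g : KindMat) (X : Idx t → ℂ) :
    tAct G (lAct g X) = lAct (G * g * G') (tAct G X) := by
  apply flat_injective
  rw [flat_tAct, flat_lAct, flat_lAct, flat_tAct]
  have hsum : ∀ (u : Finset (Σ k : Kind, Fin (t k)))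
      (Y : (Σ k : Kind, Fin (t k)) → (∀ s : (Σ k : Kind, Fin (t k)), Fin s.1.dim) → ℂ),
      famAct (fun s : (Σ k : Kind, Fin (t k)) => G s.1) (∑ s ∈ u, Y s) =
        ∑ s ∈ u, famAct (fun s => G s.1) (Y s) := by
    intro u Y
    funext a
    simp only [famAct, Finset.sum_apply, Finset.mul_sum]
    rw [Finset.sum_comm]
  rw [hsum]
  refine Finset.sum_congr rfl fun s _ => ?_
  rw [famAct_slotAct, slotAct_famAct]
  have h : G' s.1 * G s.1 = 1 := congrFun hG s.1
  have h' : (G * g * G') s.1 * G s.1 = G s.1 * g s.1 := by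
    rw [Pi.mul_apply, Pi.mul_apply, mul_assoc, h, mul_one]
  rw [h']

/-- The derivative of `tAct G X` with respect to `G`, written as a sum over the factors of the
products of matrix elements. -/
theorem lAct_tAct_apply (g G : KindMat) (X : Idx t → ℂ) (a : Idx t) :
    lAct g (tAct G X) a = ∑ b : Idx t, (∑ s : (Σ k : Kind, Fin (t k)),
      (g s.1 * G s.1) (a s.1 s.2) (b s.1 s.2) *
        ∏ s' ∈ Finset.univ.erase s, G s'.1 (a s'.1 s'.2) (b s'.1 s'.2)) * X b := by
  have h := congrFun (flat_lAct g (tAct G X)) (Sigma.uncurry a)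
  rw [flat_tAct] at h
  simp only [slotAct_famAct, Finset.sum_apply] at h
  have h0 : flat (lAct g (tAct G X)) (Sigma.uncurry a) = lAct g (tAct G X) a := by simp [flat]
  rw [← h0, h]
  simp only [famAct, Finset.sum_mul]
  rw [Finset.sum_comm]
  rw [← (Equiv.piCurry fun (k : Kind) (_ : Fin (t k)) => Fin k.dim).sum_comp]
  refine Finset.sum_congr rfl fun b _ => Finset.sum_congr rfl fun s _ => ?_
  rw [← Finset.mul_prod_erase _ _ (Finset.mem_univ s)]
  congr 2
  · rw [Function.update_self]
    rfl
  · refine Finset.prod_congr rfl fun s' hs' => ?_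
    rw [Function.update_of_ne (Finset.ne_of_mem_erase hs')]
    rfl

/-! ### Complex conjugation and sums over multi-indices -/

theorem prod_kind {β : Type*} [CommMonoid β] (f : Kind → β) :
    ∏ k, f k =
      f .spinor * f .cospinor * f .barSpinor * f .barCospinor * f .vector * f .covector := by
  have : (Finset.univ : Finset Kind) =
    {.spinor, .cospinor, .barSpinor, .barCospinor, .vector, .covector} := rfl
  rw [this]
  simp [mul_assoc]

/-- The exchange of the barred and the non-barred indices as a bijection. -/
def swapEquiv : Idx (conjType t) ≃ Idx t where
  toFun := swapIdx
  invFun a := fun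
    | .spinor => a .barSpinor
    | .cospinor => a .barCospinor
    | .barSpinor => a .spinor
    | .barCospinor => a .cospinor
    | .vector => a .vector
    | .covector => a .covector
  left_inv a := by funext k; cases k <;> rfl
  right_inv a := by funext k; cases k <;> rfl

/-- The conjugation of components commutes with changes of frames whose matrices for barred
indices are conjugate to those for non-barred indices and whose space-time matrices are real. -/
theorem tauComp_tAct {G : KindMat}
    (h1 : ∀ i j, G .barSpinor i j = starRingEnd ℂ (G .spinor i j))
    (h2 : ∀ i j, G .barCospinor i j = starRingEnd ℂ (G .cospinor i j))
    (h3 : ∀ i j, starRingEnd ℂ (G .vector i j) = G .vector i j)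
    (h4 : ∀ i j, starRingEnd ℂ (G .covector i j) = G .covector i j) (X : Idx t → ℂ) :
    tauComp (tAct G X) = tAct G (tauComp X) := by
  funext a
  simp only [tauComp, tAct, map_sum, map_mul, map_prod]
  rw [← swapEquiv.sum_comp]
  refine Finset.sum_congr rfl fun b _ => ?_
  congr 1
  rw [prod_kind, prod_kind]
  have e1 : ∀ i j, starRingEnd ℂ (G .barSpinor i j) = G .spinor i j := fun i j => by
    rw [h1]; exact Complex.conj_conj _
  have e2 : ∀ i j, starRingEnd ℂ (G .barCospinor i j) = G .cospinor i j := fun i j => by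
    rw [h2]; exact Complex.conj_conj _
  have e3 : ∀ i j : Fin Kind.spinor.dim, starRingEnd ℂ (G .spinor i j) = G .barSpinor i j :=
    fun i j => (h1 i j).symm
  have e4 : ∀ i j : Fin Kind.cospinor.dim, starRingEnd ℂ (G .cospinor i j) = G .barCospinor i j :=
    fun i j => (h2 i j).symm
  simp only [e1, e2, e3, e4, h3, h4]
  have : ∀ x y z u v w : ℂ, x * y * z * u * v * w = z * u * x * y * v * w := by
    intros; ring
  exact this _ _ _ _ _ _

theorem mkIdx_eta {α β ν γ m n : ℕ} (a : Idx (mkType α β ν γ m n)) :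
    mkIdx (a .spinor) (a .cospinor) (a .barSpinor) (a .barCospinor) (a .vector) (a .covector) =
      a := by
  funext k; cases k <;> rfl

/-- Multi-indices as sextuples of groups of indices. -/
def idxEquiv (α β ν γ m n : ℕ) :
    ((Fin α → Fin 2) × (Fin β → Fin 2) × (Fin ν → Fin 2) × (Fin γ → Fin 2) × (Fin m → Fin 4) ×
      (Fin n → Fin 4)) ≃ Idx (mkType α β ν γ m n) where
  toFun x := mkIdx x.1 x.2.1 x.2.2.1 x.2.2.2.1 x.2.2.2.2.1 x.2.2.2.2.2
  invFun a := (a .spinor, a .cospinor, a .barSpinor, a .barCospinor, a .vector, a .covector)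
  left_inv _ := rfl
  right_inv a := mkIdx_eta a

theorem sum_idx {α β ν γ m n : ℕ} (f : Idx (mkType α β ν γ m n) → ℂ) :
    ∑ a, f a = ∑ i : Fin α → Fin 2, ∑ j : Fin β → Fin 2, ∑ i' : Fin ν → Fin 2,
      ∑ j' : Fin γ → Fin 2, ∑ h : Fin m → Fin 4, ∑ k : Fin n → Fin 4, f (mkIdx i j i' j' h k) := by
  rw [← (idxEquiv α β ν γ m n).sum_comp]
  simp only [Fintype.sum_prod_type]
  rfl

theorem sum_fun_zero {κ : Type*} [Fintype κ] (f : (Fin 0 → κ) → ℂ) : ∑ x, f x = f ![] := by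
  rw [Fintype.sum_unique]
  exact congrArg f (Subsingleton.elim _ _)

theorem sum_fun_succ {κ : Type*} [Fintype κ] {n : ℕ} (f : (Fin (n + 1) → κ) → ℂ) :
    ∑ x, f x = ∑ v, ∑ y : Fin n → κ, f (Matrix.vecCons v y) := by
  rw [← (Fin.consEquiv fun _ : Fin (n + 1) => κ).sum_comp, Fintype.sum_prod_type]
  rfl

theorem tAct_mkIdx {α β ν γ m n : ℕ} (G : KindMat) (X : Idx (mkType α β ν γ m n) → ℂ)
    (i : Fin α → Fin 2) (j : Fin β → Fin 2) (i' : Fin ν → Fin 2)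
    (j' : Fin γ → Fin 2) (h : Fin m → Fin 4) (k : Fin n → Fin 4) :
    tAct G X (mkIdx i j i' j' h k) = ∑ a : Fin α → Fin 2, ∑ b : Fin β → Fin 2,
      ∑ a' : Fin ν → Fin 2, ∑ b' : Fin γ → Fin 2, ∑ u : Fin m → Fin 4, ∑ v : Fin n → Fin 4,
        ((∏ μ, G .spinor (i μ) (a μ)) * (∏ μ, G .cospinor (j μ) (b μ)) *
          (∏ μ, G .barSpinor (i' μ) (a' μ)) * (∏ μ, G .barCospinor (j' μ) (b' μ)) *
          (∏ μ, G .vector (h μ) (u μ)) * (∏ μ, G .covector (k μ) (v μ))) *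
          X (mkIdx a b a' b' u v) := by
  simp only [tAct]
  rw [sum_idx]
  simp only [prod_kind]
  rfl

theorem vecComp_tAct (G : KindMat) (X : Idx tyVector → ℂ) (i : Fin 4) :
    vecComp (tAct G X) i = ∑ v : Fin 4, G .vector i v * vecComp X v := by
  simp only [vecComp]
  rw [tAct_mkIdx]
  simp [sum_fun_succ]
  rfl

end

section

/-! ### Complex tangent vectors as derivations -/

section Derivations

variable {E E' : Type*} [NormedAddCommGroup E] [NormedSpace ℝ E] [NormedAddCommGroup E']
  [NormedSpace ℝ E'] {t : SType}

/-- The derivative of `f` at `z` along a complex tangent vector, where complex tangent vectors are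
encoded as complex linear functionals on complex valued covectors. -/
def der (Λ : (E →L[ℝ] ℂ) →ₗ[ℂ] ℂ) (f : E → ℂ) (z : E) : ℂ := Λ (fderiv ℝ f z)

variable {Λ : (E →L[ℝ] ℂ) →ₗ[ℂ] ℂ} {f g : E → ℂ} {z : E}

theorem der_congr (h : f =ᶠ[nhds z] g) : der Λ f z = der Λ g z := by
  rw [der, der, h.fderiv_eq]

theorem der_add (hf : DifferentiableAt ℝ f z) (hg : DifferentiableAt ℝ g z) :
    der Λ (fun w => f w + g w) z = der Λ f z + der Λ g z := by
  rw [der, fderiv_fun_add hf hg, map_add]; rfl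

theorem der_neg : der Λ (fun w => -f w) z = -der Λ f z := by
  rw [der, fderiv_fun_neg, map_neg]; rfl

theorem der_const (c : ℂ) : der Λ (fun _ : E => c) z = 0 := by
  simp [der]

theorem der_mul (hf : DifferentiableAt ℝ f z) (hg : DifferentiableAt ℝ g z) :
    der Λ (fun w => f w * g w) z = der Λ f z * g z + f z * der Λ g z := by
  rw [der, fderiv_fun_mul hf hg, map_add, map_smul, map_smul]
  simp only [der, smul_eq_mul]
  ring

theorem der_sum {κ : Type*} {u : Finset κ} {f : κ → E → ℂ}
    (hf : ∀ i ∈ u, DifferentiableAt ℝ (f i) z) :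
    der Λ (fun w => ∑ i ∈ u, f i w) z = ∑ i ∈ u, der Λ (f i) z := by
  rw [der, fderiv_fun_sum hf, map_sum]; rfl

theorem differentiableAt_prod {κ : Type*} {u : Finset κ} {f : κ → E → ℂ}
    (hf : ∀ i ∈ u, DifferentiableAt ℝ (f i) z) :
    DifferentiableAt ℝ (fun w => ∏ i ∈ u, f i w) z := by
  classical
  exact (HasFDerivAt.finsetProd fun i hi => (hf i hi).hasFDerivAt).differentiableAt

theorem der_prod {κ : Type*} [DecidableEq κ] {u : Finset κ} {f : κ → E → ℂ}
    (hf : ∀ i ∈ u, DifferentiableAt ℝ (f i) z) :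
    der Λ (fun w => ∏ i ∈ u, f i w) z = ∑ i ∈ u, der Λ (f i) z * ∏ j ∈ u.erase i, f j z := by
  have h := fderiv_finsetProd (u := u) (g := f) (x := z) hf
  rw [der, h, map_sum]
  refine Finset.sum_congr rfl fun i _ => ?_
  rw [map_smul, smul_eq_mul, mul_comm]; rfl

/-- The image of a complex tangent vector under a real linear map. -/
def push (A : E →L[ℝ] E') (Λ : (E →L[ℝ] ℂ) →ₗ[ℂ] ℂ) : (E' →L[ℝ] ℂ) →ₗ[ℂ] ℂ where
  toFun L := Λ (L.comp A)
  map_add' L L' := by rw [ContinuousLinearMap.add_comp, map_add]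
  map_smul' c L := by rw [ContinuousLinearMap.smul_comp, map_smul]; rfl

theorem der_comp {φ : E → E'} {g : E' → ℂ} (hφ : DifferentiableAt ℝ φ z)
    (hg : DifferentiableAt ℝ g (φ z)) :
    der Λ (fun w => g (φ w)) z = der (push (fderiv ℝ φ z) Λ) g (φ z) := by
  rw [der, show (fun w => g (φ w)) = g ∘ φ from rfl, fderiv_comp z hg hφ]; rfl

theorem der_smul_left (c : ℂ) (Λ : (E →L[ℝ] ℂ) →ₗ[ℂ] ℂ) (f : E → ℂ) (z : E) :
    der (c • Λ) f z = c * der Λ f z := rfl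

theorem der_sum_left {κ : Type*} (u : Finset κ) (Λ : κ → (E →L[ℝ] ℂ) →ₗ[ℂ] ℂ) (f : E → ℂ) (z : E) :
    der (∑ i ∈ u, Λ i) f z = ∑ i ∈ u, der (Λ i) f z := by
  simp [der, LinearMap.sum_apply]

/-- The derivative of the elements of a matrix. -/
def derMat {n : ℕ} (Λ : (E →L[ℝ] ℂ) →ₗ[ℂ] ℂ) (F : E → Matrix (Fin n) (Fin n) ℂ) (z : E) :
    Matrix (Fin n) (Fin n) ℂ := fun i j => der Λ (fun w => F w i j) z

/-- All elements of a matrix valued function are differentiable at a point. -/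
def MatDiff {n : ℕ} (F : E → Matrix (Fin n) (Fin n) ℂ) (z : E) : Prop :=
  ∀ i j, DifferentiableAt ℝ (fun w => F w i j) z

theorem derMat_congr {n : ℕ} {F G : E → Matrix (Fin n) (Fin n) ℂ} (h : F =ᶠ[nhds z] G) :
    derMat Λ F z = derMat Λ G z := by
  funext i j
  exact der_congr (h.mono fun w hw => congrFun (congrFun hw i) j)

theorem MatDiff.mul {n : ℕ} {F G : E → Matrix (Fin n) (Fin n) ℂ} (hF : MatDiff F z)
    (hG : MatDiff G z) : MatDiff (fun w => F w * G w) z := by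
  intro i j
  simp only [Matrix.mul_apply]
  exact DifferentiableAt.fun_sum fun k _ => (hF i k).mul (hG k j)

theorem MatDiff.smul {n : ℕ} {c : E → ℂ} {F : E → Matrix (Fin n) (Fin n) ℂ}
    (hc : DifferentiableAt ℝ c z) (hF : MatDiff F z) : MatDiff (fun w => c w • F w) z := by
  intro i j
  simp only [Matrix.smul_apply, smul_eq_mul]
  exact hc.mul (hF i j)

theorem MatDiff.sum {κ : Type*} {u : Finset κ} {n : ℕ} {F : κ → E → Matrix (Fin n) (Fin n) ℂ}
    (hF : ∀ i, MatDiff (F i) z) : MatDiff (fun w => ∑ i ∈ u, F i w) z := by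
  intro i j
  simp only [Matrix.sum_apply]
  exact DifferentiableAt.fun_sum fun k _ => hF k i j

theorem derMat_mul {n : ℕ} {F G : E → Matrix (Fin n) (Fin n) ℂ} (hF : MatDiff F z)
    (hG : MatDiff G z) :
    derMat Λ (fun w => F w * G w) z = derMat Λ F z * G z + F z * derMat Λ G z := by
  ext i j
  simp only [derMat, Matrix.mul_apply, Matrix.add_apply]
  rw [der_sum fun k _ => (hF i k).fun_mul (hG k j), ← Finset.sum_add_distrib]
  exact Finset.sum_congr rfl fun k _ => der_mul (hF i k) (hG k j)

theorem derMat_add {n : ℕ} {F G : E → Matrix (Fin n) (Fin n) ℂ} (hF : MatDiff F z)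
    (hG : MatDiff G z) :
    derMat Λ (fun w => F w + G w) z = derMat Λ F z + derMat Λ G z := by
  ext i j
  exact der_add (hF i j) (hG i j)

/-- The derivative of families of matrices acting on all kinds of indices. -/
def derKind (Λ : (E →L[ℝ] ℂ) →ₗ[ℂ] ℂ) (G : E → KindMat) (z : E) : KindMat :=
  fun k => derMat Λ (fun w => G w k) z

/-- The derivative of the components of a spin-tensor. -/
def derComp (Λ : (E →L[ℝ] ℂ) →ₗ[ℂ] ℂ) (X : E → Idx t → ℂ) (z : E) : Idx t → ℂ :=
  fun a => der Λ (fun w => X w a) z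

theorem derComp_congr {X Y : E → Idx t → ℂ} (h : X =ᶠ[nhds z] Y) :
    derComp Λ X z = derComp Λ Y z := by
  funext a
  exact der_congr (h.mono fun w hw => congrFun hw a)

/-- The Leibniz rule for the transformation law of components. -/
theorem derComp_tAct {G : E → KindMat} {G' : KindMat} {X : E → Idx t → ℂ} (h : G' * G z = 1)
    (hG : ∀ k, MatDiff (fun w => G w k) z) (hX : ∀ a, DifferentiableAt ℝ (fun w => X w a) z) :
    derComp Λ (fun w => tAct (G w) (X w)) z =
      lAct (derKind Λ G z * G') (tAct (G z) (X z)) + tAct (G z) (derComp Λ X z) := by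
  classical
  funext a
  rw [Pi.add_apply, lAct_tAct_apply]
  have hm : ∀ k, (derKind Λ G z * G') k * G z k = derKind Λ G z k := by
    intro k
    have h1 : G' k * G z k = 1 := congrFun h k
    rw [Pi.mul_apply, mul_assoc, h1, mul_one]
  simp only [hm, tAct, derComp]
  have hd : ∀ b : Idx t, ∀ s : (Σ k : Kind, Fin (t k)),
      DifferentiableAt ℝ (fun w => G w s.1 (a s.1 s.2) (b s.1 s.2)) z := fun b s => hG _ _ _
  have hp : ∀ (b : Idx t) (w : E), (∏ k, ∏ μ, G w k (a k μ) (b k μ)) =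
      ∏ s : (Σ k : Kind, Fin (t k)), G w s.1 (a s.1 s.2) (b s.1 s.2) := fun b w => by
    rw [Fintype.prod_sigma]
  simp only [hp]
  rw [der_sum fun b _ => DifferentiableAt.fun_mul
    (differentiableAt_prod fun s _ => hd b s) (hX b), ← Finset.sum_add_distrib]
  refine Finset.sum_congr rfl fun b _ => ?_
  rw [der_mul (differentiableAt_prod fun s _ => hd b s) (hX b),
    der_prod fun s _ => hd b s]
  rfl

theorem differentiableAt_lAct {g : E → KindMat} {X : E → Idx t → ℂ}
    (hg : ∀ k, MatDiff (fun w => g w k) z) (hX : ∀ a, DifferentiableAt ℝ (fun w => X w a) z)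
    (a : Idx t) : DifferentiableAt ℝ (fun w => lAct (g w) (X w) a) z := by
  simp only [lAct]
  exact DifferentiableAt.fun_sum fun k _ => DifferentiableAt.fun_sum fun μ _ =>
    DifferentiableAt.fun_sum fun v _ => (hg k _ _).mul (hX _)

theorem derComp_lAct {g : E → KindMat} {X : E → Idx t → ℂ}
    (hg : ∀ k, MatDiff (fun w => g w k) z) (hX : ∀ a, DifferentiableAt ℝ (fun w => X w a) z) :
    derComp Λ (fun w => lAct (g w) (X w)) z =
      lAct (derKind Λ g z) (X z) + lAct (g z) (derComp Λ X z) := by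
  funext a
  have h1 : ∀ k μ v, DifferentiableAt ℝ
      (fun w => g w k (a k μ) v * X w (replaceIdx a k μ v)) z :=
    fun k μ v => (hg k _ _).fun_mul (hX _)
  simp only [lAct, derComp, Pi.add_apply]
  rw [der_sum fun k _ => DifferentiableAt.fun_sum fun μ _ =>
    DifferentiableAt.fun_sum fun v _ => h1 k μ v, ← Finset.sum_add_distrib]
  refine Finset.sum_congr rfl fun k _ => ?_
  rw [der_sum fun μ _ => DifferentiableAt.fun_sum fun v _ => h1 k μ v, ← Finset.sum_add_distrib]
  refine Finset.sum_congr rfl fun μ _ => ?_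
  rw [der_sum fun v _ => h1 k μ v, ← Finset.sum_add_distrib]
  exact Finset.sum_congr rfl fun v _ => der_mul (hg k _ _) (hX _)

end Derivations

/-! ### Complex coordinates and complex vector fields -/

section Coordinates

variable {J : ℕ} (ty : Fin J → SType)

/-- The set numbering the complex coordinates `x^k`, `S^a[P]`, `(τS[P])^b`. -/
abbrev Dir := Fin 4 ⊕ (Σ P : Fin J, Idx (ty P)) ⊕ (Σ P : Fin J, Idx (conjType (ty P)))

/-- The complex coordinates as linear functions. -/
def coordL : Dir ty → (Coord ty →L[ℝ] ℂ)
  | .inl k => Complex.ofRealCLM.comp ((EuclideanSpace.proj (𝕜 := ℝ) k).comp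
      (ContinuousLinearMap.fst ℝ _ _))
  | .inr (.inl b) => (ContinuousLinearMap.proj (R := ℝ) (φ := fun _ : Idx (ty b.1) => ℂ) b.2).comp
      ((ContinuousLinearMap.proj (R := ℝ) (φ := fun P : Fin J => Idx (ty P) → ℂ) b.1).comp
        (ContinuousLinearMap.snd ℝ _ _))
  | .inr (.inr b) => (Complex.conjCLE : ℂ →L[ℝ] ℂ).comp
      ((ContinuousLinearMap.proj (R := ℝ) (φ := fun _ : Idx (ty b.1) => ℂ) (swapIdx b.2)).comp
      ((ContinuousLinearMap.proj (R := ℝ) (φ := fun P : Fin J => Idx (ty P) → ℂ) b.1).comp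
        (ContinuousLinearMap.snd ℝ _ _)))

variable {ty}

theorem coordL_inl (k : Fin 4) (z : Coord ty) : coordL ty (.inl k) z = (z.1 k : ℂ) := rfl

theorem coordL_inr_inl (P : Fin J) (b : Idx (ty P)) (z : Coord ty) :
    coordL ty (.inr (.inl ⟨P, b⟩)) z = z.2 P b := rfl

/-- The value of covectors on a vector, as a complex tangent vector. -/
def evalL (v : Coord ty) : (Coord ty →L[ℝ] ℂ) →ₗ[ℂ] ℂ where
  toFun L := L v
  map_add' _ _ := rfl
  map_smul' _ _ := rfl

theorem two_le_infty : (2 : WithTop ℕ∞) ≤ ∞ :=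
  WithTop.coe_le_coe.2 (le_top : (2 : ℕ∞) ≤ ⊤)

/-- The coordinate complex tangent vectors `∂/∂x^k`, `∂/∂S^a[P]`, `∂/∂(τS[P])^b`. -/
def dirL : Dir ty → (Coord ty →L[ℝ] ℂ) →ₗ[ℂ] ℂ
  | .inl k => evalL (EuclideanSpace.single k 1, 0)
  | .inr (.inl b) => (1 / 2 : ℂ) • (evalL (incr b.1 b.2 1)
      - Complex.I • evalL (incr b.1 b.2 Complex.I))
  | .inr (.inr b) => (1 / 2 : ℂ) • (evalL (incr b.1 (swapIdx b.2) 1)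
      + Complex.I • evalL (incr b.1 (swapIdx b.2) Complex.I))

theorem der_dirL_inl (k : Fin 4) (f : Coord ty → ℂ) (z : Coord ty) :
    der (dirL (.inl k)) f z = dX k f z := rfl

theorem der_dirL_inr_inl (P : Fin J) (b : Idx (ty P)) (f : Coord ty → ℂ) (z : Coord ty) :
    der (dirL (.inr (.inl ⟨P, b⟩))) f z = dS P b f z := rfl

theorem der_dirL_inr_inr (P : Fin J) (b : Idx (conjType (ty P))) (f : Coord ty → ℂ)
    (z : Coord ty) : der (dirL (.inr (.inr ⟨P, b⟩))) f z = dSbar P (swapIdx b) f z := rfl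

/-- The complex tangent vector with the given components. -/
def vec (c : Dir ty → ℂ) : (Coord ty →L[ℝ] ℂ) →ₗ[ℂ] ℂ := ∑ α, c α • dirL α

theorem der_vec (c : Dir ty → ℂ) (f : Coord ty → ℂ) (z : Coord ty) :
    der (vec c) f z = ∑ α, c α * der (dirL α) f z := by
  simp [vec, der, LinearMap.sum_apply]

/-- A real vector in the basis of the real and imaginary coordinate directions. -/
theorem decomp (v : Coord ty) : v = ∑ k, v.1 k • ((EuclideanSpace.single k 1, 0) : Coord ty)
    + ∑ P, ∑ b, ((v.2 P b).re • incr P b 1 + (v.2 P b).im • incr P b Complex.I) := by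
  refine Prod.ext ?_ ?_
  · simp only [incr, Prod.fst_add, Prod.fst_sum, Prod.smul_fst, smul_zero, add_zero,
      Finset.sum_const_zero]
    ext i
    simp [Pi.single_apply]
  · funext P b
    simp only [incr, Prod.snd_add, Prod.snd_sum, Prod.smul_snd, smul_zero, Finset.sum_const_zero,
      Finset.sum_apply, Pi.add_apply, Pi.smul_apply]
    rw [Finset.sum_eq_single P, Finset.sum_eq_single b]
    · simp
    · intro b' _ hb
      simp [Pi.single_eq_of_ne hb.symm]
    · simp
    · intro P' _ hP
      simp [Pi.single_eq_of_ne hP.symm]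
    · simp

/-- Every covector is the combination of the differentials of the complex coordinates with the
coefficients given by partial derivatives. -/
theorem sum_dirL_smul_coordL (L : Coord ty →L[ℝ] ℂ) : ∑ α, dirL α L • coordL ty α = L := by
  refine ContinuousLinearMap.ext fun v => ?_
  rw [Fintype.sum_sum_type, Fintype.sum_sum_type]
  rw [← Finset.univ_sigma_univ, ← Finset.univ_sigma_univ, Finset.sum_sigma, Finset.sum_sigma]
  conv_rhs => rw [decomp v]
  simp only [map_add, map_sum, map_smul, add_apply, sum_apply, smul_apply]
  congr 1
  · refine Finset.sum_congr rfl fun k _ => ?_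
    rw [coordL_inl, Complex.real_smul, smul_eq_mul, mul_comm]; rfl
  · rw [← Finset.sum_add_distrib]
    refine Finset.sum_congr rfl fun P _ => ?_
    have hs : ∀ f : Idx (ty P) → ℂ, ∑ b : Idx (conjType (ty P)), f (swapIdx b) = ∑ b, f b :=
      fun f => (swapEquiv (t := ty P)).sum_comp f
    have h2 : ∀ b : Idx (conjType (ty P)), dirL (.inr (.inr ⟨P, b⟩)) L •
        coordL ty (.inr (.inr ⟨P, b⟩)) v = (fun b : Idx (ty P) =>
          (1 / 2 : ℂ) * (L (incr P b 1) + Complex.I * L (incr P b Complex.I)) *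
            starRingEnd ℂ (v.2 P b)) (swapIdx b) := fun b => rfl
    rw [Finset.sum_congr rfl fun b _ => h2 b, hs (fun b : Idx (ty P) =>
      (1 / 2 : ℂ) * (L (incr P b 1) + Complex.I * L (incr P b Complex.I)) *
        starRingEnd ℂ (v.2 P b)), ← Finset.sum_add_distrib]
    refine Finset.sum_congr rfl fun b _ => ?_
    rw [coordL_inr_inl, Complex.real_smul, Complex.real_smul]
    have h1 : dirL (.inr (.inl ⟨P, b⟩)) L =
      (1 / 2 : ℂ) * (L (incr P b 1) - Complex.I * L (incr P b Complex.I)) := rfl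
    rw [h1, smul_eq_mul]
    -- the Wirtinger derivatives, contracted with `c` and its conjugate, add up to the real
    -- derivative along `c`
    have key : ∀ c A B : ℂ, (1 / 2 : ℂ) * (A - Complex.I * B) * c +
        (1 / 2 : ℂ) * (A + Complex.I * B) * starRingEnd ℂ c = c.re * A + c.im * B := by
      intro c A B
      have h1 : c = c.re + c.im * Complex.I := (Complex.re_add_im _).symm
      have h2 : starRingEnd ℂ c = c.re - c.im * Complex.I := Complex.ext (by simp) (by simp)
      linear_combination (1 / 2 : ℂ) * (A - Complex.I * B) * h1 +
        (1 / 2 : ℂ) * (A + Complex.I * B) * h2 + (-B * c.im) * Complex.I_mul_I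
    exact key _ _ _

theorem vec_coordL_eq (Λ : (Coord ty →L[ℝ] ℂ) →ₗ[ℂ] ℂ) : vec (fun α => Λ (coordL ty α)) = Λ := by
  ext L
  conv_rhs => rw [← sum_dirL_smul_coordL L]
  simp [vec, LinearMap.sum_apply, mul_comm]

theorem incr_snd (P P' : Fin J) (b : Idx (ty P)) (b' : Idx (ty P')) (c : ℂ) :
    (incr P b c).2 P' b' = if (⟨P, b⟩ : Σ P : Fin J, Idx (ty P)) = ⟨P', b'⟩ then c else 0 := by
  by_cases hP : P' = P
  · subst hP
    by_cases hb : b' = b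
    · subst hb; simp [incr]
    · have : (⟨P', b⟩ : Σ P : Fin J, Idx (ty P)) ≠ ⟨P', b'⟩ := fun h =>
        hb (eq_of_heq (Sigma.mk.inj h).2).symm
      rw [if_neg this]
      simp [incr, Pi.single_eq_of_ne hb]
  · have : (⟨P, b⟩ : Σ P : Fin J, Idx (ty P)) ≠ ⟨P', b'⟩ := fun h => hP (Sigma.mk.inj h).1.symm
    rw [if_neg this]
    simp [incr, Pi.single_eq_of_ne hP]

theorem swap_sigma_eq (P P' : Fin J) (b : Idx (conjType (ty P))) (b' : Idx (conjType (ty P'))) :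
    ((⟨P, swapIdx b⟩ : Σ P : Fin J, Idx (ty P)) = ⟨P', swapIdx b'⟩) ↔
      ((⟨P, b⟩ : Σ P : Fin J, Idx (conjType (ty P))) = ⟨P', b'⟩) := by
  constructor
  · intro h
    obtain ⟨rfl, h⟩ := Sigma.mk.inj h
    rw [(swapEquiv (t := ty P)).injective (eq_of_heq h)]
  · intro h
    obtain ⟨rfl, h⟩ := Sigma.mk.inj h
    rw [eq_of_heq h]

/-- The coordinate tangent vectors are dual to the differentials of the complex coordinates. -/
theorem dirL_coordL (α β : Dir ty) : dirL α (coordL ty β) = if α = β then 1 else 0 := by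
  have hI := Complex.I_mul_I
  have e1 : ∀ P b (L : Coord ty →L[ℝ] ℂ), dirL (.inr (.inl ⟨P, b⟩)) L =
    (1 / 2 : ℂ) * (L (incr P b 1) - Complex.I * L (incr P b Complex.I)) := fun _ _ _ => rfl
  have e2 : ∀ P b (L : Coord ty →L[ℝ] ℂ), dirL (.inr (.inr ⟨P, b⟩)) L =
    (1 / 2 : ℂ) * (L (incr P (swapIdx b) 1) + Complex.I * L (incr P (swapIdx b) Complex.I)) :=
    fun _ _ _ => rfl
  have e3 : ∀ P b (v : Coord ty), coordL ty (.inr (.inr ⟨P, b⟩)) v =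
    starRingEnd ℂ (v.2 P (swapIdx b)) := fun _ _ _ => rfl
  have e4 : ∀ P b c k, coordL ty (.inl k) (incr P b c) = 0 := fun P b c k => by
    simp [coordL_inl, incr]
  rcases α with k | ⟨P, b⟩ | ⟨P, b⟩ <;> rcases β with k' | ⟨P', b'⟩ | ⟨P', b'⟩
  · show coordL ty (.inl k') (EuclideanSpace.single k 1, 0) = _
    by_cases h : k = k' <;> simp [coordL_inl, eq_comm, h]
  · show coordL ty (.inr (.inl ⟨P', b'⟩)) (EuclideanSpace.single k 1, 0) = _
    simp [coordL_inr_inl]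
  · show coordL ty (.inr (.inr ⟨P', b'⟩)) (EuclideanSpace.single k 1, 0) = _
    simp [e3]
  · rw [e1, e4, e4]; simp
  · rw [e1, coordL_inr_inl, coordL_inr_inl, incr_snd, incr_snd]
    simp only [Sum.inr.injEq, Sum.inl.injEq]
    split_ifs
    · rw [hI]; norm_num
    · simp
  · rw [e1, e3, e3, incr_snd, incr_snd]
    simp only [Sum.inr.injEq, reduceCtorEq, if_false]
    split_ifs <;> simp
  · rw [e2, e4, e4]; simp
  · rw [e2, coordL_inr_inl, coordL_inr_inl, incr_snd, incr_snd]
    simp only [Sum.inr.injEq, reduceCtorEq, if_false]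
    split_ifs <;> simp
  · rw [e2, e3, e3, incr_snd, incr_snd]
    simp only [Sum.inr.injEq, swap_sigma_eq]
    split_ifs
    · simp; norm_num
    · simp

theorem vec_coordL (c : Dir ty → ℂ) (α : Dir ty) : vec c (coordL ty α) = c α := by
  simp only [vec, LinearMap.sum_apply, LinearMap.smul_apply, dirL_coordL, smul_eq_mul, mul_ite,
    mul_one, mul_zero]
  rw [Finset.sum_eq_single α]
  · simp
  · intro β _ h
    rw [if_neg h]
  · simp

/-- A complex tangent vector is determined by its values on the coordinate functions. -/
theorem vec_ext {Λ Λ' : (Coord ty →L[ℝ] ℂ) →ₗ[ℂ] ℂ}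
    (h : ∀ α, Λ (coordL ty α) = Λ' (coordL ty α)) : Λ = Λ' := by
  rw [← vec_coordL_eq Λ, ← vec_coordL_eq Λ']
  simp only [h]

theorem der_coordL (Λ : (Coord ty →L[ℝ] ℂ) →ₗ[ℂ] ℂ) (α : Dir ty) (z : Coord ty) :
    der Λ (fun w => coordL ty α w) z = Λ (coordL ty α) := by
  rw [der]
  congr 1
  exact (coordL ty α).fderiv

/-- The coordinate complex tangent vectors are of the form `u + i v` with real tangent vectors `u`
and `v`. This reduces their properties to those of the real derivative. -/
theorem dirL_eq (α : Dir ty) : ∃ u v : Coord ty, ∀ L, dirL α L = L u + Complex.I * L v := by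
  rcases α with k | ⟨P, b⟩ | ⟨P, b⟩
  · exact ⟨(EuclideanSpace.single k 1, 0), 0, fun L => by simp [dirL, evalL]⟩
  · refine ⟨(1 / 2 : ℝ) • incr P b 1, (-1 / 2 : ℝ) • incr P b Complex.I, fun L => ?_⟩
    simp only [dirL, evalL, map_smul, LinearMap.smul_apply, LinearMap.sub_apply, LinearMap.coe_mk,
      AddHom.coe_mk, smul_eq_mul, Complex.real_smul]
    push_cast
    ring
  · refine ⟨(1 / 2 : ℝ) • incr P (swapIdx b) 1, (1 / 2 : ℝ) • incr P (swapIdx b) Complex.I,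
      fun L => ?_⟩
    simp only [dirL, evalL, map_smul, LinearMap.smul_apply, LinearMap.add_apply, LinearMap.coe_mk,
      AddHom.coe_mk, smul_eq_mul, Complex.real_smul]
    push_cast
    ring

theorem contDiffOn_der_dirL {f : Coord ty → ℂ} {s : Set (Coord ty)} (hs : IsOpen s)
    (hf : ContDiffOn ℝ ∞ f s) (α : Dir ty) : ContDiffOn ℝ ∞ (fun w => der (dirL α) f w) s := by
  obtain ⟨u, v, h⟩ := dirL_eq α
  have h1 : ContDiffOn ℝ ∞ (fderiv ℝ f) s := hf.fderiv_of_isOpen hs (by simp)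
  simp only [der, h]
  exact (h1.clm_apply contDiffOn_const).add
    (contDiffOn_const.mul (h1.clm_apply contDiffOn_const))

/-- Partial derivatives commute. -/
theorem der_dirL_comm {f : Coord ty → ℂ} {z : Coord ty} (hf : ContDiffAt ℝ ∞ f z) (α β : Dir ty) :
    der (dirL α) (fun w => der (dirL β) f w) z = der (dirL β) (fun w => der (dirL α) f w) z := by
  obtain ⟨u, v, h⟩ := dirL_eq α
  obtain ⟨u', v', h'⟩ := dirL_eq β
  have hd : DifferentiableAt ℝ (fderiv ℝ f) z :=
    (hf.fderiv_right (m := 1)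
      (le_of_eq_of_le one_add_one_eq_two two_le_infty)).differentiableAt (by simp)
  have hsymm : IsSymmSndFDerivAt ℝ f z := hf.isSymmSndFDerivAt (by
    rw [minSmoothness_of_isRCLikeNormedField]; exact two_le_infty)
  have key : ∀ p q w : Coord ty, fderiv ℝ (fun w => fderiv ℝ f w p + Complex.I * fderiv ℝ f w q) z w
      = fderiv ℝ (fderiv ℝ f) z w p + Complex.I * fderiv ℝ (fderiv ℝ f) z w q := by
    intro p q w
    have h1 : ∀ p, HasFDerivAt (fun w => fderiv ℝ f w p) ((fderiv ℝ (fderiv ℝ f) z).flip p) z := by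
      intro p
      have := hd.hasFDerivAt.clm_apply (hasFDerivAt_const p z)
      simpa using this
    have h2 := (h1 p).add ((h1 q).const_mul Complex.I)
    rw [show (fun w => fderiv ℝ f w p + Complex.I * fderiv ℝ f w q) =
      (fun w => fderiv ℝ f w p) + fun w => Complex.I * fderiv ℝ f w q from rfl, h2.fderiv]
    simp
  have hs := fun a b => hsymm.eq a b
  simp only [der, h, h', key]
  rw [hs u u', hs u v', hs v u', hs v v']
  ring

/-- The commutator of two complex vector fields: second derivatives cancel. -/
theorem der_vec_commutator {c c' : Coord ty → Dir ty → ℂ} {f : Coord ty → ℂ} {z : Coord ty}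
    (hc : ∀ α, DifferentiableAt ℝ (fun w => c w α) z)
    (hc' : ∀ α, DifferentiableAt ℝ (fun w => c' w α) z) (hf : ContDiffAt ℝ ∞ f z) :
    der (vec (c z)) (fun w => der (vec (c' w)) f w) z -
      der (vec (c' z)) (fun w => der (vec (c w)) f w) z =
    ∑ α, (der (vec (c z)) (fun w => c' w α) z - der (vec (c' z)) (fun w => c w α) z) *
      der (dirL α) f z := by
  have hd : ∀ α, DifferentiableAt ℝ (fun w => der (dirL α) f w) z := by
    intro α
    obtain ⟨u, v, h⟩ := dirL_eq α
    have hd : DifferentiableAt ℝ (fderiv ℝ f) z :=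
      (hf.fderiv_right (m := 1)
        (le_of_eq_of_le one_add_one_eq_two two_le_infty)).differentiableAt (by simp)
    simp only [der, h]
    exact (hd.clm_apply (differentiableAt_const _)).add
      ((differentiableAt_const _).mul (hd.clm_apply (differentiableAt_const _)))
  have step : ∀ (Λ : (Coord ty →L[ℝ] ℂ) →ₗ[ℂ] ℂ) (c : Coord ty → Dir ty → ℂ),
      (∀ α, DifferentiableAt ℝ (fun w => c w α) z) →
      der Λ (fun w => der (vec (c w)) f w) z = ∑ α, (der Λ (fun w => c w α) z * der (dirL α) f z
        + c z α * der Λ (fun w => der (dirL α) f w) z) := by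
    intro Λ c hc
    simp only [der_vec]
    rw [der_sum fun α _ => (hc α).fun_mul (hd α)]
    exact Finset.sum_congr rfl fun α _ => der_mul (hc α) (hd α)
  rw [step _ c' hc', step _ c hc, Finset.sum_add_distrib, Finset.sum_add_distrib]
  simp only [sub_mul, Finset.sum_sub_distrib]
  -- the terms with second derivatives are symmetric in the two fields
  have hsw : ∑ α, c' z α * der (vec (c z)) (fun w => der (dirL α) f w) z =
      ∑ α, c z α * der (vec (c' z)) (fun w => der (dirL α) f w) z := by
    simp only [der_vec (c z) (fun w => der _ f w), der_vec (c' z) (fun w => der _ f w),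
      Finset.mul_sum]
    rw [Finset.sum_comm]
    refine Finset.sum_congr rfl fun α _ => Finset.sum_congr rfl fun β _ => ?_
    rw [der_dirL_comm hf β α]
    ring
  rw [hsw]
  ring

end Coordinates

end

universe u v

variable {M : Type u} [TopologicalSpace M] [ChartedSpace (EuclideanSpace ℝ (Fin 4)) M]
  [IsManifold (𝓡 4) ∞ M]
  {S : M → Type v} [∀ p, AddCommGroup (S p)] [∀ p, Module ℂ (S p)]
  [∀ p, TopologicalSpace (S p)] [TopologicalSpace (TotalSpace (Fin 2 → ℂ) S)]
  [FiberBundle (Fin 2 → ℂ) S] [VectorBundle ℂ (Fin 2 → ℂ) S]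
  [ContMDiffVectorBundle ∞ (Fin 2 → ℂ) S (𝓡 4)]
  {𝓢 : SpinorSpacetime M S} {J : ℕ} {ty : Fin J → SType} {t : SType}

/-! ### Transition matrices and the transformation of components -/

section Transition

theorem hermBasis_apply {V : Type*} [AddCommGroup V] [Module ℂ V] (b : Basis (Fin 2) ℂ V)
    (j : Fin 2) (v : V) : hermBasis b j v = starRingEnd ℂ (b.repr v j) := by
  have h : hermBasis b j v =
      ∑ i, starRingEnd ℂ (b.repr v i) * (Pi.single j (1 : ℂ) : Fin 2 → ℂ) i := by
    rw [hermBasis, Basis.coe_ofEquivFun]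
    rfl
  rw [h]
  simp [Pi.single_apply]

theorem dualBasis_repr_dualBasis {R V : Type*} [CommRing R] [AddCommGroup V] [Module R V] {n : ℕ}
    (b b' : Basis (Fin n) R V) (i j : Fin n) :
    b.dualBasis.repr (b'.dualBasis j) i = b'.repr (b i) j := by
  rw [Basis.dualBasis_repr, Basis.dualBasis_apply]

/-- Complexification, and lifting to another universe, do not change the transition matrix of real
bases. -/
theorem complexified_repr {V : Type*} [AddCommGroup V] [Module ℝ V] (b b' : Basis (Fin 4) ℝ V)
    (i j : Fin 4) : ((b.baseChange ℂ).map (ULift.moduleEquiv.{_, _, v} (R := ℂ)).symm).repr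
      ((b'.baseChange ℂ).map (ULift.moduleEquiv.{_, _, v} (R := ℂ)).symm j) i =
        (b.repr (b' j) i : ℂ) := by
  rw [Basis.map_apply, Basis.map_repr, LinearEquiv.trans_apply, LinearEquiv.symm_symm,
    LinearEquiv.apply_symm_apply, Basis.baseChange_apply, Basis.baseChange_repr_tmul,
    Complex.real_smul, mul_one]

namespace EquippedChart

/-- The transition matrices for all kinds of indices: `tAct (e.trans e' p)` transforms the
components in the frame of `e'` into those in the frame of `e`. -/
def trans (e e' : EquippedChart 𝓢) (p : M) : KindMat
  | .spinor => e.spinTrans e' p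
  | .cospinor => (e'.spinTrans e p).transpose
  | .barSpinor => (e.spinTrans e' p).map (starRingEnd ℂ)
  | .barCospinor => (e'.spinTrans e p).transpose.map (starRingEnd ℂ)
  | .vector => e.tanTrans e' p
  | .covector => (e'.tanTrans e p).transpose

theorem spinTrans_mul (e e' : EquippedChart 𝓢) (p : M) : e.spinTrans e' p * e'.spinTrans e p = 1 :=
  Basis.toMatrix_mul_toMatrix_flip _ _

theorem tanTrans_mul (e e' : EquippedChart 𝓢) (p : M) : e.tanTrans e' p * e'.tanTrans e p = 1 := by
  have h := Basis.toMatrix_mul_toMatrix_flip (e.tanFrame p) (e'.tanFrame p)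
  have h2 := congrArg (fun A : Matrix (Fin 4) (Fin 4) ℝ => A.map Complex.ofRealHom) h
  simp only [Matrix.map_mul] at h2
  rw [Matrix.map_one _ (map_zero _) (map_one _)] at h2
  exact h2

theorem trans_mul (e e' : EquippedChart 𝓢) (p : M) : e.trans e' p * e'.trans e p = 1 := by
  funext k
  cases k
  · exact spinTrans_mul e e' p
  · show (e'.spinTrans e p).transpose * (e.spinTrans e' p).transpose = 1
    rw [← Matrix.transpose_mul, spinTrans_mul, Matrix.transpose_one]
  · show (e.spinTrans e' p).map (starRingEnd ℂ) * (e'.spinTrans e p).map (starRingEnd ℂ) = 1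
    rw [← Matrix.map_mul, spinTrans_mul, Matrix.map_one _ (map_zero _) (map_one _)]
  · show (e'.spinTrans e p).transpose.map (starRingEnd ℂ) *
      (e.spinTrans e' p).transpose.map (starRingEnd ℂ) = 1
    rw [← Matrix.map_mul, ← Matrix.transpose_mul, spinTrans_mul, Matrix.transpose_one,
      Matrix.map_one _ (map_zero _) (map_one _)]
  · exact tanTrans_mul e e' p
  · show (e'.tanTrans e p).transpose * (e.tanTrans e' p).transpose = 1
    rw [← Matrix.transpose_mul, tanTrans_mul, Matrix.transpose_one]

theorem indexBasis_repr (e e' : EquippedChart 𝓢) (p : M) (k : Kind) (i j : Fin k.dim) :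
    (indexBasis (e.spinFrame p) (e.tanFrame p) k).repr
      (indexBasis (e'.spinFrame p) (e'.tanFrame p) k j) i = e.trans e' p k i j := by
  cases k
  · rfl
  · exact dualBasis_repr_dualBasis (e.spinFrame p) (e'.spinFrame p) i j
  · refine (dualBasis_repr_dualBasis (hermBasis (e.spinFrame p)) (hermBasis (e'.spinFrame p))
      i j).trans ?_
    exact hermBasis_apply (e.spinFrame p) i (e'.spinFrame p j)
  · exact hermBasis_apply (e'.spinFrame p) j (e.spinFrame p i)
  · exact complexified_repr.{v, 0} (e.tanFrame p) (e'.tanFrame p) i j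
  · refine (complexified_repr.{v, 0} (e.tanFrame p).dualBasis
      (e'.tanFrame p).dualBasis i j).trans ?_
    exact congrArg Complex.ofReal
      (dualBasis_repr_dualBasis (e.tanFrame p) (e'.tanFrame p) i j)

/-- The transition matrix of the tensor bases of two frames is the tensor product of the transition
matrices for all indices. -/
theorem basis_repr (e e' : EquippedChart 𝓢) (t : SType) (p : M) (a b : Idx t) :
    (e.basis t p).repr (e'.basis t p b) a = ∏ k, ∏ μ, e.trans e' p k (a k μ) (b k μ) := by
  classical
  have h : e'.basis t p b = PiTensorProduct.tprod ℂ fun s : (Σ k : Kind, Fin (t k)) =>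
      indexBasis (e'.spinFrame p) (e'.tanFrame p) s.1 (b s.1 s.2) := by
    show ((Basis.piTensorProduct _).reindex _) b = _
    rw [Basis.reindex_apply, Basis.piTensorProduct_apply]
    rfl
  rw [h]
  show ((Basis.piTensorProduct _).reindex _).repr _ a = _
  rw [Basis.repr_reindex_apply, Basis.piTensorProduct_repr_tprod_apply, Fintype.prod_sigma]
  refine Finset.prod_congr rfl fun k _ => Finset.prod_congr rfl fun μ _ => ?_
  exact indexBasis_repr e e' p k _ _

/-- The transformation law of the components of a spin-tensor. -/
theorem equivFun_eq_tAct (e e' : EquippedChart 𝓢) (t : SType) (p : M) (X : SpinTensor S t p) :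
    (e.basis t p).equivFun X = tAct (e.trans e' p) ((e'.basis t p).equivFun X) := by
  classical
  funext a
  conv_lhs => rw [← (e'.basis t p).sum_equivFun X]
  simp only [map_sum, map_smul, Finset.sum_apply, Pi.smul_apply, smul_eq_mul, tAct]
  refine Finset.sum_congr rfl fun b _ => ?_
  rw [mul_comm, Basis.equivFun_apply, basis_repr]

theorem tAct_trans_trans (e e' : EquippedChart 𝓢) (p : M) (X : Idx t → ℂ) :
    tAct (e.trans e' p) (tAct (e'.trans e p) X) = X := by
  rw [← tAct_mul, trans_mul, tAct_one]

theorem point_coord (e : EquippedChart 𝓢) (q : Composite S ty) (hq : q.1 ∈ e.chart.source) :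
    e.point (e.coord q) = q := by
  have h : ∀ p' : M, p' = q.1 → (⟨p', fun P => (e.basis (ty P) p').equivFun.symm
      ((e.basis (ty P) q.1).equivFun (q.2 P))⟩ : Composite S ty) = q := by
    rintro p' rfl
    simp
  exact h _ (e.chart.left_inv hq)

theorem coord_point (e : EquippedChart 𝓢) {z : Coord ty} (hz : z ∈ e.dom ty) :
    e.coord (e.point z) = z := by
  refine Prod.ext (e.chart.right_inv hz) ?_
  funext P
  exact LinearEquiv.apply_symm_apply _ _

theorem point_mem (e : EquippedChart 𝓢) {z : Coord ty} (hz : z ∈ e.dom ty) :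
    (e.point z).1 ∈ e.chart.source := e.chart.map_target hz

theorem coord_mem (e : EquippedChart 𝓢) {q : Composite S ty} (hq : q.1 ∈ e.chart.source) :
    e.coord q ∈ e.dom ty := e.chart.map_source hq

theorem isOpen_dom (e : EquippedChart 𝓢) : IsOpen (e.dom ty) :=
  e.chart.open_target.preimage continuous_fst

end EquippedChart

theorem rep_coord (X : ExtField S ty t) (e : EquippedChart 𝓢) {q : Composite S ty}
    (hq : q.1 ∈ e.chart.source) : X.rep e (e.coord q) = (e.basis t q.1).equivFun (X q) := by
  unfold ExtField.rep
  rw [e.point_coord q hq]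

/-- The functions `F e` transform as the components of a spin-tensor. -/
def IsTensorial (F : EquippedChart 𝓢 → Coord ty → Idx t → ℂ) : Prop :=
  ∀ (e e' : EquippedChart 𝓢) (q : Composite S ty), q.1 ∈ e.chart.source → q.1 ∈ e'.chart.source →
    F e (e.coord q) = tAct (e.trans e' q.1) (F e' (e'.coord q))

theorem isTensorial_rep (X : ExtField S ty t) : IsTensorial (𝓢 := 𝓢) fun e => X.rep e := by
  intro e e' q h h'
  show X.rep e (e.coord q) = tAct (e.trans e' q.1) (X.rep e' (e'.coord q))
  rw [rep_coord X e h, rep_coord X e' h']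
  exact e.equivFun_eq_tAct e' t q.1 (X q)

/-- Functions with the transformation law of components define a field. -/
theorem IsTensorial.isRep {F : EquippedChart 𝓢 → Coord ty → Idx t → ℂ} (hF : IsTensorial F) :
    IsRep F (ofLocal F) := by
  intro e z hz
  have hp := e.point_mem hz
  have hex : ∃ e' : EquippedChart 𝓢, (e.point z).1 ∈ e'.chart.source := ⟨e, hp⟩
  have hval : ∀ q : Composite S ty, ∀ hex : ∃ e : EquippedChart 𝓢, q.1 ∈ e.chart.source,
      ofLocal F q = (hex.choose.basis t q.1).equivFun.symm (F hex.choose (hex.choose.coord q)) := by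
    intro q hex
    rw [ofLocal, dif_pos hex]
  rw [ExtField.rep, hval _ hex, e.equivFun_eq_tAct hex.choose, LinearEquiv.apply_symm_apply,
    ← hF e _ _ hp hex.choose_spec, e.coord_point hz]

end Transition

/-! ### Smoothness of frames and transition matrices -/

section Smoothness

theorem infty_add_one_le : (∞ : WithTop ℕ∞) + 1 ≤ ∞ := by
  exact_mod_cast le_top

/-- The regularity required by the Lie bracket of vector fields on manifolds. -/
instance : IsManifold (𝓡 4) (minSmoothness ℝ 2) M := by
  rw [minSmoothness_of_isRCLikeNormedField]
  exact IsManifold.of_le (n := ∞) two_le_infty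

/-- On a vector space the bracket of vector fields is the usual commutator. -/
theorem mlieBracket_eq_fderiv (V W : ∀ x : EuclideanSpace ℝ (Fin 4), TangentSpace (𝓡 4) x)
    (x : EuclideanSpace ℝ (Fin 4)) :
    VectorField.mlieBracket (𝓡 4) V W x = fderiv ℝ (F := EuclideanSpace ℝ (Fin 4)) W x (V x) -
      fderiv ℝ (F := EuclideanSpace ℝ (Fin 4)) V x (W x) := by
  have h := VectorField.mlieBracketWithin_eq_lieBracketWithin (𝕜 := ℝ) (V := V) (W := W)
    (s := Set.univ)
  rw [VectorField.mlieBracketWithin_univ] at h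
  exact (congrFun h x).trans
    (congrFun (VectorField.lieBracketWithin_univ (𝕜 := ℝ) (E := EuclideanSpace ℝ (Fin 4))) x)

namespace EquippedChart

/-- The coordinates `x` of points in the domains of two charts. -/
def overlap (e e' : EquippedChart 𝓢) : Set (EuclideanSpace ℝ (Fin 4)) :=
  e.chart.target ∩ e.chart.symm ⁻¹' e'.chart.source

theorem isOpen_overlap (e e' : EquippedChart 𝓢) : IsOpen (e.overlap e') :=
  e.chart.isOpen_inter_preimage_symm e'.chart.open_source

theorem contDiffOn_comp_symm {F : Type*} [NormedAddCommGroup F] [NormedSpace ℝ F]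
    (e : EquippedChart 𝓢) {U : Set M} {f : M → F} (hf : ContMDiffOn (𝓡 4) 𝓘(ℝ, F) ∞ f U) :
    ContDiffOn ℝ ∞ (fun x => f (e.chart.symm x)) (e.chart.target ∩ e.chart.symm ⁻¹' U) := by
  rw [← contMDiffOn_iff_contDiffOn]
  exact hf.comp ((contMDiffOn_symm_of_mem_maximalAtlas e.chart_mem).mono Set.inter_subset_left)
    fun x hx => hx.2

theorem smoothVector_tanFrame (e : EquippedChart 𝓢) (i : Fin 4) :
    SmoothVectorOn (fun p => e.tanFrame p i) e.chart.source :=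
  𝓢.assoc_smooth e.chart.source e.spinFrame e.chart.open_source e.spinFrame_smooth
    e.spinFrame_orthonormal i

/-- The transition functions of spinor frames are values of the spin-metric. -/
theorem spinTrans_eq (e e' : EquippedChart 𝓢) {p : M} (hp : p ∈ e.chart.source) (i : Fin 2) :
    e.spinTrans e' p 0 i = 𝓢.d p (e'.spinFrame p i) (e.spinFrame p 1) ∧
      e.spinTrans e' p 1 i = 𝓢.d p (e.spinFrame p 0) (e'.spinFrame p i) := by
  have h0 : ∀ φ, 𝓢.d p φ φ = 0 := fun φ => self_eq_neg.1 (𝓢.d_skew p φ φ)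
  have h1 := e.spinFrame_orthonormal p hp
  have h2 : e'.spinFrame p i = e.spinTrans e' p 0 i • e.spinFrame p 0 +
      e.spinTrans e' p 1 i • e.spinFrame p 1 := by
    rw [← (e.spinFrame p).sum_repr (e'.spinFrame p i), Fin.sum_univ_two]
    rfl
  constructor
  · conv_rhs => rw [h2]
    simp [h0, h1]
  · conv_rhs => rw [h2]
    simp [h0, h1]

theorem contMDiffOn_spinTrans (e e' : EquippedChart 𝓢) (i j : Fin 2) :
    ContMDiffOn (𝓡 4) 𝓘(ℝ, ℂ) ∞ (fun p => e.spinTrans e' p i j)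
      (e.chart.source ∩ e'.chart.source) := by
  have ho : IsOpen (e.chart.source ∩ e'.chart.source) :=
    e.chart.open_source.inter e'.chart.open_source
  have hs : ∀ i, SmoothSpinorOn (fun p => e.spinFrame p i) (e.chart.source ∩ e'.chart.source) :=
    fun i => (e.spinFrame_smooth i).mono Set.inter_subset_left
  have hs' : ∀ i, SmoothSpinorOn (fun p => e'.spinFrame p i) (e.chart.source ∩ e'.chart.source) :=
    fun i => (e'.spinFrame_smooth i).mono Set.inter_subset_right
  fin_cases i
  · exact (𝓢.d_smooth _ _ _ ho (hs' j) (hs 1)).congr fun p hp => (e.spinTrans_eq e' hp.1 j).1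
  · exact (𝓢.d_smooth _ _ _ ho (hs 0) (hs' j)).congr fun p hp => (e.spinTrans_eq e' hp.1 j).2

theorem contDiffOn_spinTrans (e e' : EquippedChart 𝓢) (i j : Fin 2) :
    ContDiffOn ℝ ∞ (fun x => e.spinTrans e' (e.chart.symm x) i j) (e.overlap e') :=
  (e.contDiffOn_comp_symm (e.contMDiffOn_spinTrans e' i j)).mono fun _ hx =>
    ⟨hx.1, e.chart.map_target hx.1, hx.2⟩

/-- The inverse transition functions, in the coordinates of the same chart. -/
theorem contDiffOn_spinTrans' (e e' : EquippedChart 𝓢) (i j : Fin 2) :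
    ContDiffOn ℝ ∞ (fun x => e'.spinTrans e (e.chart.symm x) i j) (e.overlap e') :=
  (e.contDiffOn_comp_symm (e'.contMDiffOn_spinTrans e i j)).mono fun _ hx =>
    ⟨hx.1, hx.2, e.chart.map_target hx.1⟩

/-- The transition functions of tangent frames are the images of those of spinor frames, so that the
smoothness of the former follows from the smoothness of the latter. -/
theorem tanTrans_eq_lorentz (e e' : EquippedChart 𝓢) {p : M} (hp : p ∈ e.chart.source)
    (hp' : p ∈ e'.chart.source) :
    e.tanTrans e' p = (lorentz (e.spinTrans e' p)).map (fun r : ℝ => (r : ℂ)) := by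
  unfold tanTrans tanFrame spinTrans
  rw [𝓢.assoc_lorentz p _ _ (e.spinFrame_orthonormal p hp) (e'.spinFrame_orthonormal p hp')]

theorem contDiffOn_conj {E : Type*} [NormedAddCommGroup E] [NormedSpace ℝ E] {s : Set E} {f : E → ℂ}
    (hf : ContDiffOn ℝ ∞ f s) : ContDiffOn ℝ ∞ (fun x => starRingEnd ℂ (f x)) s :=
  Complex.conjCLE.contDiff.comp_contDiffOn hf

/-- The canonical homomorphism is a smooth function of matrix elements. -/
theorem contDiffOn_lorentz {E : Type*} [NormedAddCommGroup E] [NormedSpace ℝ E] {s : Set E}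
    {F : E → Matrix (Fin 2) (Fin 2) ℂ} (hF : ∀ i j, ContDiffOn ℝ ∞ (fun x => F x i j) s)
    (i j : Fin 4) : ContDiffOn ℝ ∞ (fun x => (lorentz (F x) i j : ℂ)) s := by
  have h : ContDiffOn ℝ ∞ (fun x => (1 / 2 : ℂ) *
      (pauli i * F x * pauli j * (F x).conjTranspose).trace) s := by
    simp only [Matrix.trace, Matrix.diag, Matrix.mul_apply, Matrix.conjTranspose_apply]
    refine contDiffOn_const.mul (ContDiffOn.sum fun _ _ => ContDiffOn.sum fun _ _ => ?_)
    refine ContDiffOn.mul (ContDiffOn.sum fun _ _ => ContDiffOn.mul (ContDiffOn.sum fun _ _ =>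
      contDiffOn_const.mul (hF _ _)) contDiffOn_const) (contDiffOn_conj (hF _ _))
  exact Complex.ofRealCLM.contDiff.comp_contDiffOn (Complex.reCLM.contDiff.comp_contDiffOn h)

theorem contDiffOn_tanTrans (e e' : EquippedChart 𝓢) (i j : Fin 4) :
    ContDiffOn ℝ ∞ (fun x => e.tanTrans e' (e.chart.symm x) i j) (e.overlap e') := by
  refine (contDiffOn_lorentz (e.contDiffOn_spinTrans e') i j).congr fun _ hx => ?_
  rw [e.tanTrans_eq_lorentz e' (e.chart.map_target hx.1) hx.2]
  rfl

theorem contDiffOn_tanTrans' (e e' : EquippedChart 𝓢) (i j : Fin 4) :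
    ContDiffOn ℝ ∞ (fun x => e'.tanTrans e (e.chart.symm x) i j) (e.overlap e') := by
  refine (contDiffOn_lorentz (e.contDiffOn_spinTrans' e') i j).congr fun _ hx => ?_
  rw [e'.tanTrans_eq_lorentz e hx.2 (e.chart.map_target hx.1)]
  rfl

theorem contDiffOn_trans (e e' : EquippedChart 𝓢) (k : Kind) (i j : Fin k.dim) :
    ContDiffOn ℝ ∞ (fun x => e.trans e' (e.chart.symm x) k i j) (e.overlap e') := by
  cases k
  · exact e.contDiffOn_spinTrans e' i j
  · exact e.contDiffOn_spinTrans' e' j i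
  · exact contDiffOn_conj (e.contDiffOn_spinTrans e' i j)
  · exact contDiffOn_conj (e.contDiffOn_spinTrans' e' j i)
  · exact e.contDiffOn_tanTrans e' i j
  · exact e.contDiffOn_tanTrans' e' j i

theorem contDiffOn_trans' (e e' : EquippedChart 𝓢) (k : Kind) (i j : Fin k.dim) :
    ContDiffOn ℝ ∞ (fun x => e'.trans e (e.chart.symm x) k i j) (e.overlap e') := by
  cases k
  · exact e.contDiffOn_spinTrans' e' i j
  · exact e.contDiffOn_spinTrans e' j i
  · exact contDiffOn_conj (e.contDiffOn_spinTrans' e' i j)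
  · exact contDiffOn_conj (e.contDiffOn_spinTrans e' j i)
  · exact e.contDiffOn_tanTrans' e' i j
  · exact e.contDiffOn_tanTrans e' j i

/-- Complex conjugation of components commutes with changes of equipped charts. -/
theorem tauComp_tAct_trans (e e' : EquippedChart 𝓢) (p : M) (X : Idx t → ℂ) :
    tauComp (tAct (e.trans e' p) X) = tAct (e.trans e' p) (tauComp X) := by
  refine tauComp_tAct (fun _ _ => rfl) (fun _ _ => rfl) (fun _ _ => ?_) (fun _ _ => ?_) X
  · exact Complex.conj_ofReal _
  · exact Complex.conj_ofReal _

/-! ### Frame vectors in coordinates and their commutators -/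

theorem mdifferentiable_chart (e : EquippedChart 𝓢) : e.chart.MDifferentiable (𝓡 4) (𝓡 4) :=
  ⟨(contMDiffOn_of_mem_maximalAtlas e.chart_mem).mdifferentiableOn (by simp),
    (contMDiffOn_symm_of_mem_maximalAtlas e.chart_mem).mdifferentiableOn (by simp)⟩

/-- The differential of a chart at the point with the coordinates `x`. -/
def dchart (e : EquippedChart 𝓢) (x : EuclideanSpace ℝ (Fin 4)) :
    TangentSpace (𝓡 4) (e.chart.symm x) →L[ℝ] EuclideanSpace ℝ (Fin 4) :=
  mfderiv (𝓡 4) (𝓡 4) e.chart (e.chart.symm x)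

/-- The differential of the inverse of a chart. -/
def dsymm (e : EquippedChart 𝓢) (x : EuclideanSpace ℝ (Fin 4)) :
    EuclideanSpace ℝ (Fin 4) →L[ℝ] TangentSpace (𝓡 4) (e.chart.symm x) :=
  mfderiv (𝓡 4) (𝓡 4) e.chart.symm x

/-- The frame vector `Υ_j` in the coordinates `x`. -/
def frameVec (e : EquippedChart 𝓢) (j : Fin 4) (x : EuclideanSpace ℝ (Fin 4)) :
    EuclideanSpace ℝ (Fin 4) :=
  e.dchart x (e.tanFrame (e.chart.symm x) j)

theorem upsilon_eq (e : EquippedChart 𝓢) (j k : Fin 4) (x : EuclideanSpace ℝ (Fin 4)) :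
    e.upsilon j k x = e.frameVec j x k := rfl

/-- The differential of the inverse of a chart is inverse to the differential of the chart. -/
theorem mfderiv_symm_eq (e : EquippedChart 𝓢) {x : EuclideanSpace ℝ (Fin 4)}
    (hx : x ∈ e.chart.target) :
    ∃ A : EuclideanSpace ℝ (Fin 4) ≃L[ℝ] TangentSpace (𝓡 4) (e.chart.symm x),
      e.dsymm x = A ∧ e.dchart x = A.symm :=
  ⟨e.mdifferentiable_chart.symm.mfderiv hx, rfl, rfl⟩

/-- The representation of a vector field in a chart is its pullback under the inverse of the chart.
-/
theorem mpullback_symm (e : EquippedChart 𝓢) (V : ∀ p : M, TangentSpace (𝓡 4) p)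
    {x : EuclideanSpace ℝ (Fin 4)} (hx : x ∈ e.chart.target) :
    VectorField.mpullback (𝓡 4) (𝓡 4) e.chart.symm V x = e.dchart x (V (e.chart.symm x)) := by
  obtain ⟨A, h1, h2⟩ := e.mfderiv_symm_eq hx
  show (e.dsymm x).inverse (V (e.chart.symm x)) = _
  rw [h1, h2, ContinuousLinearMap.inverse_equiv]

theorem contDiffOn_frameVec (e : EquippedChart 𝓢) (j : Fin 4) :
    ContDiffOn ℝ ∞ (e.frameVec j) e.chart.target := by
  intro x hx
  obtain ⟨A, h1, h2⟩ := e.mfderiv_symm_eq hx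
  have hV : ContMDiffAt (𝓡 4) (𝓡 4).tangent ∞
      (fun p => (⟨p, e.tanFrame p j⟩ : TangentBundle (𝓡 4) M)) (e.chart.symm x) :=
    (e.smoothVector_tanFrame j).contMDiffAt (e.chart.open_source.mem_nhds (e.chart.map_target hx))
  have hf := contMDiffAt_symm_of_mem_maximalAtlas e.chart_mem hx
  have h := ContMDiffAt.mpullback_vectorField_preimage (m := ∞) hV hf
    ⟨A, h1.symm⟩ infty_add_one_le
  have h' : ContDiffAt ℝ ∞ (VectorField.mpullback (𝓡 4) (𝓡 4) e.chart.symm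
      (fun p => e.tanFrame p j)) x := by
    rw [← contMDiffAt_vectorSpace_iff_contDiffAt]
    exact h
  refine (h'.congr_of_eventuallyEq ?_).contDiffWithinAt
  filter_upwards [e.chart.open_target.mem_nhds hx] with y hy
  exact (e.mpullback_symm (fun p => e.tanFrame p j) hy).symm

theorem contDiffOn_upsilon (e : EquippedChart 𝓢) (j k : Fin 4) :
    ContDiffOn ℝ ∞ (fun x => (e.upsilon j k x : ℂ)) e.chart.target :=
  Complex.ofRealCLM.contDiff.comp_contDiffOn
    ((EuclideanSpace.proj (𝕜 := ℝ) k).contDiff.comp_contDiffOn (e.contDiffOn_frameVec j))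

/-- The commutators of the frame vectors in coordinates: the pullback under the inverse of the chart
preserves brackets. -/
theorem frameVec_commutator (e : EquippedChart 𝓢) (i j : Fin 4) {x : EuclideanSpace ℝ (Fin 4)}
    (hx : x ∈ e.chart.target) :
    fderiv ℝ (e.frameVec j) x (e.frameVec i x) - fderiv ℝ (e.frameVec i) x (e.frameVec j x) =
      ∑ k, e.structC k i j (e.chart.symm x) • e.frameVec k x := by
  have hV : ∀ j, MDifferentiableAt (𝓡 4) (𝓡 4).tangent
      (fun p => (⟨p, e.tanFrame p j⟩ : TangentBundle (𝓡 4) M)) (e.chart.symm x) := fun j =>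
    ((e.smoothVector_tanFrame j).contMDiffAt
      (e.chart.open_source.mem_nhds (e.chart.map_target hx))).mdifferentiableAt (by simp)
  have hf := contMDiffAt_symm_of_mem_maximalAtlas e.chart_mem hx
  have h := VectorField.mpullback_mlieBracket (hV i) (hV j) hf
    (by rw [minSmoothness_of_isRCLikeNormedField]; exact two_le_infty)
  have hev : ∀ j, VectorField.mpullback (𝓡 4) (𝓡 4) e.chart.symm (fun p => e.tanFrame p j)
      =ᶠ[nhds x] e.frameVec j := fun j => by
    filter_upwards [e.chart.open_target.mem_nhds hx] with y hy
    exact e.mpullback_symm (fun p => e.tanFrame p j) hy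
  rw [Filter.EventuallyEq.mlieBracket_vectorField_eq (hev i) (hev j), e.mpullback_symm _ hx] at h
  refine Eq.trans (mlieBracket_eq_fderiv _ _ x).symm (Eq.trans h.symm ?_)
  conv_lhs => rw [← (e.tanFrame (e.chart.symm x)).sum_repr
    (VectorField.mlieBracket (𝓡 4) (fun p => e.tanFrame p i) (fun p => e.tanFrame p j)
      (e.chart.symm x))]
  rw [map_sum]
  refine Finset.sum_congr rfl fun k _ => ?_
  rw [map_smul]
  rfl

theorem smoothVector_bracket (e : EquippedChart 𝓢) (i j : Fin 4) :
    SmoothVectorOn (VectorField.mlieBracket (𝓡 4) (fun p => e.tanFrame p i)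
      (fun p => e.tanFrame p j)) e.chart.source := by
  intro p hp
  have hV : ∀ j, ContMDiffAt (𝓡 4) (𝓡 4).tangent ∞
      (fun p => (⟨p, e.tanFrame p j⟩ : TangentBundle (𝓡 4) M)) p := fun j =>
    (e.smoothVector_tanFrame j).contMDiffAt (e.chart.open_source.mem_nhds hp)
  have : IsManifold (𝓡 4) ((⊤ : ℕ∞) + 1) M := inferInstanceAs (IsManifold (𝓡 4) ∞ M)
  exact (ContMDiffAt.mlieBracket_vectorField (m := ⊤) (n := ⊤) (hV i) (hV j)
    (by rw [minSmoothness_of_isRCLikeNormedField]; exact infty_add_one_le)).contMDiffWithinAt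

/-- The structure functions are values of the metric, because the frame is orthonormal: in this form
they are smooth. -/
theorem structC_eq (e : EquippedChart 𝓢) (k i j : Fin 4) {p : M} (hp : p ∈ e.chart.source) :
    e.structC k i j p = minkowski k k *
      𝓢.g p (VectorField.mlieBracket (𝓡 4) (fun x => e.tanFrame x i) (fun x => e.tanFrame x j) p)
        (e.tanFrame p k) := by
  have ho : ∀ a b, 𝓢.g p (e.tanFrame p a) (e.tanFrame p b) = minkowski a b :=
    𝓢.assoc_orthonormal p _ (e.spinFrame_orthonormal p hp)
  rw [structC]
  set v := VectorField.mlieBracket (𝓡 4) (fun x => e.tanFrame x i) (fun x => e.tanFrame x j) p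
  conv_rhs => rw [← (e.tanFrame p).sum_repr v]
  simp only [map_sum, map_smul, LinearMap.sum_apply, LinearMap.smul_apply, ho, smul_eq_mul]
  rw [Finset.sum_eq_single k]
  · have h : minkowski k k * minkowski k k = 1 := by
      fin_cases k <;> simp [minkowski]
    linear_combination (-(e.tanFrame p).repr v k) * h
  · intro a _ ha
    rw [minkowski, Matrix.diagonal_apply_ne _ ha, mul_zero]
  · simp

theorem contDiffOn_structC (e : EquippedChart 𝓢) (k i j : Fin 4) :
    ContDiffOn ℝ ∞ (fun x => (e.structC k i j (e.chart.symm x) : ℂ)) e.chart.target := by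
  have h := e.contDiffOn_comp_symm (𝓢.g_smooth e.chart.source _ _ e.chart.open_source
    (e.smoothVector_bracket i j) (e.smoothVector_tanFrame k))
  have h2 : ContDiffOn ℝ ∞ (fun x => e.structC k i j (e.chart.symm x)) e.chart.target :=
    (contDiffOn_const.mul (h.mono fun x hx => ⟨hx, e.chart.map_target hx⟩)).congr fun x hx =>
      e.structC_eq k i j (e.chart.map_target hx)
  exact Complex.ofRealCLM.contDiff.comp_contDiffOn h2

/-- The change of coordinates between two charts maps frame vectors to frame vectors. -/
theorem fderiv_transition_frameVec (e e' : EquippedChart 𝓢) (j : Fin 4)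
    {x : EuclideanSpace ℝ (Fin 4)} (hx : x ∈ e.overlap e') :
    fderiv ℝ (fun y => e'.chart (e.chart.symm y)) x (e.frameVec j x) =
      ∑ c, (e'.tanFrame (e.chart.symm x)).toMatrix (e.tanFrame (e.chart.symm x)) c j •
        e'.frameVec c (e'.chart (e.chart.symm x)) := by
  obtain ⟨A, h1, h2⟩ := e.mfderiv_symm_eq hx.1
  have hc : mfderiv (𝓡 4) (𝓡 4) (fun y => e'.chart (e.chart.symm y)) x =
      (mfderiv (𝓡 4) (𝓡 4) e'.chart (e.chart.symm x)).comp
        (mfderiv (𝓡 4) (𝓡 4) e.chart.symm x) :=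
    mfderiv_comp x (e'.mdifferentiable_chart.mdifferentiableAt hx.2)
      (e.mdifferentiable_chart.symm.mdifferentiableAt hx.1)
  have hfr : ∀ c, e'.frameVec c (e'.chart (e.chart.symm x)) =
      mfderiv (𝓡 4) (𝓡 4) e'.chart (e.chart.symm x) (e'.tanFrame (e.chart.symm x) c) := by
    intro c
    have h : ∀ p' p : M, p' = p → (mfderiv (𝓡 4) (𝓡 4) e'.chart p' (e'.tanFrame p' c) :
        EuclideanSpace ℝ (Fin 4)) = mfderiv (𝓡 4) (𝓡 4) e'.chart p (e'.tanFrame p c) := by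
      rintro _ p rfl
      rfl
    exact h _ _ (e'.chart.left_inv hx.2)
  rw [← mfderiv_eq_fderiv, hc]
  have h3 : e.dsymm x (e.frameVec j x) = e.tanFrame (e.chart.symm x) j := by
    rw [frameVec, h1, h2]
    exact A.apply_symm_apply _
  show mfderiv (𝓡 4) (𝓡 4) e'.chart (e.chart.symm x)
    (e.dsymm x (e.frameVec j x)) = _
  rw [h3]
  simp only [hfr]
  conv_lhs => rw [← (e'.tanFrame (e.chart.symm x)).sum_repr (e.tanFrame (e.chart.symm x) j)]
  rw [map_sum]
  refine Finset.sum_congr rfl fun k _ => ?_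
  rw [map_smul]
  rfl

/-- The frame vectors are linearly independent in coordinates, also over `ℂ`. -/
theorem eq_zero_of_sum_upsilon (e : EquippedChart 𝓢) {x : EuclideanSpace ℝ (Fin 4)}
    (hx : x ∈ e.chart.target) {y : Fin 4 → ℂ} (hy : ∀ l, ∑ m, y m * (e.upsilon m l x : ℂ) = 0) :
    y = 0 := by
  obtain ⟨A, h1, h2⟩ := e.mfderiv_symm_eq hx
  have hli : LinearIndependent ℝ fun j => e.frameVec j x := by
    have h := (e.tanFrame (e.chart.symm x)).linearIndependent.map'
      (A.symm.toLinearEquiv : TangentSpace (𝓡 4) (e.chart.symm x) →ₗ[ℝ] EuclideanSpace ℝ (Fin 4))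
      (LinearEquiv.ker _)
    simp only [frameVec, h2]
    exact h
  have hr : ∀ r : Fin 4 → ℝ, (∀ l, ∑ m, r m * e.upsilon m l x = 0) → r = 0 := by
    intro r hr
    funext m
    refine Fintype.linearIndependent_iff.1 hli r ?_ m
    ext l
    have := hr l
    simpa [upsilon_eq] using this
  have hre := hr (fun m => (y m).re) fun l => by
    have := congrArg Complex.re (hy l)
    simpa using this
  have him := hr (fun m => (y m).im) fun l => by
    have := congrArg Complex.im (hy l)
    simpa using this
  funext m
  exact Complex.ext (congrFun hre m) (congrFun him m)

end EquippedChart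

end Smoothness

/-! ### Horizontal vector fields and their commutators -/

section Horizontal

theorem contDiffOn_sum_const_mul {E : Type*} [NormedAddCommGroup E] [NormedSpace ℝ E] {s : Set E}
    {κ : Type*} [Fintype κ] {f g : κ → E → ℂ} (hf : ∀ i, ContDiffOn ℝ ∞ (f i) s)
    (hg : ∀ i, ContDiffOn ℝ ∞ (g i) s) : ContDiffOn ℝ ∞ (fun x => ∑ i, f i x * g i x) s :=
  ContDiffOn.sum fun i _ => (hf i).mul (hg i)

theorem contDiffOn_lAct {E : Type*} [NormedAddCommGroup E] [NormedSpace ℝ E] {s : Set E}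
    {g : E → KindMat} {X : E → Idx t → ℂ} (hg : ∀ k i j, ContDiffOn ℝ ∞ (fun w => g w k i j) s)
    (hX : ∀ a, ContDiffOn ℝ ∞ (fun w => X w a) s) (a : Idx t) :
    ContDiffOn ℝ ∞ (fun w => lAct (g w) (X w) a) s := by
  simp only [lAct]
  exact ContDiffOn.sum fun k _ => ContDiffOn.sum fun μ _ => ContDiffOn.sum fun v _ =>
    (hg _ _ _).mul (hX _)

theorem _root_.ContDiffOn.diffAt {E F : Type*} [NormedAddCommGroup E] [NormedSpace ℝ E]
    [NormedAddCommGroup F] [NormedSpace ℝ F] {s : Set E} {f : E → F} {z : E}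
    (hf : ContDiffOn ℝ ∞ f s) (hs : IsOpen s) (hz : z ∈ s) : DifferentiableAt ℝ f z :=
  (hf.contDiffAt (hs.mem_nhds hz)).differentiableAt (by simp)

theorem contDiffOn_coord_snd (P : Fin J) (b : Idx (ty P)) (s : Set (Coord ty)) :
    ContDiffOn ℝ ∞ (fun w : Coord ty => w.2 P b) s :=
  (coordL ty (.inr (.inl ⟨P, b⟩))).contDiff.contDiffOn

theorem contDiffOn_tauComp_snd (P : Fin J) (b : Idx (conjType (ty P))) (s : Set (Coord ty)) :
    ContDiffOn ℝ ∞ (fun w : Coord ty => tauComp (w.2 P) b) s :=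
  (coordL ty (.inr (.inr ⟨P, b⟩))).contDiff.contDiffOn

/-- On covectors which come from the base only the components along `∂/∂x^k` of a tangent vector
matter. -/
theorem vec_comp_fst (c : Dir ty → ℂ) (L : EuclideanSpace ℝ (Fin 4) →L[ℝ] ℂ) :
    vec c (L.comp (ContinuousLinearMap.fst ℝ _ _)) =
      ∑ k, c (.inl k) * L (EuclideanSpace.single k 1) := by
  have h1 : ∀ P b (r : ℂ), L (incr (ty := ty) P b r).1 = 0 := fun P b r => by simp [incr]
  have h2 : ∀ P b, dirL (ty := ty) (.inr (.inl ⟨P, b⟩))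
      (L.comp (ContinuousLinearMap.fst ℝ _ _)) = 0 := by
    intro P b
    show (1 / 2 : ℂ) * (L (incr (ty := ty) P b 1).1 -
      Complex.I * L (incr (ty := ty) P b Complex.I).1) = 0
    rw [h1, h1]; simp
  have h3 : ∀ P b, dirL (ty := ty) (.inr (.inr ⟨P, b⟩))
      (L.comp (ContinuousLinearMap.fst ℝ _ _)) = 0 := by
    intro P b
    show (1 / 2 : ℂ) * (L (incr (ty := ty) P (swapIdx b) 1).1 +
      Complex.I * L (incr (ty := ty) P (swapIdx b) Complex.I).1) = 0
    rw [h1, h1]; simp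
  rw [vec, LinearMap.sum_apply]
  simp only [LinearMap.smul_apply, smul_eq_mul, Fintype.sum_sum_type, h2, h3, mul_zero,
    Finset.sum_const_zero, add_zero]
  rfl

theorem der_vec_fst (c : Dir ty → ℂ) {f : EuclideanSpace ℝ (Fin 4) → ℂ} {z : Coord ty}
    (hf : DifferentiableAt ℝ f z.1) :
    der (vec c) (fun w => f w.1) z =
      ∑ k, c (.inl k) * fderiv ℝ f z.1 (EuclideanSpace.single k 1) := by
  have h : fderiv ℝ (fun w : Coord ty => f w.1) z =
      (fderiv ℝ f z.1).comp (ContinuousLinearMap.fst ℝ _ _) :=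
    (hf.hasFDerivAt.comp z hasFDerivAt_fst).fderiv
  rw [der, h, vec_comp_fst]

namespace SpinorConnection

variable (C : SpinorConnection 𝓢 ty)

/-- The matrices by which the connection acts on all kinds of indices. -/
def conn (e : EquippedChart 𝓢) (j : Fin 4) (z : Coord ty) : KindMat :=
  kindMatrix (C.A e z j) (C.A' e z j) (C.Γ e z j)

theorem contDiffOn_conn (e : EquippedChart 𝓢) (j : Fin 4) (k : Kind) (a b : Fin k.dim) :
    ContDiffOn ℝ ∞ (fun z => C.conn e j z k a b) (e.dom ty) := by
  cases k
  · exact C.A_smooth e j a b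
  · exact (C.A_smooth e j b a).neg
  · exact C.A'_smooth e j a b
  · exact (C.A'_smooth e j b a).neg
  · exact C.Γ_smooth e j a b
  · exact (C.Γ_smooth e j b a).neg

/-- The components of the horizontal vector fields. -/
def hcoef (e : EquippedChart 𝓢) (j : Fin 4) (z : Coord ty) : Dir ty → ℂ
  | .inl k => e.upsilon j k z.1
  | .inr (.inl b) => -lAct (C.conn e j z) (z.2 b.1) b.2
  | .inr (.inr b) => -lAct (C.conn e j z) (tauComp (z.2 b.1)) b.2

/-- The horizontal lift `H_j` of the frame vector `Υ_j`, at the point with the coordinates `z`. -/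
def H (e : EquippedChart 𝓢) (j : Fin 4) (z : Coord ty) : (Coord ty →L[ℝ] ℂ) →ₗ[ℂ] ℂ :=
  vec (C.hcoef e j z)

theorem contDiffOn_hcoef (e : EquippedChart 𝓢) (j : Fin 4) (α : Dir ty) :
    ContDiffOn ℝ ∞ (fun z => C.hcoef e j z α) (e.dom ty) := by
  rcases α with k | ⟨P, b⟩ | ⟨P, b⟩
  · exact (e.contDiffOn_upsilon j k).comp contDiff_fst.contDiffOn fun z hz => hz
  · exact (contDiffOn_lAct (C.contDiffOn_conn e j) (fun b => contDiffOn_coord_snd P b _) b).neg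
  · exact (contDiffOn_lAct (C.contDiffOn_conn e j) (fun b => contDiffOn_tauComp_snd P b _) b).neg

/-- The derivative along `H_j` is the operator `H_j` of the definition of spatial covariant
differentiation. -/
theorem der_H (e : EquippedChart 𝓢) (j : Fin 4) (f : Coord ty → ℂ) (z : Coord ty) :
    der (C.H e j z) f z = e.frameD j f z - C.fiberD e j f z - C.fiberDbar e j f z := by
  rw [H, der_vec, Fintype.sum_sum_type, Fintype.sum_sum_type, Fintype.sum_sigma, Fintype.sum_sigma]
  have h1 : ∀ P b, C.hcoef e j z (.inr (.inl ⟨P, b⟩)) = -lAct (C.conn e j z) (z.2 P) b :=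
    fun _ _ => rfl
  have h2 : ∀ P b, C.hcoef e j z (.inr (.inr ⟨P, b⟩)) =
    -lAct (C.conn e j z) (tauComp (z.2 P)) b := fun _ _ => rfl
  simp only [h1, h2, neg_mul, Finset.sum_neg_distrib, der_dirL_inl, der_dirL_inr_inl,
    der_dirL_inr_inr]
  rw [sub_sub, sub_eq_add_neg (e.frameD j f z), neg_add]
  rfl

/-- The covariant derivative is the derivative along `H_j` plus the action of the connection. -/
theorem nablaComp_eq (e : EquippedChart 𝓢) (j : Fin 4) (Z : Coord ty → Idx t → ℂ) (z : Coord ty) :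
    C.nablaComp e j Z z = derComp (C.H e j z) Z z + lAct (C.conn e j z) (Z z) := by
  funext a
  rw [Pi.add_apply, derComp, der_H]
  rfl

theorem contDiffOn_der_H {e : EquippedChart 𝓢} {f : Coord ty → ℂ} {s : Set (Coord ty)}
    (hs : IsOpen s) (hse : s ⊆ e.dom ty) (hf : ContDiffOn ℝ ∞ f s) (j : Fin 4) :
    ContDiffOn ℝ ∞ (fun z => der (C.H e j z) f z) s := by
  simp only [H, der_vec]
  exact contDiffOn_sum_const_mul (fun α => (C.contDiffOn_hcoef e j α).mono hse)
    fun α => contDiffOn_der_dirL hs hf α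

theorem contDiffOn_nablaComp {e : EquippedChart 𝓢} {Z : Coord ty → Idx t → ℂ}
    (hZ : ∀ a, ContDiffOn ℝ ∞ (fun z => Z z a) (e.dom ty)) (j : Fin 4) (a : Idx t) :
    ContDiffOn ℝ ∞ (fun z => C.nablaComp e j Z z a) (e.dom ty) := by
  simp only [nablaComp_eq, Pi.add_apply]
  exact (C.contDiffOn_der_H e.isOpen_dom subset_rfl (hZ a) j).add
    (contDiffOn_lAct (C.contDiffOn_conn e j) hZ a)

/-- On functions of `x` the horizontal vector fields act as the frame vectors. -/
theorem der_H_fst (e : EquippedChart 𝓢) (j : Fin 4) {f : EuclideanSpace ℝ (Fin 4) → ℂ}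
    {z : Coord ty} (hf : DifferentiableAt ℝ f z.1) :
    der (C.H e j z) (fun w => f w.1) z = fderiv ℝ f z.1 (e.frameVec j z.1) := by
  rw [H, der_vec_fst _ hf]
  have h2 : e.frameVec j z.1 = ∑ k, e.upsilon j k z.1 • EuclideanSpace.single k (1 : ℝ) := by
    ext i
    simp [EquippedChart.upsilon_eq, Pi.single_apply]
  conv_rhs => rw [h2]
  rw [map_sum]
  refine Finset.sum_congr rfl fun k _ => ?_
  rw [map_smul, Complex.real_smul]
  rfl

theorem der_H_lieD (e : EquippedChart 𝓢) (j : Fin 4) {f : M → ℂ} {z : Coord ty}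
    (hz : z ∈ e.dom ty) (hf : DifferentiableAt ℝ (fun x => f (e.chart.symm x)) z.1) :
    der (C.H e j z) (fun w => f (e.chart.symm w.1)) z = e.lieD j f (e.chart.symm z.1) := by
  rw [H, der_vec_fst (f := fun x => f (e.chart.symm x)) _ hf, EquippedChart.lieD,
    e.chart.right_inv hz]
  rfl

/-- The curvature of a matrix valued part of the connection. -/
def curvMat {n : ℕ} (B : Coord ty → Fin 4 → Matrix (Fin n) (Fin n) ℂ) (e : EquippedChart 𝓢)
    (z : Coord ty) (i j : Fin 4) : Matrix (Fin n) (Fin n) ℂ :=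
  derMat (C.H e i z) (fun w => B w j) z - derMat (C.H e j z) (fun w => B w i) z
    + (B z i * B z j - B z j * B z i)
    - ∑ k, (e.structC k i j (e.chart.symm z.1) : ℂ) • B z k

theorem curvComp_eq {n : ℕ} (B : Coord ty → Fin 4 → Matrix (Fin n) (Fin n) ℂ)
    (e : EquippedChart 𝓢) (z : Coord ty) (p q : Fin n) (i j : Fin 4) :
    C.curvComp B e z p q i j = C.curvMat B e z i j p q := by
  simp only [curvMat, curvComp, Matrix.sub_apply, Matrix.add_apply, Matrix.mul_apply, derMat, der_H,
    Matrix.sum_apply, Matrix.smul_apply, smul_eq_mul, Finset.sum_sub_distrib]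
  ring

/-- The curvature acting on all kinds of indices. -/
def curvKind (e : EquippedChart 𝓢) (z : Coord ty) (i j : Fin 4) : KindMat :=
  kindMatrix (C.curvMat (C.A e) e z i j) (C.curvMat (C.A' e) e z i j) (C.curvMat (C.Γ e) e z i j)

theorem curvMat_neg_transpose {n : ℕ} (B : Coord ty → Fin 4 → Matrix (Fin n) (Fin n) ℂ)
    (e : EquippedChart 𝓢) (z : Coord ty) (i j : Fin 4) :
    C.curvMat (fun w j => -(B w j).transpose) e z i j = -(C.curvMat B e z i j).transpose := by
  have h : ∀ (Λ : (Coord ty →L[ℝ] ℂ) →ₗ[ℂ] ℂ) j,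
      derMat Λ (fun w => -(B w j).transpose) z = -(derMat Λ (fun w => B w j) z).transpose := by
    intro Λ j
    ext a b
    exact der_neg
  simp only [curvMat, h, Matrix.transpose_sub, Matrix.transpose_add, Matrix.transpose_mul,
    Matrix.transpose_sum, Matrix.transpose_smul, smul_neg, Finset.sum_neg_distrib]
  noncomm_ring

/-- For every kind of indices the matrices of curvature are the curvature of the matrices of the
connection: the negative transpose commutes with taking the curvature. -/
theorem curvKind_apply (e : EquippedChart 𝓢) (z : Coord ty) (i j : Fin 4) (k : Kind) :
    C.curvKind e z i j k = C.curvMat (fun w j => C.conn e j w k) e z i j := by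
  cases k
  · rfl
  · exact (C.curvMat_neg_transpose (C.A e) e z i j).symm
  · rfl
  · exact (C.curvMat_neg_transpose (C.A' e) e z i j).symm
  · rfl
  · exact (C.curvMat_neg_transpose (C.Γ e) e z i j).symm

/-- The defining formula of the curvature for all kinds of indices, solved for the terms which
appear in commutators. -/
theorem curvKind_eq (e : EquippedChart 𝓢) (z : Coord ty) (i j : Fin 4) :
    derKind (C.H e i z) (C.conn e j) z - derKind (C.H e j z) (C.conn e i) z
      + (C.conn e i z * C.conn e j z - C.conn e j z * C.conn e i z) =
    C.curvKind e z i j + ∑ k, (e.structC k i j (e.chart.symm z.1) : ℂ) • C.conn e k z := by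
  funext κ
  show _ = C.curvKind e z i j κ +
    (∑ k, (e.structC k i j (e.chart.symm z.1) : ℂ) • C.conn e k z) κ
  rw [curvKind_apply, Finset.sum_apply, curvMat]
  exact (sub_add_cancel _ _).symm

/-- The components of the vertical vector field given by minus the action of the curvature. -/
def vcoef (e : EquippedChart 𝓢) (i j : Fin 4) (z : Coord ty) : Dir ty → ℂ
  | .inl _ => 0
  | .inr (.inl b) => -lAct (C.curvKind e z i j) (z.2 b.1) b.2
  | .inr (.inr b) => -lAct (C.curvKind e z i j) (tauComp (z.2 b.1)) b.2

/-- The coordinates `S[P]` are parallel along the horizontal vectors: `H_j S[P] = -D_j S[P]`. -/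
theorem derComp_H_snd (e : EquippedChart 𝓢) (j : Fin 4) (z : Coord ty) (P : Fin J) :
    derComp (C.H e j z) (fun w : Coord ty => w.2 P) z = -lAct (C.conn e j z) (z.2 P) := by
  funext b
  show der (C.H e j z) (fun w => coordL ty (.inr (.inl ⟨P, b⟩)) w) z = _
  rw [der_coordL, H, vec_coordL]
  rfl

/-- The coordinates `τS[P]` are parallel along the horizontal vectors. -/
theorem derComp_H_tauComp_snd (e : EquippedChart 𝓢) (j : Fin 4) (z : Coord ty) (P : Fin J) :
    derComp (C.H e j z) (fun w : Coord ty => tauComp (w.2 P)) z =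
      -lAct (C.conn e j z) (tauComp (z.2 P)) := by
  funext b
  show der (C.H e j z) (fun w => coordL ty (.inr (.inr ⟨P, b⟩)) w) z = _
  rw [der_coordL, H, vec_coordL]
  rfl

theorem matDiff_conn (e : EquippedChart 𝓢) (j : Fin 4) {z : Coord ty} (hz : z ∈ e.dom ty)
    (k : Kind) : MatDiff (fun w => C.conn e j w k) z :=
  fun a b => (C.contDiffOn_conn e j k a b).diffAt e.isOpen_dom hz

/-- The commutator of covariant derivatives of components which are parallel along the horizontal
vector fields. -/
theorem derComp_lAct_conn_commutator (e : EquippedChart 𝓢) (i j : Fin 4) {z : Coord ty}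
    (hz : z ∈ e.dom ty) {X : Coord ty → Idx t → ℂ}
    (hX : ∀ a, DifferentiableAt ℝ (fun w => X w a) z)
    (hp : ∀ j, derComp (C.H e j z) X z = -lAct (C.conn e j z) (X z)) :
    derComp (C.H e i z) (fun w => -lAct (C.conn e j w) (X w)) z -
      derComp (C.H e j z) (fun w => -lAct (C.conn e i w) (X w)) z =
    -lAct (C.curvKind e z i j) (X z) -
      ∑ k, (e.structC k i j (e.chart.symm z.1) : ℂ) • lAct (C.conn e k z) (X z) := by
  have h1 : ∀ (Λ : (Coord ty →L[ℝ] ℂ) →ₗ[ℂ] ℂ) j,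
      derComp Λ (fun w => -lAct (C.conn e j w) (X w)) z =
        -derComp Λ (fun w => lAct (C.conn e j w) (X w)) z := by
    intro Λ j
    funext a
    exact der_neg
  have hneg : ∀ (g : KindMat) (Y : Idx t → ℂ), lAct g (-Y) = -lAct g Y := by
    intro g Y
    funext a
    simp [lAct]
  rw [h1, h1, derComp_lAct (C.matDiff_conn e j hz) hX, derComp_lAct (C.matDiff_conn e i hz) hX,
    hp, hp, hneg, hneg]
  -- parallel components turn the derivatives of `X` into the action of the commutator of matrices
  have key : ∀ a b g h r s : KindMat, a - b + (g * h - h * g) = r + s → ∀ Y : Idx t → ℂ,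
      -(lAct a Y + -lAct h (lAct g Y)) - -(lAct b Y + -lAct g (lAct h Y)) =
        -lAct r Y - lAct s Y := by
    intro a b g h r s hs Y
    have h2 := congrArg (fun g => lAct g Y) hs
    rw [lAct_add_left, lAct_sub_left, lAct_commutator, lAct_add_left] at h2
    linear_combination -h2
  rw [key _ _ _ _ _ _ (C.curvKind_eq e z i j), lAct_sum_left]
  simp only [lAct_smul_left]

/-- The commutator of the horizontal vector fields: `[H_i, H_j] = ∑ c^k_ij H_k + V_ij`, with the
vertical field `V_ij` given by minus the action of the curvature on the native fields. -/
theorem der_H_commutator (e : EquippedChart 𝓢) (i j : Fin 4) {f : Coord ty → ℂ} {z : Coord ty}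
    (hz : z ∈ e.dom ty) (hf : ContDiffAt ℝ ∞ f z) :
    der (C.H e i z) (fun w => der (C.H e j w) f w) z -
      der (C.H e j z) (fun w => der (C.H e i w) f w) z =
    ∑ k, (e.structC k i j (e.chart.symm z.1) : ℂ) * der (C.H e k z) f z +
      der (vec (C.vcoef e i j z)) f z := by
  have hd : ∀ j α, DifferentiableAt ℝ (fun w => C.hcoef e j w α) z :=
    fun j α => (C.contDiffOn_hcoef e j α).diffAt e.isOpen_dom hz
  have hcomm := der_vec_commutator (c := C.hcoef e i) (c' := C.hcoef e j) (hd i) (hd j) hf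
  refine hcomm.trans ?_
  simp only [H, der_vec (C.hcoef e _ z) f, der_vec (C.vcoef e i j z) f, Finset.mul_sum]
  rw [Finset.sum_comm, ← Finset.sum_add_distrib]
  refine Finset.sum_congr rfl fun α _ => ?_
  simp only [← mul_assoc, ← Finset.sum_mul]
  rw [← add_mul]
  congr 1
  -- the components along `x^l` are those of the commutator of frame vectors, the vertical ones come
  -- from the coordinates `S[P]` and `τS[P]`, which are parallel
  rcases α with l | ⟨P, b⟩ | ⟨P, b⟩
  · have hu : ∀ j, DifferentiableAt ℝ (fun x => (e.upsilon j l x : ℂ)) z.1 := fun j =>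
      (e.contDiffOn_upsilon j l).diffAt e.chart.open_target hz
    have hv : ∀ j, DifferentiableAt ℝ (e.frameVec j) z.1 := fun j =>
      (e.contDiffOn_frameVec j).diffAt e.chart.open_target hz
    have hfd : ∀ j v, fderiv ℝ (fun x => (e.upsilon j l x : ℂ)) z.1 v =
        (fderiv ℝ (e.frameVec j) z.1 v l : ℂ) := by
      intro j v
      have := ((Complex.ofRealCLM.comp (EuclideanSpace.proj (𝕜 := ℝ) l)).hasFDerivAt.comp z.1
        (hv j).hasFDerivAt).fderiv
      exact congrArg (fun L => L v) this
    have e1 := C.der_H_fst e i (hu j)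
    have e2 := C.der_H_fst e j (hu i)
    have e3 := congrArg (fun v : EuclideanSpace ℝ (Fin 4) => (v l : ℂ))
      (e.frameVec_commutator i j hz)
    show der (C.H e i z) (fun w => (e.upsilon j l w.1 : ℂ)) z -
      der (C.H e j z) (fun w => (e.upsilon i l w.1 : ℂ)) z =
      ∑ k, (e.structC k i j (e.chart.symm z.1) : ℂ) * (e.upsilon k l z.1 : ℂ) + 0
    rw [e1, e2, hfd, hfd, add_zero]
    simpa [EquippedChart.upsilon_eq] using e3
  · have h := congrFun (C.derComp_lAct_conn_commutator e i j hz (X := fun w => w.2 P)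
      (fun a => (contDiffOn_coord_snd P a (e.dom ty)).diffAt e.isOpen_dom hz)
      fun j => C.derComp_H_snd e j z P) b
    refine Eq.trans h ?_
    simp only [Pi.sub_apply, Pi.neg_apply, Finset.sum_apply, Pi.smul_apply, smul_eq_mul, vcoef,
      hcoef, mul_neg, Finset.sum_neg_distrib]
    ring
  · have h := congrFun (C.derComp_lAct_conn_commutator e i j hz (X := fun w => tauComp (w.2 P))
      (fun a => (contDiffOn_tauComp_snd P a (e.dom ty)).diffAt e.isOpen_dom hz)
      fun j => C.derComp_H_tauComp_snd e j z P) b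
    refine Eq.trans h ?_
    simp only [Pi.sub_apply, Pi.neg_apply, Finset.sum_apply, Pi.smul_apply, smul_eq_mul, vcoef,
      hcoef, mul_neg, Finset.sum_neg_distrib]
    ring

/-- On functions of `x` the vertical part of the commutator vanishes. -/
theorem der_H_commutator_fst (e : EquippedChart 𝓢) (i j : Fin 4)
    {f : EuclideanSpace ℝ (Fin 4) → ℂ} {z : Coord ty} (hz : z ∈ e.dom ty)
    (hf : ContDiffAt ℝ ∞ f z.1) :
    der (C.H e i z) (fun w => der (C.H e j w) (fun v => f v.1) w) z -
      der (C.H e j z) (fun w => der (C.H e i w) (fun v => f v.1) w) z =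
    ∑ k, (e.structC k i j (e.chart.symm z.1) : ℂ) * der (C.H e k z) (fun v => f v.1) z := by
  rw [C.der_H_commutator e i j hz (f := fun v => f v.1) (hf.comp z contDiffAt_fst),
    der_vec_fst _ (hf.differentiableAt (by simp))]
  simp [vcoef]

end SpinorConnection

end Horizontal

/-! ### Changes of local coordinates -/

section Overlaps

theorem contDiffOn_tAct {E : Type*} [NormedAddCommGroup E] [NormedSpace ℝ E] {s : Set E}
    {G : E → KindMat} {X : E → Idx t → ℂ} (hG : ∀ k i j, ContDiffOn ℝ ∞ (fun w => G w k i j) s)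
    (hX : ∀ a, ContDiffOn ℝ ∞ (fun w => X w a) s) (a : Idx t) :
    ContDiffOn ℝ ∞ (fun w => tAct (G w) (X w) a) s := by
  simp only [tAct]
  exact ContDiffOn.sum fun b _ => (contDiffOn_prod fun k _ => contDiffOn_prod fun μ _ =>
    hG _ _ _).mul (hX b)

namespace EquippedChart

/-- The change of local coordinates of the composite bundle. -/
def transMap (e e' : EquippedChart 𝓢) (z : Coord ty) : Coord ty :=
  (e'.chart (e.chart.symm z.1), fun P => tAct (e'.trans e (e.chart.symm z.1)) (z.2 P))

variable (ty) in
/-- The set of the local coordinates of points in the domains of two equipped charts. -/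
def overlapDom (e e' : EquippedChart 𝓢) : Set (Coord ty) := {z | z.1 ∈ e.overlap e'}

theorem isOpen_overlapDom (e e' : EquippedChart 𝓢) : IsOpen (e.overlapDom ty e') :=
  (e.isOpen_overlap e').preimage continuous_fst

theorem overlapDom_subset (e e' : EquippedChart 𝓢) : e.overlapDom ty e' ⊆ e.dom ty :=
  fun _ hz => hz.1

theorem coord_point_eq_transMap (e e' : EquippedChart 𝓢) (z : Coord ty) :
    e'.coord (e.point z) = e.transMap e' z := by
  refine Prod.ext rfl ?_
  funext P
  show (e'.basis (ty P) (e.chart.symm z.1)).equivFun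
    ((e.basis (ty P) (e.chart.symm z.1)).equivFun.symm (z.2 P)) = _
  rw [e'.equivFun_eq_tAct e, LinearEquiv.apply_symm_apply]
  rfl

theorem symm_transMap (e e' : EquippedChart 𝓢) {z : Coord ty} (hz : z ∈ e.overlapDom ty e') :
    e'.chart.symm (e.transMap e' z).1 = e.chart.symm z.1 :=
  e'.chart.left_inv hz.2

theorem transMap_mem (e e' : EquippedChart 𝓢) {z : Coord ty} (hz : z ∈ e.overlapDom ty e') :
    e.transMap e' z ∈ e'.overlapDom ty e := by
  refine ⟨e'.chart.map_source hz.2, ?_⟩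
  show e'.chart.symm (e.transMap e' z).1 ∈ e.chart.source
  rw [e.symm_transMap e' hz]
  exact e.chart.map_target hz.1

theorem coord_mem_overlapDom (e e' : EquippedChart 𝓢) {q : Composite S ty}
    (h : q.1 ∈ e.chart.source) (h' : q.1 ∈ e'.chart.source) : e.coord q ∈ e.overlapDom ty e' := by
  refine ⟨e.chart.map_source h, ?_⟩
  show e.chart.symm (e.chart q.1) ∈ e'.chart.source
  rwa [e.chart.left_inv h]

theorem contDiffOn_transMap (e e' : EquippedChart 𝓢) :
    ContDiffOn ℝ ∞ (e.transMap e' (ty := ty)) (e.overlapDom ty e') := by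
  have h1 : ContDiffOn ℝ ∞ (fun x => e'.chart (e.chart.symm x)) (e.overlap e') :=
    e.contDiffOn_comp_symm (contMDiffOn_of_mem_maximalAtlas e'.chart_mem)
  refine ContDiffOn.prodMk (h1.comp contDiff_fst.contDiffOn fun z hz => hz) ?_
  refine contDiffOn_pi.2 fun P => contDiffOn_pi.2 fun a => ?_
  exact contDiffOn_tAct (fun k i j => (e.contDiffOn_trans' e' k i j).comp contDiff_fst.contDiffOn
    fun z hz => hz) (fun b => contDiffOn_coord_snd P b _) a

theorem differentiableAt_transMap (e e' : EquippedChart 𝓢) {z : Coord ty}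
    (hz : z ∈ e.overlapDom ty e') : DifferentiableAt ℝ (e.transMap e') z :=
  (e.contDiffOn_transMap e').diffAt (e.isOpen_overlapDom e') hz

theorem matDiff_trans (e e' : EquippedChart 𝓢) {z : Coord ty} (hz : z ∈ e.overlapDom ty e')
    (k : Kind) : MatDiff (fun w : Coord ty => e.trans e' (e.chart.symm w.1) k) z := fun i j =>
  ((e.contDiffOn_trans e' k i j).diffAt (e.isOpen_overlap e') hz).comp z differentiableAt_fst

theorem matDiff_trans' (e e' : EquippedChart 𝓢) {z : Coord ty} (hz : z ∈ e.overlapDom ty e')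
    (k : Kind) : MatDiff (fun w : Coord ty => e'.trans e (e.chart.symm w.1) k) z := fun i j =>
  ((e.contDiffOn_trans' e' k i j).diffAt (e.isOpen_overlap e') hz).comp z differentiableAt_fst

end EquippedChart

theorem IsTensorial.eq_tAct {F : EquippedChart 𝓢 → Coord ty → Idx t → ℂ} (hF : IsTensorial F)
    (e e' : EquippedChart 𝓢) {z : Coord ty} (hz : z ∈ e.overlapDom ty e') :
    F e z = tAct (e.trans e' (e.chart.symm z.1)) (F e' (e.transMap e' z)) := by
  have h := hF e e' (e.point z) (e.point_mem hz.1) hz.2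
  rwa [e.coord_point hz.1, e.coord_point_eq_transMap] at h

/-- The transformation law of components in terms of local coordinates instead of points. -/
theorem isTensorial_of_transMap {F : EquippedChart 𝓢 → Coord ty → Idx t → ℂ}
    (h : ∀ (e e' : EquippedChart 𝓢) (z : Coord ty), z ∈ e.overlapDom ty e' →
      F e z = tAct (e.trans e' (e.chart.symm z.1)) (F e' (e.transMap e' z))) : IsTensorial F := by
  intro e e' q hq hq'
  have h1 := h e e' (e.coord q) (e.coord_mem_overlapDom e' hq hq')
  rwa [← e.coord_point_eq_transMap, e.point_coord q hq,
    show e.chart.symm (e.coord q).1 = q.1 from e.chart.left_inv hq] at h1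

theorem rep_eq_tAct (X : ExtField S ty t) (e e' : EquippedChart 𝓢) {z : Coord ty}
    (hz : z ∈ e.overlapDom ty e') :
    X.rep e z = tAct (e.trans e' (e.chart.symm z.1)) (X.rep e' (e.transMap e' z)) :=
  (isTensorial_rep X).eq_tAct e e' hz

theorem tAct_rep (X : ExtField S ty t) (e e' : EquippedChart 𝓢) {z : Coord ty}
    (hz : z ∈ e.overlapDom ty e') :
    tAct (e'.trans e (e.chart.symm z.1)) (X.rep e z) = X.rep e' (e.transMap e' z) := by
  rw [rep_eq_tAct X e e' hz, e'.tAct_trans_trans]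

/-- The derivatives of the components of a field in two equipped charts. The first term, with the
derivatives of the transition matrices, is the one which a connection has to compensate. -/
theorem derComp_rep {X : ExtField S ty t} (hX : X.Smooth 𝓢) (e e' : EquippedChart 𝓢) {z : Coord ty}
    (hz : z ∈ e.overlapDom ty e') (Λ : (Coord ty →L[ℝ] ℂ) →ₗ[ℂ] ℂ) :
    derComp Λ (X.rep e) z =
      lAct (derKind Λ (fun w => e.trans e' (e.chart.symm w.1)) z * e'.trans e (e.chart.symm z.1))
        (X.rep e z) +
      tAct (e.trans e' (e.chart.symm z.1))
        (derComp (push (fderiv ℝ (e.transMap e') z) Λ) (X.rep e') (e.transMap e' z)) := by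
  have hev : X.rep e =ᶠ[nhds z] fun w =>
      tAct (e.trans e' (e.chart.symm w.1)) (X.rep e' (e.transMap e' w)) :=
    Filter.mem_of_superset ((e.isOpen_overlapDom e').mem_nhds hz) fun w hw => rep_eq_tAct X e e' hw
  have hd : ∀ a, DifferentiableAt ℝ (fun w => X.rep e' w a) (e.transMap e' z) := fun a =>
    differentiableAt_pi.1 ((hX e').diffAt e'.isOpen_dom (e.transMap_mem e' hz).1) a
  have hφ := e.differentiableAt_transMap e' hz
  rw [derComp_congr hev, derComp_tAct (G := fun w : Coord ty => e.trans e' (e.chart.symm w.1))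
    (X := fun w => X.rep e' (e.transMap e' w)) (e'.trans_mul e (e.chart.symm z.1))
    (e.matDiff_trans e' hz) fun a => (hd a).comp z hφ,
    ← rep_eq_tAct X e e' hz]
  congr 2
  funext a
  exact der_comp hφ (hd a)

theorem tau_isTensorial (X : ExtField S ty t) : IsTensorial (𝓢 := 𝓢) (tauLocal X) :=
  isTensorial_of_transMap fun e e' z hz => by
    rw [tauLocal, tauLocal, rep_eq_tAct X e e' hz, EquippedChart.tauComp_tAct_trans]

/-! ### Native multivariate derivatives in different charts -/

/-- The components of the vertical complex tangent vector with the components `η P` along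
`S[P]` and `ζ P` along `τ S[P]`. -/
def vertical (η : ∀ P : Fin J, Idx (ty P) → ℂ) (ζ : ∀ P : Fin J, Idx (conjType (ty P)) → ℂ) :
    Dir ty → ℂ
  | .inl _ => 0
  | .inr (.inl b) => η b.1 b.2
  | .inr (.inr b) => ζ b.1 b.2

theorem der_vertical (η : ∀ P : Fin J, Idx (ty P) → ℂ)
    (ζ : ∀ P : Fin J, Idx (conjType (ty P)) → ℂ) (f : Coord ty → ℂ) (z : Coord ty) :
    der (vec (vertical η ζ)) f z = ∑ P, ∑ b, η P b * dS P b f z +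
      ∑ P, ∑ b, ζ P b * dSbar P (swapIdx b) f z := by
  rw [der_vec, Fintype.sum_sum_type, Fintype.sum_sum_type, Fintype.sum_sigma, Fintype.sum_sigma]
  simp only [vertical, zero_mul, Finset.sum_const_zero, zero_add]
  rfl

theorem vertLocal_eq (P : Fin J) (Y : ExtField S ty (ty P)) (Z : ExtField S ty t)
    (e : EquippedChart 𝓢) (z : Coord ty) :
    vertLocal P Y Z e z = derComp (vec (vertical (Pi.single P (Y.rep e z)) 0)) (Z.rep e) z := by
  funext a
  rw [derComp, der_vertical, Finset.sum_eq_single P]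
  · simp [vertLocal]
  · intro P' _ hP
    simp [Pi.single_eq_of_ne hP]
  · simp

theorem vertBarLocal_eq (P : Fin J) (Y : ExtField S ty (conjType (ty P))) (Z : ExtField S ty t)
    (e : EquippedChart 𝓢) (z : Coord ty) :
    vertBarLocal P Y Z e z = derComp (vec (vertical 0
      (Pi.single (M := fun P => Idx (conjType (ty P)) → ℂ) P (Y.rep e z)))) (Z.rep e) z := by
  funext a
  rw [derComp, der_vertical]
  have h : ∑ P' : Fin J, ∑ b, (Pi.single (M := fun P => Idx (conjType (ty P)) → ℂ) P
      (Y.rep e z)) P' b * dSbar P' (swapIdx b) (fun w => Z.rep e w a) z =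
      ∑ b, (Y.rep e z) b * dSbar P (swapIdx b) (fun w => Z.rep e w a) z := by
    rw [Finset.sum_eq_single P]
    · simp
    · intro P' _ hP
      simp [Pi.single_eq_of_ne hP]
    · simp
  rw [h]
  simp [vertBarLocal]

theorem der_vertical_fst (η : ∀ P : Fin J, Idx (ty P) → ℂ)
    (ζ : ∀ P : Fin J, Idx (conjType (ty P)) → ℂ) {f : EuclideanSpace ℝ (Fin 4) → ℂ} {z : Coord ty}
    (hf : DifferentiableAt ℝ f z.1) : der (vec (vertical η ζ)) (fun w => f w.1) z = 0 := by
  rw [der_vec_fst _ hf]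
  simp [vertical]

/-- The derivative of components recomputed in the frame of another chart. -/
theorem derComp_tAct_trans {X : Coord ty → Idx t → ℂ} (e e' : EquippedChart 𝓢) {z : Coord ty}
    (hz : z ∈ e.overlapDom ty e') (Λ : (Coord ty →L[ℝ] ℂ) →ₗ[ℂ] ℂ)
    (hX : ∀ a, DifferentiableAt ℝ (fun w => X w a) z) :
    derComp Λ (fun w => tAct (e'.trans e (e.chart.symm w.1)) (X w)) z =
      lAct (derKind Λ (fun w => e'.trans e (e.chart.symm w.1)) z * e.trans e' (e.chart.symm z.1))
        (tAct (e'.trans e (e.chart.symm z.1)) (X z)) +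
      tAct (e'.trans e (e.chart.symm z.1)) (derComp Λ X z) :=
  derComp_tAct (G := fun w : Coord ty => e'.trans e (e.chart.symm w.1))
    (e.trans_mul e' (e.chart.symm z.1)) (e.matDiff_trans' e' hz) hX

/-- The components of the image of a tangent vector under a change of coordinates are the
derivatives of the new coordinates. -/
theorem push_transMap_apply (e e' : EquippedChart 𝓢) {z : Coord ty} (hz : z ∈ e.overlapDom ty e')
    (Λ : (Coord ty →L[ℝ] ℂ) →ₗ[ℂ] ℂ) (α : Dir ty) :
    push (fderiv ℝ (e.transMap e') z) Λ (coordL ty α) =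
      der Λ (fun w => coordL ty α (e.transMap e' w)) z := by
  rw [← der_coordL _ α (e.transMap e' z)]
  exact (der_comp (e.differentiableAt_transMap e' hz)
    (coordL ty α).differentiableAt).symm

/-- Transition matrices depend on `x` only. -/
theorem derKind_vertical_trans (η : ∀ P : Fin J, Idx (ty P) → ℂ)
    (ζ : ∀ P : Fin J, Idx (conjType (ty P)) → ℂ) (e e' : EquippedChart 𝓢) {z : Coord ty}
    (hz : z ∈ e.overlapDom ty e') :
    derKind (vec (vertical η ζ)) (fun w => e.trans e' (e.chart.symm w.1)) z = 0 := by
  funext k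
  ext i j
  exact der_vertical_fst η ζ ((e.contDiffOn_trans e' k i j).diffAt (e.isOpen_overlap e') hz)

theorem derKind_vertical_trans' (η : ∀ P : Fin J, Idx (ty P) → ℂ)
    (ζ : ∀ P : Fin J, Idx (conjType (ty P)) → ℂ) (e e' : EquippedChart 𝓢) {z : Coord ty}
    (hz : z ∈ e.overlapDom ty e') :
    derKind (vec (vertical η ζ)) (fun w => e'.trans e (e.chart.symm w.1)) z = 0 := by
  funext k
  ext i j
  exact der_vertical_fst η ζ ((e.contDiffOn_trans' e' k i j).diffAt (e.isOpen_overlap e') hz)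

/-- Vertical vectors transform as spin-tensors. -/
theorem push_vertical (η : ∀ P : Fin J, Idx (ty P) → ℂ)
    (ζ : ∀ P : Fin J, Idx (conjType (ty P)) → ℂ) (e e' : EquippedChart 𝓢) {z : Coord ty}
    (hz : z ∈ e.overlapDom ty e') :
    push (fderiv ℝ (e.transMap e') z) (vec (vertical η ζ)) =
      vec (vertical (fun P => tAct (e'.trans e (e.chart.symm z.1)) (η P))
        fun P => tAct (e'.trans e (e.chart.symm z.1)) (ζ P)) := by
  refine vec_ext fun α => ?_
  rw [push_transMap_apply e e' hz, vec_coordL]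
  rcases α with k | ⟨P, b⟩ | ⟨P, b⟩
  · have h1 : ContDiffOn ℝ ∞ (fun x => ((e'.chart (e.chart.symm x)) k : ℂ)) (e.overlap e') :=
      Complex.ofRealCLM.contDiff.comp_contDiffOn
        ((EuclideanSpace.proj (𝕜 := ℝ) k).contDiff.comp_contDiffOn
          (e.contDiffOn_comp_symm (contMDiffOn_of_mem_maximalAtlas e'.chart_mem)))
    exact der_vertical_fst η ζ (h1.diffAt (e.isOpen_overlap e') hz)
  · have h := congrFun (derComp_tAct_trans (X := fun w => w.2 P) e e' hz (vec (vertical η ζ))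
      fun a => (contDiffOn_coord_snd P a (e.dom ty)).diffAt e.isOpen_dom hz.1) b
    refine h.trans ?_
    rw [derKind_vertical_trans' η ζ e e' hz, zero_mul, lAct_zero_left, zero_add]
    have h2 : derComp (vec (vertical η ζ)) (fun w : Coord ty => w.2 P) z = η P := by
      funext b
      exact (der_coordL (vec (vertical η ζ)) (.inr (.inl ⟨P, b⟩)) z).trans (vec_coordL _ _)
    rw [h2]
    rfl
  · have h := congrFun (derComp_tAct_trans (X := fun w => tauComp (w.2 P)) e e' hz
      (vec (vertical η ζ))
      fun a => (contDiffOn_tauComp_snd P a (e.dom ty)).diffAt e.isOpen_dom hz.1) b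
    have h3 : (fun w : Coord ty => coordL ty (.inr (.inr ⟨P, b⟩)) (e.transMap e' w)) =
        fun w => tAct (e'.trans e (e.chart.symm w.1)) (tauComp (w.2 P)) b := by
      funext w
      rw [← e'.tauComp_tAct_trans e]
      rfl
    rw [h3]
    refine h.trans ?_
    rw [derKind_vertical_trans' η ζ e e' hz, zero_mul, lAct_zero_left, zero_add]
    have h2 : derComp (vec (vertical η ζ)) (fun w : Coord ty => tauComp (w.2 P)) z = ζ P := by
      funext b
      exact (der_coordL (vec (vertical η ζ)) (.inr (.inr ⟨P, b⟩)) z).trans (vec_coordL _ _)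
    rw [h2]
    rfl

/-- Vertical derivatives of components are the components of a spin-tensor: no derivatives of
transition matrices arise. -/
theorem derComp_vertical_rep {X : ExtField S ty t} (hX : X.Smooth 𝓢) (e e' : EquippedChart 𝓢)
    {z : Coord ty} (hz : z ∈ e.overlapDom ty e') (η : ∀ P : Fin J, Idx (ty P) → ℂ)
    (ζ : ∀ P : Fin J, Idx (conjType (ty P)) → ℂ) :
    derComp (vec (vertical η ζ)) (X.rep e) z = tAct (e.trans e' (e.chart.symm z.1))
      (derComp (vec (vertical (fun P => tAct (e'.trans e (e.chart.symm z.1)) (η P))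
        fun P => tAct (e'.trans e (e.chart.symm z.1)) (ζ P))) (X.rep e') (e.transMap e' z)) := by
  rw [derComp_rep hX e e' hz, derKind_vertical_trans η ζ e e' hz, zero_mul, lAct_zero_left,
    zero_add, push_vertical η ζ e e' hz]

theorem tAct_single {κ : Type*} [DecidableEq κ] {s : κ → SType} (G : KindMat) (i : κ)
    (Y : Idx (s i) → ℂ) (j : κ) :
    tAct G (Pi.single (M := fun j => Idx (s j) → ℂ) i Y j) =
      Pi.single (M := fun j => Idx (s j) → ℂ) i (tAct G Y) j :=
  Pi.apply_single (fun j => tAct (t := s j) G) (fun _ => tAct_zero G) i Y j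

theorem vert_isTensorial (P : Fin J) (Y : ExtField S ty (ty P)) {Z : ExtField S ty t}
    (hZ : Z.Smooth 𝓢) : IsTensorial (𝓢 := 𝓢) (vertLocal P Y Z) :=
  isTensorial_of_transMap fun e e' z hz => by
    rw [vertLocal_eq, vertLocal_eq, derComp_vertical_rep hZ e e' hz]
    simp only [tAct_single, tAct_rep Y e e' hz, Pi.zero_apply, tAct_zero]
    rfl

theorem vertBar_isTensorial (P : Fin J) (Y : ExtField S ty (conjType (ty P)))
    {Z : ExtField S ty t} (hZ : Z.Smooth 𝓢) : IsTensorial (𝓢 := 𝓢) (vertBarLocal P Y Z) :=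
  isTensorial_of_transMap fun e e' z hz => by
    rw [vertBarLocal_eq, vertBarLocal_eq, derComp_vertical_rep hZ e e' hz]
    simp only [tAct_single (s := fun P => conjType (ty P)), tAct_rep Y e e' hz, Pi.zero_apply,
      tAct_zero]
    rfl

/-! ### Algebraic operations in different charts -/

/-- Operator valued spin-tensors transform by conjugation with the transition matrices. -/
theorem kindMatrix_tAct_trans (e e' : EquippedChart 𝓢) (p : M) (X : Idx tySpinOp → ℂ)
    (X' : Idx tyBarOp → ℂ) (R : Idx tyVecOp → ℂ) :
    kindMatrix (spinOpMatrix (tAct (e.trans e' p) X)) (barOpMatrix (tAct (e.trans e' p) X'))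
      (vecOpMatrix (tAct (e.trans e' p) R)) =
    e.trans e' p * kindMatrix (spinOpMatrix X) (barOpMatrix X') (vecOpMatrix R) *
      e'.trans e p := by
  have h1 : spinOpMatrix (tAct (e.trans e' p) X) =
      e.spinTrans e' p * spinOpMatrix X * e'.spinTrans e p := by
    ext a b
    simp only [spinOpMatrix, Matrix.mul_apply]
    rw [tAct_mkIdx]
    simp only [sum_fun_succ, sum_fun_zero, Finset.sum_mul]
    rw [Finset.sum_comm]
    refine Finset.sum_congr rfl fun i _ => Finset.sum_congr rfl fun j _ => ?_
    simp [EquippedChart.trans]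
    ring
  have h2 : barOpMatrix (tAct (e.trans e' p) X') =
      (e.spinTrans e' p).map (starRingEnd ℂ) * barOpMatrix X' *
        (e'.spinTrans e p).map (starRingEnd ℂ) := by
    ext a b
    simp only [barOpMatrix, Matrix.mul_apply]
    rw [tAct_mkIdx]
    simp only [sum_fun_succ, sum_fun_zero, Finset.sum_mul]
    rw [Finset.sum_comm]
    refine Finset.sum_congr rfl fun i _ => Finset.sum_congr rfl fun j _ => ?_
    simp [EquippedChart.trans]
    ring
  have h3 : vecOpMatrix (tAct (e.trans e' p) R) =
      e.tanTrans e' p * vecOpMatrix R * e'.tanTrans e p := by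
    ext a b
    simp only [vecOpMatrix, Matrix.mul_apply]
    rw [tAct_mkIdx]
    simp only [sum_fun_succ, sum_fun_zero, Finset.sum_mul]
    rw [Finset.sum_comm]
    refine Finset.sum_congr rfl fun i _ => Finset.sum_congr rfl fun j _ => ?_
    simp [EquippedChart.trans]
    ring
  rw [h1, h2, h3]
  -- the blocks for lower indices are negative transposes of the blocks for upper indices
  have hT : ∀ {n : ℕ} (a b c : Matrix (Fin n) (Fin n) ℂ),
      -(a * b * c).transpose = c.transpose * -b.transpose * a.transpose := by
    intro n a b c
    rw [Matrix.transpose_mul, Matrix.transpose_mul, mul_neg, neg_mul, mul_assoc]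
  funext k
  cases k
  · rfl
  · exact hT _ _ _
  · rfl
  · exact hT _ _ _
  · rfl
  · exact hT _ _ _

theorem deg_isTensorial (X : ExtField S ty tySpinOp) (X' : ExtField S ty tyBarOp)
    (R : ExtField S ty tyVecOp) (Z : ExtField S ty t) :
    IsTensorial (𝓢 := 𝓢) (degLocal X X' R Z) :=
  isTensorial_of_transMap fun e e' z hz => by
    rw [degLocal, degLocal, degComp_eq_lAct, degComp_eq_lAct, rep_eq_tAct X e e' hz,
      rep_eq_tAct X' e e' hz, rep_eq_tAct R e e' hz, rep_eq_tAct Z e e' hz,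
      kindMatrix_tAct_trans, tAct_lAct (e'.trans_mul e _)]

theorem sum_swap_pairs {α β γ δ : Type*} [Fintype α] [Fintype β] [Fintype γ] [Fintype δ]
    (f : α → β → γ → δ → ℂ) :
    ∑ i, ∑ j, ∑ a, ∑ b, f i j a b = ∑ a, ∑ b, ∑ i, ∑ j, f i j a b := by
  have h := Finset.sum_comm (s := (Finset.univ : Finset (α × β)))
    (t := (Finset.univ : Finset (γ × δ))) (f := fun x y => f x.1 x.2 y.1 y.2)
  simpa only [Fintype.sum_prod_type] using h

theorem sum_swap_triple {α β γ V : Type*} [Fintype α] [Fintype β] [Fintype γ] [AddCommMonoid V]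
    (f : α → β → γ → V) :
    ∑ i, ∑ a, ∑ b, f i a b = ∑ a, ∑ b, ∑ i, f i a b := by
  rw [Finset.sum_comm]
  exact Finset.sum_congr rfl fun a _ => Finset.sum_comm

theorem idx_ext {α β ν γ m n : ℕ} {F F' : Idx (mkType α β ν γ m n) → ℂ}
    (h : ∀ i j i' j' k l, F (mkIdx i j i' j' k l) = F' (mkIdx i j i' j' k l)) : F = F' := by
  funext a
  rw [← (idxEquiv α β ν γ m n).apply_symm_apply a]
  exact h _ _ _ _ _ _

/-- Contraction with two vectors commutes with changes of frames. -/
theorem sum_contract {n : ℕ} {G G' : Matrix (Fin n) (Fin n) ℂ} (h : G' * G = 1)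
    (F : Fin n → Fin n → ℂ) (x y : Fin n → ℂ) :
    ∑ i, ∑ j, (∑ a, ∑ b, G' a i * G' b j * F a b) * (∑ c, G i c * x c) * (∑ d, G j d * y d) =
      ∑ a, ∑ b, F a b * x a * y b := by
  have h1 : ∀ (x : Fin n → ℂ) (a : Fin n), ∑ i, G' a i * ∑ c, G i c * x c = x a := fun x a => by
    have h2 : G'.mulVec (G.mulVec x) = x := by rw [Matrix.mulVec_mulVec, h, Matrix.one_mulVec]
    exact congrFun h2 a
  calc ∑ i, ∑ j, (∑ a, ∑ b, G' a i * G' b j * F a b) * (∑ c, G i c * x c) * (∑ d, G j d * y d)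
      = ∑ i, ∑ j, ∑ a, ∑ b, F a b * (G' a i * ∑ c, G i c * x c) *
          (G' b j * ∑ d, G j d * y d) := by
        refine Finset.sum_congr rfl fun i _ => Finset.sum_congr rfl fun j _ => ?_
        generalize ∑ c, G i c * x c = u
        generalize ∑ d, G j d * y d = v
        simp only [Finset.sum_mul]
        refine Finset.sum_congr rfl fun a _ => Finset.sum_congr rfl fun b _ => ?_
        ring
    _ = ∑ a, ∑ b, F a b * (∑ i, G' a i * ∑ c, G i c * x c) *
          (∑ j, G' b j * ∑ d, G j d * y d) := by
        rw [sum_swap_pairs]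
        refine Finset.sum_congr rfl fun a _ => Finset.sum_congr rfl fun b _ => ?_
        rw [mul_assoc (F a b), Finset.sum_mul_sum, Finset.mul_sum _ _ (F a b)]
        refine Finset.sum_congr rfl fun i _ => ?_
        rw [Finset.mul_sum _ _ (F a b)]
        refine Finset.sum_congr rfl fun j _ => ?_
        ring
    _ = _ := by simp only [h1]

/-- The contraction of the last two indices of a field with two vector fields, given the law of
transformation of the remaining components. -/
theorem sum_contract_rep (X Y : ExtField S ty tyVector) (e e' : EquippedChart 𝓢) {z : Coord ty}
    (hz : z ∈ e.overlapDom ty e') {f F : Fin 4 → Fin 4 → ℂ}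
    (hf : ∀ i j, f i j = ∑ a, ∑ b, e'.tanTrans e (e.chart.symm z.1) a i *
      e'.tanTrans e (e.chart.symm z.1) b j * F a b) :
    ∑ i, ∑ j, f i j * vecComp (X.rep e z) i * vecComp (Y.rep e z) j =
      ∑ a, ∑ b, F a b * vecComp (X.rep e' (e.transMap e' z)) a *
        vecComp (Y.rep e' (e.transMap e' z)) b := by
  simp only [rep_eq_tAct X e e' hz, rep_eq_tAct Y e e' hz, vecComp_tAct, hf]
  exact sum_contract (e'.tanTrans_mul e (e.chart.symm z.1)) F _ _

theorem evalTorsion_isTensorial (T : ExtField S ty (mkType 0 0 0 0 1 2))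
    (X Y : ExtField S ty tyVector) : IsTensorial (𝓢 := 𝓢) (evalTorsionLocal T X Y) :=
  isTensorial_of_transMap fun e e' z hz => by
    refine idx_ext fun i j i' j' k l => ?_
    refine (sum_contract_rep X Y e e' hz (F := fun a b => ∑ u, e.tanTrans e' (e.chart.symm z.1)
      (k 0) u * T.rep e' (e.transMap e' z) (mkIdx ![] ![] ![] ![] ![u] ![a, b])) ?_).trans ?_
    · intro i j
      rw [rep_eq_tAct T e e' hz]
      refine (tAct_mkIdx _ _ _ _ _ _ _ _).trans ?_
      simp only [sum_fun_succ, sum_fun_zero]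
      rw [sum_swap_triple]
      refine Finset.sum_congr rfl fun a _ => Finset.sum_congr rfl fun b _ => ?_
      rw [Finset.mul_sum]
      refine Finset.sum_congr rfl fun u _ => ?_
      simp [EquippedChart.trans, mkIdx]
      ring
    · rw [tAct_mkIdx]
      simp only [sum_fun_succ, sum_fun_zero, Finset.sum_mul]
      rw [← sum_swap_triple]
      refine Finset.sum_congr rfl fun u _ => ?_
      simp [EquippedChart.trans, mkIdx, evalTorsionLocal, Finset.mul_sum]
      refine Finset.sum_congr rfl fun a _ => Finset.sum_congr rfl fun b _ => ?_
      ring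

theorem evalS_isTensorial (T : ExtField S ty (mkType 1 1 0 0 0 2))
    (X Y : ExtField S ty tyVector) : IsTensorial (𝓢 := 𝓢) (evalSLocal T X Y) :=
  isTensorial_of_transMap fun e e' z hz => by
    refine idx_ext fun i j i' j' k l => ?_
    refine (sum_contract_rep X Y e e' hz (F := fun a b => ∑ u, ∑ v,
      e.spinTrans e' (e.chart.symm z.1) (i 0) u * e'.spinTrans e (e.chart.symm z.1) v (j 0) *
        T.rep e' (e.transMap e' z) (mkIdx ![u] ![v] ![] ![] ![] ![a, b])) ?_).trans ?_
    · intro i j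
      rw [rep_eq_tAct T e e' hz]
      refine (tAct_mkIdx _ _ _ _ _ _ _ _).trans ?_
      simp only [sum_fun_succ, sum_fun_zero]
      rw [sum_swap_pairs]
      refine Finset.sum_congr rfl fun a _ => Finset.sum_congr rfl fun b _ => ?_
      simp only [Finset.mul_sum]
      refine Finset.sum_congr rfl fun u _ => Finset.sum_congr rfl fun v _ => ?_
      simp [EquippedChart.trans, mkIdx]
      ring
    · rw [tAct_mkIdx]
      simp only [sum_fun_succ, sum_fun_zero, Finset.sum_mul]
      rw [← sum_swap_pairs]
      refine Finset.sum_congr rfl fun u _ => Finset.sum_congr rfl fun v _ => ?_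
      simp [EquippedChart.trans, mkIdx, evalSLocal, Finset.mul_sum]
      refine Finset.sum_congr rfl fun a _ => Finset.sum_congr rfl fun b _ => ?_
      ring

theorem evalS'_isTensorial (T : ExtField S ty (mkType 0 0 1 1 0 2))
    (X Y : ExtField S ty tyVector) : IsTensorial (𝓢 := 𝓢) (evalS'Local T X Y) :=
  isTensorial_of_transMap fun e e' z hz => by
    refine idx_ext fun i j i' j' k l => ?_
    refine (sum_contract_rep X Y e e' hz (F := fun a b => ∑ u, ∑ v,
      starRingEnd ℂ (e.spinTrans e' (e.chart.symm z.1) (i' 0) u) *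
        starRingEnd ℂ (e'.spinTrans e (e.chart.symm z.1) v (j' 0)) *
        T.rep e' (e.transMap e' z) (mkIdx ![] ![] ![u] ![v] ![] ![a, b])) ?_).trans ?_
    · intro i j
      rw [rep_eq_tAct T e e' hz]
      refine (tAct_mkIdx _ _ _ _ _ _ _ _).trans ?_
      simp only [sum_fun_succ, sum_fun_zero]
      rw [sum_swap_pairs]
      refine Finset.sum_congr rfl fun a _ => Finset.sum_congr rfl fun b _ => ?_
      simp only [Finset.mul_sum]
      refine Finset.sum_congr rfl fun u _ => Finset.sum_congr rfl fun v _ => ?_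
      simp [EquippedChart.trans, mkIdx]
      ring
    · rw [tAct_mkIdx]
      simp only [sum_fun_succ, sum_fun_zero, Finset.sum_mul]
      rw [← sum_swap_pairs]
      refine Finset.sum_congr rfl fun u _ => Finset.sum_congr rfl fun v _ => ?_
      simp [EquippedChart.trans, mkIdx, evalS'Local, Finset.mul_sum]
      refine Finset.sum_congr rfl fun a _ => Finset.sum_congr rfl fun b _ => ?_
      ring

theorem evalR_isTensorial (T : ExtField S ty (mkType 0 0 0 0 1 3))
    (X Y : ExtField S ty tyVector) : IsTensorial (𝓢 := 𝓢) (evalRLocal T X Y) :=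
  isTensorial_of_transMap fun e e' z hz => by
    refine idx_ext fun i j i' j' k l => ?_
    refine (sum_contract_rep X Y e e' hz (F := fun a b => ∑ u, ∑ v,
      e.tanTrans e' (e.chart.symm z.1) (k 0) u * e'.tanTrans e (e.chart.symm z.1) v (l 0) *
        T.rep e' (e.transMap e' z) (mkIdx ![] ![] ![] ![] ![u] ![v, a, b])) ?_).trans ?_
    · intro i j
      rw [rep_eq_tAct T e e' hz]
      refine (tAct_mkIdx _ _ _ _ _ _ _ _).trans ?_
      simp only [sum_fun_succ, sum_fun_zero]
      rw [sum_swap_pairs]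
      refine Finset.sum_congr rfl fun a _ => Finset.sum_congr rfl fun b _ => ?_
      simp only [Finset.mul_sum]
      refine Finset.sum_congr rfl fun u _ => Finset.sum_congr rfl fun v _ => ?_
      simp [EquippedChart.trans, mkIdx, Fin.prod_univ_three]
      ring
    · rw [tAct_mkIdx]
      simp only [sum_fun_succ, sum_fun_zero, Finset.sum_mul]
      rw [← sum_swap_pairs]
      refine Finset.sum_congr rfl fun u _ => Finset.sum_congr rfl fun v _ => ?_
      simp [EquippedChart.trans, mkIdx, evalRLocal, Finset.mul_sum]
      refine Finset.sum_congr rfl fun a _ => Finset.sum_congr rfl fun b _ => ?_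
      ring

theorem tau_isRep (Z : ExtField S ty t) : IsRep (𝓢 := 𝓢) (tauLocal Z) (tau 𝓢 Z) :=
  (tau_isTensorial Z).isRep

theorem vert_isRep (P : Fin J) (Y : ExtField S ty (ty P)) {Z : ExtField S ty t}
    (hZ : Z.Smooth 𝓢) : IsRep (𝓢 := 𝓢) (vertLocal P Y Z) (vert 𝓢 P Y Z) :=
  (vert_isTensorial P Y hZ).isRep

theorem vertBar_isRep (P : Fin J) (Y : ExtField S ty (conjType (ty P))) {Z : ExtField S ty t}
    (hZ : Z.Smooth 𝓢) : IsRep (𝓢 := 𝓢) (vertBarLocal P Y Z) (vertBar 𝓢 P Y Z) :=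
  (vertBar_isTensorial P Y hZ).isRep

theorem deg_isRep (X : ExtField S ty tySpinOp) (X' : ExtField S ty tyBarOp)
    (R : ExtField S ty tyVecOp) (Z : ExtField S ty t) :
    IsRep (𝓢 := 𝓢) (degLocal X X' R Z) (deg 𝓢 X X' R Z) :=
  (deg_isTensorial X X' R Z).isRep

theorem evalTorsion_isRep (T : ExtField S ty (mkType 0 0 0 0 1 2)) (X Y : ExtField S ty tyVector) :
    IsRep (𝓢 := 𝓢) (evalTorsionLocal T X Y) (evalTorsion 𝓢 T X Y) :=
  (evalTorsion_isTensorial T X Y).isRep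

theorem evalS_isRep (R : ExtField S ty (mkType 1 1 0 0 0 2)) (X Y : ExtField S ty tyVector) :
    IsRep (𝓢 := 𝓢) (evalSLocal R X Y) (evalS 𝓢 R X Y) :=
  (evalS_isTensorial R X Y).isRep

theorem evalS'_isRep (R : ExtField S ty (mkType 0 0 1 1 0 2)) (X Y : ExtField S ty tyVector) :
    IsRep (𝓢 := 𝓢) (evalS'Local R X Y) (evalS' 𝓢 R X Y) :=
  (evalS'_isTensorial R X Y).isRep

theorem evalR_isRep (R : ExtField S ty (mkType 0 0 0 0 1 3)) (X Y : ExtField S ty tyVector) :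
    IsRep (𝓢 := 𝓢) (evalRLocal R X Y) (evalR 𝓢 R X Y) :=
  (evalR_isTensorial R X Y).isRep

end Overlaps

/-! ### The transformation law of connections -/

section ConnectionLaw

theorem mul_sum_smul_mul_apply {n : ℕ} (g g' : Matrix (Fin n) (Fin n) ℂ) (c : Fin 4 → ℂ)
    (B : Fin 4 → Matrix (Fin n) (Fin n) ℂ) (k i : Fin n) :
    (g * (∑ l, c l • B l) * g') k i = ∑ b, ∑ a, ∑ l, g k a * g' b i * c l * B l a b := by
  simp only [Matrix.mul_apply, Matrix.sum_apply, Matrix.smul_apply, smul_eq_mul, Finset.mul_sum,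
    Finset.sum_mul]
  refine Finset.sum_congr rfl fun b _ => ?_
  rw [Finset.sum_comm]
  refine Finset.sum_congr rfl fun a _ => Finset.sum_congr rfl fun l _ => ?_
  ring

/-- The derivatives of mutually inverse matrices. -/
theorem derMat_mul_inverse {n : ℕ} {Λ : (Coord ty →L[ℝ] ℂ) →ₗ[ℂ] ℂ}
    {g g' : Coord ty → Matrix (Fin n) (Fin n) ℂ} {z : Coord ty} (h : ∀ w, g w * g' w = 1)
    (hg : MatDiff g z) (hg' : MatDiff g' z) :
    derMat Λ g z * g' z + g z * derMat Λ g' z = 0 := by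
  rw [← derMat_mul hg hg']
  ext i j
  simp only [derMat, h]
  exact der_const _

namespace SpinorConnection

/-- The matrices `B` are the components of a connection in the bundle with the transition functions
`g`. The inhomogeneous term of the law is written as the derivative of the transition functions
along the horizontal vectors of `C`; on functions of `x` these act as the frame vectors. This
uniform setting covers `A`, `Ā`, `Γ` and their duals. -/
structure IsConnection (C : SpinorConnection 𝓢 ty) {n : ℕ}
    (g : EquippedChart 𝓢 → EquippedChart 𝓢 → M → Matrix (Fin n) (Fin n) ℂ)
    (B : EquippedChart 𝓢 → Coord ty → Fin 4 → Matrix (Fin n) (Fin n) ℂ) : Prop where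
  mul_eq_one : ∀ e e' p, g e e' p * g e' e p = 1
  contDiffOn_left : ∀ e e' i j,
    ContDiffOn ℝ ∞ (fun x => g e e' (e.chart.symm x) i j) (e.overlap e')
  contDiffOn_right : ∀ e e' i j,
    ContDiffOn ℝ ∞ (fun x => g e' e (e.chart.symm x) i j) (e.overlap e')
  contDiffOn : ∀ e j a b, ContDiffOn ℝ ∞ (fun z => B e z j a b) (e.dom ty)
  law : ∀ e e' z, z ∈ e.overlapDom ty e' → ∀ j, B e z j =
    g e e' (e.chart.symm z.1) *
      (∑ c, e'.tanTrans e (e.chart.symm z.1) c j • B e' (e.transMap e' z) c) *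
        g e' e (e.chart.symm z.1) +
    g e e' (e.chart.symm z.1) * derMat (C.H e j z) (fun w => g e' e (e.chart.symm w.1)) z

variable {C : SpinorConnection 𝓢 ty}

namespace IsConnection

variable {n : ℕ} {g : EquippedChart 𝓢 → EquippedChart 𝓢 → M → Matrix (Fin n) (Fin n) ℂ}
  {B : EquippedChart 𝓢 → Coord ty → Fin 4 → Matrix (Fin n) (Fin n) ℂ}

theorem matDiff_left (h : C.IsConnection g B) (e e' : EquippedChart 𝓢) {z : Coord ty}
    (hz : z ∈ e.overlapDom ty e') : MatDiff (fun w : Coord ty => g e e' (e.chart.symm w.1)) z :=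
  fun i j => ((h.contDiffOn_left e e' i j).diffAt (e.isOpen_overlap e') hz).comp z
    differentiableAt_fst

theorem matDiff_right (h : C.IsConnection g B) (e e' : EquippedChart 𝓢) {z : Coord ty}
    (hz : z ∈ e.overlapDom ty e') : MatDiff (fun w : Coord ty => g e' e (e.chart.symm w.1)) z :=
  fun i j => ((h.contDiffOn_right e e' i j).diffAt (e.isOpen_overlap e') hz).comp z
    differentiableAt_fst

theorem matDiff (h : C.IsConnection g B) (e : EquippedChart 𝓢) {z : Coord ty}
    (hz : z ∈ e.dom ty) (j : Fin 4) : MatDiff (fun w => B e w j) z :=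
  fun a b => (h.contDiffOn e j a b).diffAt e.isOpen_dom hz

/-- The connection in the dual bundle, with the negative transposed matrices. -/
theorem dual (h : C.IsConnection g B) :
    C.IsConnection (fun e e' p => (g e' e p).transpose) fun e z j => -(B e z j).transpose where
  mul_eq_one e e' p := by
    rw [← Matrix.transpose_mul, h.mul_eq_one, Matrix.transpose_one]
  contDiffOn_left e e' i j := h.contDiffOn_right e e' j i
  contDiffOn_right e e' i j := h.contDiffOn_left e e' j i
  contDiffOn e j a b := (h.contDiffOn e j b a).neg
  law e e' z hz j := by
    have h1 := derMat_mul_inverse (Λ := C.H e j z) (fun w => h.mul_eq_one e e' (e.chart.symm w.1))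
      (h.matDiff_left e e' hz) (h.matDiff_right e e' hz)
    have h2 : derMat (C.H e j z) (fun w => (g e e' (e.chart.symm w.1)).transpose) z =
      (derMat (C.H e j z) (fun w => g e e' (e.chart.symm w.1)) z).transpose := rfl
    rw [h2, h.law e e' z hz j, eq_neg_of_add_eq_zero_right h1, ← Matrix.transpose_mul]
    simp only [Matrix.transpose_add, Matrix.transpose_mul, Matrix.transpose_neg, neg_add, neg_neg,
      smul_neg, Finset.sum_neg_distrib, mul_neg, neg_mul, Matrix.transpose_sum,
      Matrix.transpose_smul, mul_assoc]

end IsConnection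

/-- The inhomogeneous term `ϑ` of the law for `A` in matrix form. -/
theorem spinTheta_eq (C : SpinorConnection 𝓢 ty) (e e' : EquippedChart 𝓢) {z : Coord ty}
    (hz : z ∈ e.overlapDom ty e') (k : Fin 2) (j : Fin 4) (i : Fin 2) :
    e.spinTheta e' k j i (e.chart.symm z.1) = (e.spinTrans e' (e.chart.symm z.1) *
      derMat (C.H e j z) (fun w => e'.spinTrans e (e.chart.symm w.1)) z) k i := by
  rw [Matrix.mul_apply]
  refine Finset.sum_congr rfl fun a _ => ?_
  rw [derMat, C.der_H_lieD (f := fun p => e'.spinTrans e p a i) e j hz.1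
    ((e.contDiffOn_spinTrans' e' a i).diffAt (e.isOpen_overlap e') hz)]

/-- The inhomogeneous term `θ` of the law for `Γ` in matrix form. -/
theorem tanTheta_eq (C : SpinorConnection 𝓢 ty) (e e' : EquippedChart 𝓢) {z : Coord ty}
    (hz : z ∈ e.overlapDom ty e') (k j i : Fin 4) :
    e.tanTheta e' k j i (e.chart.symm z.1) = (e.tanTrans e' (e.chart.symm z.1) *
      derMat (C.H e j z) (fun w => e'.tanTrans e (e.chart.symm w.1)) z) k i := by
  rw [Matrix.mul_apply]
  refine Finset.sum_congr rfl fun a _ => ?_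
  rw [derMat, C.der_H_lieD (f := fun p => e'.tanTrans e p a i) e j hz.1
    ((e.contDiffOn_tanTrans' e' a i).diffAt (e.isOpen_overlap e') hz)]

/-- The horizontal vectors are real on functions of `x`. -/
theorem der_H_conj (C : SpinorConnection 𝓢 ty) (e : EquippedChart 𝓢) (j : Fin 4)
    {f : EuclideanSpace ℝ (Fin 4) → ℂ} {z : Coord ty} (hf : DifferentiableAt ℝ f z.1) :
    der (C.H e j z) (fun w => starRingEnd ℂ (f w.1)) z =
      starRingEnd ℂ (der (C.H e j z) (fun w => f w.1) z) := by
  have h : HasFDerivAt (fun x => starRingEnd ℂ (f x))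
      ((Complex.conjCLE : ℂ →L[ℝ] ℂ).comp (fderiv ℝ f z.1)) z.1 :=
    (Complex.conjCLE : ℂ →L[ℝ] ℂ).hasFDerivAt.comp z.1 hf.hasFDerivAt
  rw [C.der_H_fst e j hf, C.der_H_fst (f := fun x => starRingEnd ℂ (f x)) e j h.differentiableAt,
    h.fderiv]
  rfl

variable (C)

theorem isConnection_A : C.IsConnection EquippedChart.spinTrans C.A where
  mul_eq_one e e' p := e.spinTrans_mul e' p
  contDiffOn_left e e' := e.contDiffOn_spinTrans e'
  contDiffOn_right e e' := e.contDiffOn_spinTrans' e'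
  contDiffOn := C.A_smooth
  law e e' z hz j := by
    ext k i
    have h := C.A_trans e e' (e.point z) (e.point_mem hz.1) hz.2 j k i
    rw [e.coord_point hz.1, e.coord_point_eq_transMap] at h
    rw [Matrix.add_apply, mul_sum_smul_mul_apply, ← C.spinTheta_eq e e' hz]
    exact h

theorem isConnection_A' :
    C.IsConnection (fun e e' p => (e.spinTrans e' p).map (starRingEnd ℂ)) C.A' where
  mul_eq_one e e' p := by
    rw [← Matrix.map_mul, e.spinTrans_mul, Matrix.map_one _ (map_zero _) (map_one _)]
  contDiffOn_left e e' i j := EquippedChart.contDiffOn_conj (e.contDiffOn_spinTrans e' i j)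
  contDiffOn_right e e' i j := EquippedChart.contDiffOn_conj (e.contDiffOn_spinTrans' e' i j)
  contDiffOn := C.A'_smooth
  law e e' z hz j := by
    ext k i
    have h := C.A'_trans e e' (e.point z) (e.point_mem hz.1) hz.2 j k i
    rw [e.coord_point hz.1, e.coord_point_eq_transMap] at h
    rw [Matrix.add_apply, mul_sum_smul_mul_apply, h]
    congr 1
    refine (congrArg (starRingEnd ℂ) (C.spinTheta_eq e e' hz k j i)).trans ?_
    rw [Matrix.mul_apply, Matrix.mul_apply, map_sum]
    refine Finset.sum_congr rfl fun a _ => ?_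
    rw [map_mul]
    congr 1
    exact (C.der_H_conj e j
      ((e.contDiffOn_spinTrans' e' a i).diffAt (e.isOpen_overlap e') hz)).symm

theorem isConnection_Γ : C.IsConnection EquippedChart.tanTrans C.Γ where
  mul_eq_one e e' p := e.tanTrans_mul e' p
  contDiffOn_left e e' := e.contDiffOn_tanTrans e'
  contDiffOn_right e e' := e.contDiffOn_tanTrans' e'
  contDiffOn := C.Γ_smooth
  law e e' z hz j := by
    ext k i
    have h := C.Γ_trans e e' (e.point z) (e.point_mem hz.1) hz.2 j k i
    rw [e.coord_point hz.1, e.coord_point_eq_transMap] at h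
    rw [Matrix.add_apply, mul_sum_smul_mul_apply, ← C.tanTheta_eq e e' hz]
    exact h

theorem isConnection_conn (k : Kind) :
    C.IsConnection (fun e e' p => e.trans e' p k) fun e z j => C.conn e j z k := by
  cases k
  · exact C.isConnection_A
  · exact C.isConnection_A.dual
  · exact C.isConnection_A'
  · exact C.isConnection_A'.dual
  · exact C.isConnection_Γ
  · exact C.isConnection_Γ.dual

/-- The transformation law of the connection, for all kinds of indices at once. -/
theorem conn_eq (e e' : EquippedChart 𝓢) {z : Coord ty} (hz : z ∈ e.overlapDom ty e') (j : Fin 4) :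
    C.conn e j z = e.trans e' (e.chart.symm z.1) *
      (∑ c, e'.tanTrans e (e.chart.symm z.1) c j • C.conn e' c (e.transMap e' z)) *
        e'.trans e (e.chart.symm z.1) +
      e.trans e' (e.chart.symm z.1) *
        derKind (C.H e j z) (fun w => e'.trans e (e.chart.symm w.1)) z := by
  funext k
  have h := (C.isConnection_conn k).law e e' z hz j
  simp only [Pi.add_apply, Pi.mul_apply, Finset.sum_apply, Pi.smul_apply]
  exact h

/-- The derivatives of the transition matrices and of their inverses. -/
theorem derKind_mul_trans (e e' : EquippedChart 𝓢) {z : Coord ty} (hz : z ∈ e.overlapDom ty e')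
    (Λ : (Coord ty →L[ℝ] ℂ) →ₗ[ℂ] ℂ) :
    derKind Λ (fun w => e.trans e' (e.chart.symm w.1)) z * e'.trans e (e.chart.symm z.1) +
      e.trans e' (e.chart.symm z.1) * derKind Λ (fun w => e'.trans e (e.chart.symm w.1)) z = 0 := by
  funext k
  have h : ∀ w : Coord ty, e.trans e' (e.chart.symm w.1) k * e'.trans e (e.chart.symm w.1) k = 1 :=
    fun w => congrFun (e.trans_mul e' (e.chart.symm w.1)) k
  show derMat Λ (fun w => e.trans e' (e.chart.symm w.1) k) z * e'.trans e (e.chart.symm z.1) k +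
    e.trans e' (e.chart.symm z.1) k * derMat Λ (fun w => e'.trans e (e.chart.symm w.1) k) z = 0
  exact derMat_mul_inverse (g := fun w : Coord ty => e.trans e' (e.chart.symm w.1) k)
    (g' := fun w : Coord ty => e'.trans e (e.chart.symm w.1) k) h
    (e.matDiff_trans e' hz k) (e.matDiff_trans' e' hz k)

/-- Components which are parallel along the horizontal vectors remain parallel in another chart. -/
theorem derComp_H_tAct_trans (e e' : EquippedChart 𝓢) {z : Coord ty}
    (hz : z ∈ e.overlapDom ty e') (j : Fin 4) {X : Coord ty → Idx t → ℂ}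
    (hX : ∀ a, DifferentiableAt ℝ (fun w => X w a) z)
    (hp : derComp (C.H e j z) X z = -lAct (C.conn e j z) (X z)) :
    derComp (C.H e j z) (fun w => tAct (e'.trans e (e.chart.symm w.1)) (X w)) z =
      -∑ c, e'.tanTrans e (e.chart.symm z.1) c j • lAct (C.conn e' c (e.transMap e' z))
        (tAct (e'.trans e (e.chart.symm z.1)) (X z)) := by
  have h1 := e'.trans_mul e (e.chart.symm z.1)
  have h2 : e'.trans e (e.chart.symm z.1) * C.conn e j z * e.trans e' (e.chart.symm z.1) =
      (∑ c, e'.tanTrans e (e.chart.symm z.1) c j • C.conn e' c (e.transMap e' z)) +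
      derKind (C.H e j z) (fun w => e'.trans e (e.chart.symm w.1)) z *
        e.trans e' (e.chart.symm z.1) := by
    rw [C.conn_eq e e' hz j, mul_add, add_mul]
    simp only [← mul_assoc, h1, one_mul]
    rw [mul_assoc (∑ c, _), h1, mul_one]
  rw [derComp_tAct_trans e e' hz _ hX, hp, tAct_neg, tAct_lAct (e.trans_mul e' (e.chart.symm z.1)),
    h2, lAct_add_left, lAct_sum_left]
  simp only [lAct_smul_left]
  abel

/-- The change of local coordinates maps horizontal vectors to horizontal vectors. It suffices to
compare the derivatives of the complex coordinates: for `x^k` this is the transformation of frame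
vectors, for `S[P]` and `τS[P]` it is the law of transformation of the connection. -/
theorem push_H (e e' : EquippedChart 𝓢) {z : Coord ty} (hz : z ∈ e.overlapDom ty e') (j : Fin 4) :
    push (fderiv ℝ (e.transMap e') z) (C.H e j z) =
      ∑ c, e'.tanTrans e (e.chart.symm z.1) c j • C.H e' c (e.transMap e' z) := by
  refine vec_ext fun α => ?_
  rw [push_transMap_apply e e' hz, LinearMap.sum_apply]
  simp only [LinearMap.smul_apply, smul_eq_mul, H, vec_coordL]
  rcases α with k | ⟨P, b⟩ | ⟨P, b⟩
  · have hψ : ContDiffOn ℝ ∞ (fun x => e'.chart (e.chart.symm x)) (e.overlap e') :=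
      e.contDiffOn_comp_symm (contMDiffOn_of_mem_maximalAtlas e'.chart_mem)
    have h1 := (hψ.diffAt (e.isOpen_overlap e') hz).hasFDerivAt
    have h2 : HasFDerivAt (fun x => (e'.chart (e.chart.symm x) k : ℂ))
        ((Complex.ofRealCLM.comp (EuclideanSpace.proj (𝕜 := ℝ) k)).comp
          (fderiv ℝ (fun x => e'.chart (e.chart.symm x)) z.1)) z.1 :=
      (Complex.ofRealCLM.comp (EuclideanSpace.proj (𝕜 := ℝ) k)).hasFDerivAt.comp z.1 h1
    refine (C.der_H_fst e j h2.differentiableAt).trans ?_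
    rw [h2.fderiv]
    show ((fderiv ℝ (fun x => e'.chart (e.chart.symm x)) z.1 (e.frameVec j z.1) k : ℝ) : ℂ) = _
    rw [e.fderiv_transition_frameVec e' j hz]
    simp [EquippedChart.tanTrans, hcoef, EquippedChart.upsilon_eq, EquippedChart.transMap]
  · have h := congrFun (C.derComp_H_tAct_trans e e' hz j (X := fun w => w.2 P)
      (fun a => (contDiffOn_coord_snd P a (e.dom ty)).diffAt e.isOpen_dom hz.1)
      (C.derComp_H_snd e j z P)) b
    refine Eq.trans h ?_
    simp only [Pi.neg_apply, Finset.sum_apply, Pi.smul_apply, smul_eq_mul, hcoef, mul_neg,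
      Finset.sum_neg_distrib]
    rfl
  · have h := congrFun (C.derComp_H_tAct_trans e e' hz j (X := fun w => tauComp (w.2 P))
      (fun a => (contDiffOn_tauComp_snd P a (e.dom ty)).diffAt e.isOpen_dom hz.1)
      (C.derComp_H_tauComp_snd e j z P)) b
    have h3 : (fun w : Coord ty => coordL ty (.inr (.inr ⟨P, b⟩)) (e.transMap e' w)) =
        fun w => tAct (e'.trans e (e.chart.symm w.1)) (tauComp (w.2 P)) b := by
      funext w
      rw [← e'.tauComp_tAct_trans e]
      rfl
    rw [← H, h3]
    refine Eq.trans h ?_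
    simp only [Pi.neg_apply, Finset.sum_apply, Pi.smul_apply, smul_eq_mul, hcoef, mul_neg,
      Finset.sum_neg_distrib]
    rw [← e'.tauComp_tAct_trans e]
    rfl

theorem derComp_sum_smul {κ : Type*} [Fintype κ] (c : κ → ℂ)
    (Λ : κ → (Coord ty →L[ℝ] ℂ) →ₗ[ℂ] ℂ) (X : Coord ty → Idx t → ℂ) (z : Coord ty) :
    derComp (∑ i, c i • Λ i) X z = ∑ i, c i • derComp (Λ i) X z := by
  funext a
  simp [derComp, der_sum_left, der_smul_left]

/-- The law of transformation of covariant derivatives: the derivatives of the transition matrices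
cancel with the inhomogeneous term of the law of transformation of the connection. -/
theorem nablaComp_rep {Z : ExtField S ty t} (hZ : Z.Smooth 𝓢) (e e' : EquippedChart 𝓢)
    {z : Coord ty} (hz : z ∈ e.overlapDom ty e') (j : Fin 4) :
    C.nablaComp e j (Z.rep e) z = ∑ c, e'.tanTrans e (e.chart.symm z.1) c j •
      tAct (e.trans e' (e.chart.symm z.1)) (C.nablaComp e' c (Z.rep e') (e.transMap e' z)) := by
  have h1 := tAct_lAct (e'.trans_mul e (e.chart.symm z.1))
    (∑ c, e'.tanTrans e (e.chart.symm z.1) c j • C.conn e' c (e.transMap e' z))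
    (Z.rep e' (e.transMap e' z))
  rw [← rep_eq_tAct Z e e' hz] at h1
  rw [nablaComp_eq, derComp_rep hZ e e' hz, C.push_H e e' hz, C.conn_eq e e' hz, lAct_add_left,
    ← h1]
  have h2 := congrArg (fun g => lAct g (Z.rep e z)) (derKind_mul_trans e e' hz (C.H e j z))
  simp only [lAct_add_left, lAct_zero_left] at h2
  simp only [nablaComp_eq, tAct_add, smul_add, Finset.sum_add_distrib, derComp_sum_smul, tAct_sum,
    tAct_smul, lAct_sum_left, lAct_smul_left]
  linear_combination h2

theorem nabla_isTensorial (X : ExtField S ty tyVector) {Z : ExtField S ty t} (hZ : Z.Smooth 𝓢) :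
    IsTensorial (C.nablaLocal X Z) :=
  isTensorial_of_transMap fun e e' z hz => by
    have h1 : ∀ (e : EquippedChart 𝓢) z, C.nablaLocal X Z e z =
        ∑ j, vecComp (X.rep e z) j • C.nablaComp e j (Z.rep e) z := by
      intro e z
      funext a
      simp [nablaLocal]
    have h2 : ∀ c, ∑ j, vecComp (X.rep e z) j * e'.tanTrans e (e.chart.symm z.1) c j =
        vecComp (X.rep e' (e.transMap e' z)) c := by
      intro c
      rw [← tAct_rep X e e' hz, vecComp_tAct]
      exact Finset.sum_congr rfl fun j _ => mul_comm _ _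
    rw [h1, h1, tAct_sum]
    simp only [C.nablaComp_rep hZ e e' hz, Finset.smul_sum, smul_smul, tAct_smul]
    rw [Finset.sum_comm]
    simp only [← Finset.sum_smul, h2]

end SpinorConnection

end ConnectionLaw

/-! ### The transformation laws of the torsion and the curvature -/

section CurvatureLaw

/-- Antisymmetrization of contracted second derivatives. -/
theorem sum_smul_antisymm {V : Type*} [AddCommGroup V] [Module ℂ V] {n : ℕ} (x y : Fin n → ℂ)
    (D : Fin n → Fin n → V) :
    ∑ c, y c • ∑ d, x d • D d c - ∑ c, x c • ∑ d, y d • D d c =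
      ∑ a, ∑ b, (x a * y b) • (D a b - D b a) := by
  simp only [Finset.smul_sum, smul_smul, smul_sub, Finset.sum_sub_distrib]
  rw [Finset.sum_comm]
  simp only [mul_comm]

/-- Covariance of the expression of the curvature, as an identity in an associative ring: `G` is
the transition function, `b` is the connection in the new frame, and `K` is the derivative
of `G' = G⁻¹`. -/
theorem curvature_gauge {A : Type*} [Ring A] {G G' Ki Kj bi bj dbi dbj dKi dKj dGi dGj s t : A}
    (h : G' * G = 1) (hi : dGi = -(G * Ki * G)) (hj : dGj = -(G * Kj * G)) (hK : dKj - dKi = s) :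
    ((dGi * bj + G * dbj) * G' + G * bj * Ki + (dGi * Kj + G * dKj)) -
      ((dGj * bi + G * dbi) * G' + G * bi * Kj + (dGj * Ki + G * dKi)) +
      ((G * bi * G' + G * Ki) * (G * bj * G' + G * Kj) -
        (G * bj * G' + G * Kj) * (G * bi * G' + G * Ki)) - (G * t * G' + G * s) =
    G * (dbj - dbi + (bi * bj - bj * bi) - t) * G' := by
  have h2 : ∀ x, G' * (G * x) = x := fun x => by rw [← mul_assoc, h, one_mul]
  rw [eq_add_of_sub_eq hK, hi, hj]
  simp only [mul_add, add_mul, mul_sub, sub_mul, neg_mul, mul_assoc, h2]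
  abel

namespace SpinorConnection

variable (C : SpinorConnection 𝓢 ty)

/-- The derivative along `H_j` of a function given in the coordinates of another chart. -/
theorem der_H_transMap (e e' : EquippedChart 𝓢) {z : Coord ty} (hz : z ∈ e.overlapDom ty e')
    (j : Fin 4) {f : Coord ty → ℂ} (hf : DifferentiableAt ℝ f (e.transMap e' z)) :
    der (C.H e j z) (fun w => f (e.transMap e' w)) z =
      ∑ c, e'.tanTrans e (e.chart.symm z.1) c j *
        der (C.H e' c (e.transMap e' z)) f (e.transMap e' z) := by
  rw [der_comp (e.differentiableAt_transMap e' hz) hf, C.push_H e e' hz, der_sum_left]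
  rfl

theorem differentiableAt_tanTrans (e e' : EquippedChart 𝓢) {z : Coord ty}
    (hz : z ∈ e.overlapDom ty e') (i j : Fin 4) :
    DifferentiableAt ℝ (fun w : Coord ty => e'.tanTrans e (e.chart.symm w.1) i j) z :=
  ((e.contDiffOn_tanTrans' e' i j).diffAt (e.isOpen_overlap e') hz).comp z differentiableAt_fst

/-- The derivative of the components `T_{aj} f_a` of a covector in the frame of another chart. -/
theorem der_sum_tanTrans_mul (e e' : EquippedChart 𝓢) {z : Coord ty}
    (hz : z ∈ e.overlapDom ty e') (i j : Fin 4) {f : Fin 4 → Coord ty → ℂ}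
    (hf : ∀ c, DifferentiableAt ℝ (f c) (e.transMap e' z)) :
    der (C.H e i z) (fun w => ∑ c, e'.tanTrans e (e.chart.symm w.1) c j * f c (e.transMap e' w)) z =
      ∑ c, der (C.H e i z) (fun w => e'.tanTrans e (e.chart.symm w.1) c j) z *
        f c (e.transMap e' z) +
      ∑ c, e'.tanTrans e (e.chart.symm z.1) c j * ∑ d, e'.tanTrans e (e.chart.symm z.1) d i *
        der (C.H e' d (e.transMap e' z)) (f c) (e.transMap e' z) := by
  have hd := e.differentiableAt_transMap e' hz
  have hfd : ∀ c, DifferentiableAt ℝ (fun w => f c (e.transMap e' w)) z :=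
    fun c => (hf c).comp z hd
  rw [der_sum fun c _ => (differentiableAt_tanTrans e e' hz c j).fun_mul (hfd c),
    ← Finset.sum_add_distrib]
  refine Finset.sum_congr rfl fun c _ => ?_
  rw [← C.der_H_transMap e e' hz i (hf c)]
  exact der_mul (differentiableAt_tanTrans e e' hz c j) (hfd c)

theorem der_H_apply_fst (e : EquippedChart 𝓢) (j l : Fin 4) (z : Coord ty) :
    der (C.H e j z) (fun w => (w.1 l : ℂ)) z = e.upsilon j l z.1 :=
  (der_coordL (C.H e j z) (.inl l) z).trans (vec_coordL _ _)

/-- The transformation law of the structure functions of frames. It suffices to compare the vectors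
with these components in the frame of the other chart, and they are compared by their coordinates
`x'^l` in that chart. -/
theorem structC_trans (e e' : EquippedChart 𝓢) {z : Coord ty} (hz : z ∈ e.overlapDom ty e')
    (m i j : Fin 4) :
    ∑ k, (e.structC k i j (e.chart.symm z.1) : ℂ) * e'.tanTrans e (e.chart.symm z.1) m k =
      der (C.H e i z) (fun w => e'.tanTrans e (e.chart.symm w.1) m j) z -
      der (C.H e j z) (fun w => e'.tanTrans e (e.chart.symm w.1) m i) z +
      ∑ a, ∑ b, e'.tanTrans e (e.chart.symm z.1) a i * e'.tanTrans e (e.chart.symm z.1) b j *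
        (e'.structC m a b (e.chart.symm z.1) : ℂ) := by
  have hz' := (e.transMap_mem e' hz).1
  have hψ : ContDiffOn ℝ ∞ (fun x => e'.chart (e.chart.symm x)) (e.overlap e') :=
    e.contDiffOn_comp_symm (contMDiffOn_of_mem_maximalAtlas e'.chart_mem)
  have hX : ∀ l : Fin 4, ContDiff ℝ ∞ (fun x : EuclideanSpace ℝ (Fin 4) => (x l : ℂ)) := fun l =>
    Complex.ofRealCLM.contDiff.comp (EuclideanSpace.proj (𝕜 := ℝ) l).contDiff
  have hυ : ∀ l c, DifferentiableAt ℝ (fun w : Coord ty => (e'.upsilon c l w.1 : ℂ))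
      (e.transMap e' z) := fun l c =>
    ((e'.contDiffOn_upsilon c l).diffAt e'.chart.open_target hz').comp _ differentiableAt_fst
  refine sub_eq_zero.1 (congrFun (e'.eq_zero_of_sum_upsilon hz' (y := fun m =>
    ∑ k, (e.structC k i j (e.chart.symm z.1) : ℂ) * e'.tanTrans e (e.chart.symm z.1) m k -
      (der (C.H e i z) (fun w => e'.tanTrans e (e.chart.symm w.1) m j) z -
      der (C.H e j z) (fun w => e'.tanTrans e (e.chart.symm w.1) m i) z +
      ∑ a, ∑ b, e'.tanTrans e (e.chart.symm z.1) a i * e'.tanTrans e (e.chart.symm z.1) b j *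
        (e'.structC m a b (e.chart.symm z.1) : ℂ))) fun l => ?_) m)
  -- both sides of the commutation relation are applied to the coordinate `x'^l` of the other chart
  have h1 := C.der_H_commutator_fst e i j (f := fun x => (e'.chart (e.chart.symm x) l : ℂ)) hz.1
    ((hX l).contDiffAt.comp z.1 (hψ.contDiffAt ((e.isOpen_overlap e').mem_nhds hz)))
  have h2 : ∀ (j : Fin 4) {w : Coord ty}, w ∈ e.overlapDom ty e' →
      der (C.H e j w) (fun v => (e'.chart (e.chart.symm v.1) l : ℂ)) w =
        ∑ c, e'.tanTrans e (e.chart.symm w.1) c j * (e'.upsilon c l (e.transMap e' w).1 : ℂ) := by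
    intro j w hw
    refine (C.der_H_transMap e e' hw j (f := fun w => (w.1 l : ℂ))
      (((hX l).differentiable (by simp)).differentiableAt.comp _ differentiableAt_fst)).trans ?_
    simp only [der_H_apply_fst]
  have h3 : ∀ i j, der (C.H e i z)
      (fun w => der (C.H e j w) (fun v => (e'.chart (e.chart.symm v.1) l : ℂ)) w) z = _ :=
    fun i j => (der_congr (Filter.mem_of_superset ((e.isOpen_overlapDom e').mem_nhds hz)
      fun w hw => h2 j hw)).trans (C.der_sum_tanTrans_mul e e' hz i j
        (f := fun c w => (e'.upsilon c l w.1 : ℂ)) (hυ l))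
  have h4 : ∀ a b, der (C.H e' a (e.transMap e' z)) (fun w => (e'.upsilon b l w.1 : ℂ))
      (e.transMap e' z) - der (C.H e' b (e.transMap e' z)) (fun w => (e'.upsilon a l w.1 : ℂ))
      (e.transMap e' z) = ∑ m, (e'.structC m a b (e.chart.symm z.1) : ℂ) *
        (e'.upsilon m l (e.transMap e' z).1 : ℂ) := by
    intro a b
    have h := C.der_H_commutator_fst e' a b (f := fun x => (x l : ℂ)) hz' (hX l).contDiffAt
    simp only [der_H_apply_fst, e.symm_transMap e' hz] at h
    exact h
  have h5 := sum_smul_antisymm (fun c => e'.tanTrans e (e.chart.symm z.1) c i)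
    (fun c => e'.tanTrans e (e.chart.symm z.1) c j) fun a b =>
      der (C.H e' a (e.transMap e' z)) (fun w => (e'.upsilon b l w.1 : ℂ)) (e.transMap e' z)
  simp only [h4, smul_eq_mul] at h5
  rw [h3, h3] at h1
  simp only [h2 _ hz] at h1
  have h6 : ∑ m, (∑ k, (e.structC k i j (e.chart.symm z.1) : ℂ) *
      e'.tanTrans e (e.chart.symm z.1) m k) * (e'.upsilon m l (e.transMap e' z).1 : ℂ) =
      ∑ k, (e.structC k i j (e.chart.symm z.1) : ℂ) * ∑ c, e'.tanTrans e (e.chart.symm z.1) c k *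
        (e'.upsilon c l (e.transMap e' z).1 : ℂ) := by
    simp only [Finset.sum_mul, Finset.mul_sum, mul_assoc]
    exact Finset.sum_comm
  have h7 : ∑ m, (∑ a, ∑ b, e'.tanTrans e (e.chart.symm z.1) a i *
      e'.tanTrans e (e.chart.symm z.1) b j * (e'.structC m a b (e.chart.symm z.1) : ℂ)) *
        (e'.upsilon m l (e.transMap e' z).1 : ℂ) =
      ∑ a, ∑ b, e'.tanTrans e (e.chart.symm z.1) a i * e'.tanTrans e (e.chart.symm z.1) b j *
        ∑ m, (e'.structC m a b (e.chart.symm z.1) : ℂ) *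
          (e'.upsilon m l (e.transMap e' z).1 : ℂ) := by
    simp only [Finset.sum_mul, Finset.mul_sum, mul_assoc]
    exact sum_swap_triple _
  simp only [sub_mul, add_mul, Finset.sum_sub_distrib, Finset.sum_add_distrib, h6, h7]
  linear_combination h5 - h1

/-- The inhomogeneous terms in the laws for `Γ` and for the structure functions cancel in the
torsion. -/
theorem torsion_isTensorial : IsTensorial C.torsionLocal :=
  isTensorial_of_transMap fun e e' z hz => by
    refine idx_ext fun i j i' j' k l => ?_
    rw [tAct_mkIdx]
    simp only [sum_fun_succ, sum_fun_zero]
    show C.torsionComp e z (k 0) (l 0) (l 1) = _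
    set S := e.tanTrans e' (e.chart.symm z.1) with hS
    set T := e'.tanTrans e (e.chart.symm z.1) with hT
    -- the matrix `S` is a left factor of each term in the law for `Γ`
    have hΓ : ∀ i k j, C.Γ e z i k j = ∑ m, S k m * (∑ a, ∑ b, T a i * T b j *
        C.Γ e' (e.transMap e' z) a m b +
          der (C.H e i z) (fun w => e'.tanTrans e (e.chart.symm w.1) m j) z) := by
      intro i k j
      rw [C.isConnection_Γ.law e e' z hz i, ← hS, ← hT, mul_assoc, ← mul_add, Matrix.mul_apply]
      refine Finset.sum_congr rfl fun m _ => ?_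
      congr 1
      rw [Matrix.add_apply]
      congr 1
      simp only [Matrix.mul_apply, Matrix.sum_apply, Matrix.smul_apply, smul_eq_mul,
        Finset.sum_mul]
      rw [Finset.sum_comm]
      refine Finset.sum_congr rfl fun a _ => Finset.sum_congr rfl fun b _ => ?_
      ring
    -- the same form for the structure functions, where `S T = 1` is inserted
    have hc : ∀ k i j, (e.structC k i j (e.chart.symm z.1) : ℂ) = ∑ m, S k m *
        ∑ l, (e.structC l i j (e.chart.symm z.1) : ℂ) * T m l := by
      intro k i j
      have h1 : S.mulVec (T.mulVec fun l => (e.structC l i j (e.chart.symm z.1) : ℂ)) =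
          fun l => (e.structC l i j (e.chart.symm z.1) : ℂ) := by
        rw [Matrix.mulVec_mulVec, e.tanTrans_mul, Matrix.one_mulVec]
      refine (congrFun h1 k).symm.trans ?_
      simp only [Matrix.mulVec, dotProduct, mul_comm (T _ _)]
    have hst : ∀ m, _ := fun m => C.structC_trans e e' hz m (l 0) (l 1)
    simp only [← hT] at hst
    rw [torsionComp, hΓ, hΓ, hc]
    simp only [hst]
    rw [← Finset.sum_sub_distrib, ← Finset.sum_sub_distrib]
    refine Finset.sum_congr rfl fun m _ => ?_
    have h2 : ∑ a, ∑ b, T a (l 1) * T b (l 0) * C.Γ e' (e.transMap e' z) a m b =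
        ∑ a, ∑ b, T a (l 0) * T b (l 1) * C.Γ e' (e.transMap e' z) b m a := by
      rw [Finset.sum_comm]
      refine Finset.sum_congr rfl fun a _ => Finset.sum_congr rfl fun b _ => ?_
      ring
    have h3 : ∑ a, ∑ b, (T a (l 0) * T b (l 1)) * C.torsionComp e' (e.transMap e' z) m a b =
        ∑ a, ∑ b, T a (l 0) * T b (l 1) * C.Γ e' (e.transMap e' z) a m b -
        ∑ a, ∑ b, T a (l 0) * T b (l 1) * C.Γ e' (e.transMap e' z) b m a -
        ∑ a, ∑ b, T a (l 0) * T b (l 1) * (e'.structC m a b (e.chart.symm z.1) : ℂ) := by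
      simp only [torsionComp, e.symm_transMap e' hz, mul_sub, Finset.sum_sub_distrib]
    have h4 : S (k 0) m * (∑ a, ∑ b, (T a (l 0) * T b (l 1)) *
        C.torsionComp e' (e.transMap e' z) m a b) = ∑ a, ∑ b, S (k 0) m * (T a (l 0) * T b (l 1)) *
        C.torsionComp e' (e.transMap e' z) m a b := by
      simp only [Finset.mul_sum, mul_assoc]
    refine Eq.trans ?_ (h4.trans ?_)
    · rw [h3, h2]
      ring
    · refine Finset.sum_congr rfl fun a _ => Finset.sum_congr rfl fun b _ => ?_
      simp [EquippedChart.trans, torsionLocal, mkIdx, hS, hT]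

variable {C} in
/-- The transformation law of the curvature of a connection. -/
theorem IsConnection.curvMat_eq {n : ℕ}
    {g : EquippedChart 𝓢 → EquippedChart 𝓢 → M → Matrix (Fin n) (Fin n) ℂ}
    {B : EquippedChart 𝓢 → Coord ty → Fin 4 → Matrix (Fin n) (Fin n) ℂ} (h : C.IsConnection g B)
    (e e' : EquippedChart 𝓢) {z : Coord ty} (hz : z ∈ e.overlapDom ty e') (i j : Fin 4) :
    C.curvMat (B e) e z i j = g e e' (e.chart.symm z.1) *
      (∑ a, ∑ b, (e'.tanTrans e (e.chart.symm z.1) a i * e'.tanTrans e (e.chart.symm z.1) b j) •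
        C.curvMat (B e') e' (e.transMap e' z) a b) * g e' e (e.chart.symm z.1) := by
  have hz' := (e.transMap_mem e' hz).1
  have hd := e.differentiableAt_transMap e' hz
  have hev := (e.isOpen_overlapDom e').mem_nhds hz
  set T := e'.tanTrans e (e.chart.symm z.1) with hT
  set p := e.chart.symm z.1 with hp
  -- `K j` is the derivative of the transition functions, `b j` is the connection in the other frame
  let K : Fin 4 → Coord ty → Matrix (Fin n) (Fin n) ℂ := fun j w =>
    derMat (C.H e j w) (fun v => g e' e (e.chart.symm v.1)) w
  let b : Fin 4 → Coord ty → Matrix (Fin n) (Fin n) ℂ := fun j w =>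
    ∑ c, e'.tanTrans e (e.chart.symm w.1) c j • B e' (e.transMap e' w) c
  have hG : MatDiff (fun w : Coord ty => g e e' (e.chart.symm w.1)) z := h.matDiff_left e e' hz
  have hG' : MatDiff (fun w : Coord ty => g e' e (e.chart.symm w.1)) z := h.matDiff_right e e' hz
  have hK : ∀ j, MatDiff (K j) z := fun j a c =>
    (C.contDiffOn_der_H (e.isOpen_overlapDom e') (e.overlapDom_subset e')
      ((h.contDiffOn_right e e' a c).comp contDiff_fst.contDiffOn fun w hw => hw) j).diffAt
      (e.isOpen_overlapDom e') hz
  have hBφ : ∀ c, MatDiff (fun w => B e' (e.transMap e' w) c) z := fun c a d =>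
    (h.matDiff e' hz' c a d).comp z hd
  have hb : ∀ j, MatDiff (b j) z := fun j => MatDiff.sum fun c =>
    MatDiff.smul (differentiableAt_tanTrans e e' hz c j) (hBφ c)
  have hB : ∀ j, B e z j = g e e' p * b j z * g e' e p + g e e' p * K j z := h.law e e' z hz
  have hdB : ∀ i j, derMat (C.H e i z) (fun w => B e w j) z =
      (derMat (C.H e i z) (fun w => g e e' (e.chart.symm w.1)) z * b j z +
        g e e' p * derMat (C.H e i z) (b j) z) * g e' e p + g e e' p * b j z * K i z +
      (derMat (C.H e i z) (fun w => g e e' (e.chart.symm w.1)) z * K j z +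
        g e e' p * derMat (C.H e i z) (K j) z) := by
    intro i j
    have h1 : (fun w => B e w j) =ᶠ[nhds z] fun w => g e e' (e.chart.symm w.1) * b j w *
        g e' e (e.chart.symm w.1) + g e e' (e.chart.symm w.1) * K j w :=
      Filter.mem_of_superset hev fun w hw => h.law e e' w hw j
    rw [derMat_congr h1, derMat_add ((hG.mul (hb j)).mul hG') (hG.mul (hK j)),
      derMat_mul (hG.mul (hb j)) hG', derMat_mul hG (hb j), derMat_mul hG (hK j)]
  have hinv : g e' e p * g e e' p = 1 := h.mul_eq_one e' e p
  -- the derivative of the inverse matrix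
  have hdG : ∀ i, derMat (C.H e i z) (fun w => g e e' (e.chart.symm w.1)) z =
      -(g e e' p * K i z * g e e' p) := by
    intro i
    have h1 := eq_neg_of_add_eq_zero_left (derMat_mul_inverse (Λ := C.H e i z)
      (fun w => h.mul_eq_one e e' (e.chart.symm w.1)) hG hG')
    have h2 := congrArg (fun m => m * g e e' p) h1
    simp only [neg_mul] at h2
    rwa [mul_assoc, hinv, mul_one] at h2
  -- the commutator of `H_i` and `H_j` on functions of `x`
  have hdK : derMat (C.H e i z) (K j) z - derMat (C.H e j z) (K i) z =
      ∑ k, (e.structC k i j p : ℂ) • K k z := by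
    ext a c
    rw [Matrix.sub_apply, Matrix.sum_apply]
    exact C.der_H_commutator_fst e i j (f := fun x => g e' e (e.chart.symm x) a c) hz.1
      ((h.contDiffOn_right e e' a c).contDiffAt ((e.isOpen_overlap e').mem_nhds hz))
  have hdb : ∀ i j, derMat (C.H e i z) (b j) z =
      ∑ c, der (C.H e i z) (fun w => e'.tanTrans e (e.chart.symm w.1) c j) z •
        B e' (e.transMap e' z) c +
      ∑ c, T c j • ∑ d, T d i • derMat (C.H e' d (e.transMap e' z)) (fun w => B e' w c)
        (e.transMap e' z) := by
    intro i j
    ext a d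
    rw [Matrix.add_apply]
    simp only [Matrix.sum_apply, Matrix.smul_apply, smul_eq_mul]
    refine Eq.trans ?_ (C.der_sum_tanTrans_mul e e' hz i j (f := fun c w => B e' w c a d)
      fun c => h.matDiff e' hz' c a d)
    simp only [derMat, b, Matrix.sum_apply, Matrix.smul_apply, smul_eq_mul]
  have hc : ∑ k, (e.structC k i j p : ℂ) • B e z k = g e e' p *
      (∑ k, (e.structC k i j p : ℂ) • b k z) * g e' e p +
        g e e' p * ∑ k, (e.structC k i j p : ℂ) • K k z := by
    simp only [hB, smul_add, Finset.sum_add_distrib, Finset.mul_sum, Finset.sum_mul,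
      mul_smul_comm, smul_mul_assoc]
  rw [curvMat, hdB, hdB, hc, hB i, hB j, curvature_gauge hinv (hdG i) (hdG j) hdK]
  -- it remains to express the curvature of `b` by the curvature in the other chart
  congr 2
  have h1 := sum_smul_antisymm (fun c => T c i) (fun c => T c j) fun d c =>
    derMat (C.H e' d (e.transMap e' z)) (fun w => B e' w c) (e.transMap e' z)
  have h2 : b i z * b j z - b j z * b i z = ∑ a, ∑ c, (T a i * T c j) •
      (B e' (e.transMap e' z) a * B e' (e.transMap e' z) c -
        B e' (e.transMap e' z) c * B e' (e.transMap e' z) a) := by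
    have h3 : ∀ i j, b i z * b j z = ∑ a, ∑ c, (T a i * T c j) •
        (B e' (e.transMap e' z) a * B e' (e.transMap e' z) c) := by
      intro i j
      simp only [b, Finset.sum_mul_sum, smul_mul_smul_comm]
      rfl
    rw [h3, h3, Finset.sum_comm (f := fun a c => (T a j * T c i) • _)]
    simp only [smul_sub, Finset.sum_sub_distrib, mul_comm (T _ j)]
  have h4 : ∑ k, (e.structC k i j p : ℂ) • b k z =
      ∑ m, der (C.H e i z) (fun w => e'.tanTrans e (e.chart.symm w.1) m j) z •
        B e' (e.transMap e' z) m -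
      ∑ m, der (C.H e j z) (fun w => e'.tanTrans e (e.chart.symm w.1) m i) z •
        B e' (e.transMap e' z) m +
      ∑ a, ∑ c, (T a i * T c j) • ∑ m, (e'.structC m a c p : ℂ) • B e' (e.transMap e' z) m := by
    have h5 : ∑ k, (e.structC k i j p : ℂ) • b k z =
        ∑ m, (∑ k, (e.structC k i j p : ℂ) * T m k) • B e' (e.transMap e' z) m := by
      simp only [b, Finset.smul_sum, Finset.sum_smul, smul_smul]
      exact Finset.sum_comm
    have h6 : ∑ m, (∑ a, ∑ c, T a i * T c j * (e'.structC m a c p : ℂ)) •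
        B e' (e.transMap e' z) m = ∑ a, ∑ c, (T a i * T c j) •
          ∑ m, (e'.structC m a c p : ℂ) • B e' (e.transMap e' z) m := by
      simp only [Finset.smul_sum, Finset.sum_smul, smul_smul]
      exact sum_swap_triple _
    rw [h5, ← h6, ← Finset.sum_sub_distrib, ← Finset.sum_add_distrib]
    refine Finset.sum_congr rfl fun m _ => ?_
    rw [hT, hp, C.structC_trans e e' hz m i j, add_smul, sub_smul]
  simp only [curvMat, e.symm_transMap e' hz, smul_sub, smul_add, Finset.sum_sub_distrib,
    Finset.sum_add_distrib] at h1 h2 ⊢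
  rw [h4, hdb, hdb, h2, ← hp]
  rw [sub_eq_iff_eq_add] at h1
  rw [h1]
  abel

theorem mul_sum_sum_smul_mul_apply {n : ℕ} (g g' : Matrix (Fin n) (Fin n) ℂ) (x y : Fin 4 → ℂ)
    (R : Fin 4 → Fin 4 → Matrix (Fin n) (Fin n) ℂ) (p q : Fin n) :
    (g * (∑ a, ∑ b, (x a * y b) • R a b) * g') p q =
      ∑ u, ∑ v, ∑ a, ∑ b, g p u * g' v q * (x a * y b) * R a b u v := by
  simp only [Matrix.mul_apply, Finset.sum_mul]
  rw [Finset.sum_comm]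
  refine Finset.sum_congr rfl fun u _ => Finset.sum_congr rfl fun v _ => ?_
  simp only [Matrix.sum_apply, Matrix.smul_apply, smul_eq_mul, Finset.mul_sum, Finset.sum_mul]
  refine Finset.sum_congr rfl fun a _ => Finset.sum_congr rfl fun b _ => ?_
  ring

theorem curvS_isTensorial : IsTensorial C.curvSLocal :=
  isTensorial_of_transMap fun e e' z hz => by
    refine idx_ext fun i j i' j' k l => ?_
    refine (C.curvComp_eq (C.A e) e z (i 0) (j 0) (l 0) (l 1)).trans ?_
    rw [C.isConnection_A.curvMat_eq e e' hz, mul_sum_sum_smul_mul_apply, tAct_mkIdx]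
    simp only [sum_fun_succ, sum_fun_zero]
    refine Finset.sum_congr rfl fun u _ => Finset.sum_congr rfl fun v _ => Finset.sum_congr rfl
      fun a _ => Finset.sum_congr rfl fun b _ => ?_
    simp [EquippedChart.trans, curvSLocal, mkIdx, curvComp_eq]

theorem curvS'_isTensorial : IsTensorial C.curvS'Local :=
  isTensorial_of_transMap fun e e' z hz => by
    refine idx_ext fun i j i' j' k l => ?_
    refine (C.curvComp_eq (C.A' e) e z (i' 0) (j' 0) (l 0) (l 1)).trans ?_
    rw [C.isConnection_A'.curvMat_eq e e' hz, mul_sum_sum_smul_mul_apply, tAct_mkIdx]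
    simp only [sum_fun_succ, sum_fun_zero]
    refine Finset.sum_congr rfl fun u _ => Finset.sum_congr rfl fun v _ => Finset.sum_congr rfl
      fun a _ => Finset.sum_congr rfl fun b _ => ?_
    simp [EquippedChart.trans, curvS'Local, mkIdx, curvComp_eq]

theorem curvR_isTensorial : IsTensorial C.curvRLocal :=
  isTensorial_of_transMap fun e e' z hz => by
    refine idx_ext fun i j i' j' k l => ?_
    refine (C.curvComp_eq (C.Γ e) e z (k 0) (l 0) (l 1) (l 2)).trans ?_
    rw [C.isConnection_Γ.curvMat_eq e e' hz, mul_sum_sum_smul_mul_apply, tAct_mkIdx]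
    simp only [sum_fun_succ, sum_fun_zero]
    refine Finset.sum_congr rfl fun u _ => Finset.sum_congr rfl fun v _ => Finset.sum_congr rfl
      fun a _ => Finset.sum_congr rfl fun b _ => ?_
    simp [EquippedChart.trans, curvRLocal, mkIdx, curvComp_eq, Fin.prod_univ_three, mul_assoc]

theorem torsion_isRep : IsRep C.torsionLocal C.torsion := C.torsion_isTensorial.isRep

theorem curvS_isRep : IsRep C.curvSLocal C.curvS := C.curvS_isTensorial.isRep

theorem curvS'_isRep : IsRep C.curvS'Local C.curvS' := C.curvS'_isTensorial.isRep

theorem curvR_isRep : IsRep C.curvRLocal C.curvR := C.curvR_isTensorial.isRep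

end SpinorConnection

end CurvatureLaw

/-! ### Smoothness of torsion, curvature and covariant derivatives -/

section Main

theorem lAct_add_right (g : KindMat) (X Y : Idx t → ℂ) :
    lAct g (X + Y) = lAct g X + lAct g Y := by
  funext a
  simp [lAct, mul_add, Finset.sum_add_distrib]

theorem lAct_smul_right (g : KindMat) (c : ℂ) (X : Idx t → ℂ) :
    lAct g (c • X) = c • lAct g X := by
  funext a
  simp [lAct, Finset.mul_sum, mul_left_comm]

theorem lAct_sum_smul_right {κ : Type*} [Fintype κ] (g : KindMat) (c : κ → ℂ) (X : κ → Idx t → ℂ) :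
    lAct g (∑ i, c i • X i) = ∑ i, c i • lAct g (X i) := by
  simp only [← lAct_smul_right]
  exact map_sum (AddMonoidHom.mk' (lAct g) (lAct_add_right g)) _ _

theorem IsRep.smooth {F : EquippedChart 𝓢 → Coord ty → Idx t → ℂ} {X : ExtField S ty t}
    (h : IsRep F X) (hF : ∀ e a, ContDiffOn ℝ ∞ (fun z => F e z a) (e.dom ty)) : X.Smooth 𝓢 :=
  fun e => (contDiffOn_pi.2 fun a => hF e a).congr fun z hz => h e z hz

theorem contDiffOn_rep {X : ExtField S ty t} (hX : X.Smooth 𝓢) (e : EquippedChart 𝓢) (a : Idx t) :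
    ContDiffOn ℝ ∞ (fun z => X.rep e z a) (e.dom ty) :=
  contDiffOn_pi.1 (hX e) a

theorem ExtField.rep_add (X Y : ExtField S ty t) (e : EquippedChart 𝓢) (z : Coord ty) :
    ExtField.rep (X + Y) e z = X.rep e z + Y.rep e z :=
  map_add (e.basis t (e.point z).1).equivFun _ _

theorem ExtField.rep_sub (X Y : ExtField S ty t) (e : EquippedChart 𝓢) (z : Coord ty) :
    ExtField.rep (X - Y) e z = X.rep e z - Y.rep e z :=
  map_sub (e.basis t (e.point z).1).equivFun _ _

theorem ExtField.rep_neg (X : ExtField S ty t) (e : EquippedChart 𝓢) (z : Coord ty) :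
    ExtField.rep (-X) e z = -X.rep e z :=
  map_neg (e.basis t (e.point z).1).equivFun _

theorem ExtField.rep_sum {κ : Type*} (u : Finset κ) (X : κ → ExtField S ty t)
    (e : EquippedChart 𝓢) (z : Coord ty) :
    ExtField.rep (∑ i ∈ u, X i) e z = ∑ i ∈ u, (X i).rep e z := by
  show (e.basis t (e.point z).1).equivFun ((∑ i ∈ u, X i) (e.point z)) = _
  rw [Finset.sum_apply, map_sum]
  rfl

theorem rep_nativeField (P : Fin J) (e : EquippedChart 𝓢) (z : Coord ty) :
    (nativeField P : ExtField S ty (ty P)).rep e z = z.2 P :=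
  LinearEquiv.apply_symm_apply _ _

/-- Fields defined by their components vanish at the points which belong to no equipped chart. -/
theorem ofLocal_eq_zero (F : EquippedChart 𝓢 → Coord ty → Idx t → ℂ) {q : Composite S ty}
    (h : ¬∃ e : EquippedChart 𝓢, q.1 ∈ e.chart.source) : ofLocal F q = 0 := by
  rw [ofLocal, dif_neg h]

/-- Fields are equal if their components in all equipped charts are equal and they agree at the
points which belong to no equipped chart. -/
theorem ext_of_rep {X Y : ExtField S ty t}
    (h : ∀ (e : EquippedChart 𝓢) (z : Coord ty), z ∈ e.dom ty → X.rep e z = Y.rep e z)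
    (h0 : ∀ q : Composite S ty, (¬∃ e : EquippedChart 𝓢, q.1 ∈ e.chart.source) → X q = Y q) :
    X = Y := by
  funext q
  by_cases hq : ∃ e : EquippedChart 𝓢, q.1 ∈ e.chart.source
  · obtain ⟨e, he⟩ := hq
    have h1 := h e (e.coord q) (e.coord_mem he)
    rw [rep_coord X e he, rep_coord Y e he] at h1
    exact (e.basis t q.1).equivFun.injective h1
  · exact h0 q hq

namespace SpinorConnection

variable (C : SpinorConnection 𝓢 ty)

theorem contDiffOn_structC_fst (e : EquippedChart 𝓢) (k i j : Fin 4) :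
    ContDiffOn ℝ ∞ (fun z : Coord ty => (e.structC k i j (e.chart.symm z.1) : ℂ)) (e.dom ty) :=
  (e.contDiffOn_structC k i j).comp contDiff_fst.contDiffOn fun _ hz => hz

theorem torsion_smooth : C.torsion.Smooth 𝓢 :=
  C.torsion_isRep.smooth fun e _ =>
    ((C.Γ_smooth e _ _ _).sub (C.Γ_smooth e _ _ _)).sub (contDiffOn_structC_fst e _ _ _)

variable {C} in
theorem IsConnection.contDiffOn_curvComp {n : ℕ}
    {g : EquippedChart 𝓢 → EquippedChart 𝓢 → M → Matrix (Fin n) (Fin n) ℂ}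
    {B : EquippedChart 𝓢 → Coord ty → Fin 4 → Matrix (Fin n) (Fin n) ℂ} (h : C.IsConnection g B)
    (e : EquippedChart 𝓢) (p q : Fin n) (i j : Fin 4) :
    ContDiffOn ℝ ∞ (fun z => C.curvComp (B e) e z p q i j) (e.dom ty) := by
  have hB := h.contDiffOn e
  have hH : ∀ i j, ContDiffOn ℝ ∞ (fun z => der (C.H e i z) (fun w => B e w j p q) z) (e.dom ty) :=
    fun i j => C.contDiffOn_der_H e.isOpen_dom subset_rfl (hB j p q) i
  simp only [curvComp_eq, curvMat, Matrix.sub_apply, Matrix.add_apply, Matrix.sum_apply,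
    Matrix.mul_apply, Matrix.smul_apply, smul_eq_mul, derMat]
  exact (((hH i j).sub (hH j i)).add ((contDiffOn_sum_const_mul (fun _ => hB i p _)
    fun _ => hB j _ q).sub (contDiffOn_sum_const_mul (fun _ => hB j p _) fun _ => hB i _ q))).sub
      (contDiffOn_sum_const_mul (fun _ => contDiffOn_structC_fst e _ i j) fun _ => hB _ p q)

theorem curvS_smooth : C.curvS.Smooth 𝓢 :=
  C.curvS_isRep.smooth fun e _ => C.isConnection_A.contDiffOn_curvComp e _ _ _ _

theorem curvS'_smooth : C.curvS'.Smooth 𝓢 :=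
  C.curvS'_isRep.smooth fun e _ => C.isConnection_A'.contDiffOn_curvComp e _ _ _ _

theorem curvR_smooth : C.curvR.Smooth 𝓢 :=
  C.curvR_isRep.smooth fun e _ => C.isConnection_Γ.contDiffOn_curvComp e _ _ _ _

theorem nabla_isRep (X : ExtField S ty tyVector) {Z : ExtField S ty t} (hZ : Z.Smooth 𝓢) :
    IsRep (C.nablaLocal X Z) (C.nabla X Z) :=
  (C.nabla_isTensorial X hZ).isRep

theorem nabla_smooth {X : ExtField S ty tyVector} (hX : X.Smooth 𝓢) {Z : ExtField S ty t}
    (hZ : Z.Smooth 𝓢) : (C.nabla X Z).Smooth 𝓢 :=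
  (C.nabla_isRep X hZ).smooth fun e a => contDiffOn_sum_const_mul
    (fun _ => contDiffOn_rep hX e _) fun j => C.contDiffOn_nablaComp (contDiffOn_rep hZ e) j a

/-! ### The commutator of spatial covariant differentiations -/

theorem nablaComp_congr {e : EquippedChart 𝓢} {j : Fin 4} {Z Z' : Coord ty → Idx t → ℂ}
    {z : Coord ty} (h : Z =ᶠ[nhds z] Z') : C.nablaComp e j Z z = C.nablaComp e j Z' z := by
  rw [nablaComp_eq, nablaComp_eq, derComp_congr h, h.self_of_nhds]

/-- The Leibniz rule for covariant derivatives. -/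
theorem nablaComp_sum_smul (e : EquippedChart 𝓢) (i : Fin 4) {z : Coord ty}
    {y : Fin 4 → Coord ty → ℂ} {N : Fin 4 → Coord ty → Idx t → ℂ}
    (hy : ∀ j, DifferentiableAt ℝ (y j) z)
    (hN : ∀ j a, DifferentiableAt ℝ (fun w => N j w a) z) :
    C.nablaComp e i (fun w => ∑ j, y j w • N j w) z =
      ∑ j, der (C.H e i z) (y j) z • N j z + ∑ j, y j z • C.nablaComp e i (N j) z := by
  simp only [nablaComp_eq, lAct_sum_smul_right, smul_add, Finset.sum_add_distrib, ← add_assoc]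
  congr 1
  funext a
  rw [← Finset.sum_add_distrib]
  simp only [derComp, Finset.sum_apply, Pi.smul_apply, smul_eq_mul, Pi.add_apply]
  rw [der_sum fun j _ => (hy j).fun_mul (hN j a)]
  exact Finset.sum_congr rfl fun j _ => der_mul (hy j) (hN j a)

/-- The Ricci identity in an equipped chart. The mixed terms, with a derivative of `Z` and an action
of the connection, cancel. -/
theorem nablaComp_commutator (e : EquippedChart 𝓢) (i j : Fin 4) {z : Coord ty}
    (hz : z ∈ e.dom ty) {Z : Coord ty → Idx t → ℂ}
    (hZ : ∀ a, ContDiffOn ℝ ∞ (fun w => Z w a) (e.dom ty)) :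
    C.nablaComp e i (C.nablaComp e j Z) z - C.nablaComp e j (C.nablaComp e i Z) z =
      ∑ k, (e.structC k i j (e.chart.symm z.1) : ℂ) • C.nablaComp e k Z z +
        derComp (vec (C.vcoef e i j z)) Z z + lAct (C.curvKind e z i j) (Z z) := by
  have hZd : ∀ a, DifferentiableAt ℝ (fun w => Z w a) z := fun a => (hZ a).diffAt e.isOpen_dom hz
  have hH : ∀ j a, DifferentiableAt ℝ (fun w => derComp (C.H e j w) Z w a) z := fun j a =>
    (C.contDiffOn_der_H e.isOpen_dom subset_rfl (hZ a) j).diffAt e.isOpen_dom hz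
  have h1 : ∀ i j, C.nablaComp e i (C.nablaComp e j Z) z =
      derComp (C.H e i z) (fun w => derComp (C.H e j w) Z w) z +
      (lAct (derKind (C.H e i z) (C.conn e j) z) (Z z) +
        lAct (C.conn e j z) (derComp (C.H e i z) Z z)) +
      (lAct (C.conn e i z) (derComp (C.H e j z) Z z) +
        lAct (C.conn e i z) (lAct (C.conn e j z) (Z z))) := by
    intro i j
    have h2 : C.nablaComp e j Z = fun w => derComp (C.H e j w) Z w + lAct (C.conn e j w) (Z w) :=
      funext fun w => C.nablaComp_eq e j Z w
    rw [C.nablaComp_eq e i, ← derComp_lAct (C.matDiff_conn e j hz) hZd, C.nablaComp_eq e j]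
    congr 1
    · rw [h2]
      funext a
      exact der_add (hH j a) (differentiableAt_lAct (C.matDiff_conn e j hz) hZd a)
    · exact lAct_add_right _ _ _
  have h3 : derComp (C.H e i z) (fun w => derComp (C.H e j w) Z w) z -
      derComp (C.H e j z) (fun w => derComp (C.H e i w) Z w) z =
      ∑ k, (e.structC k i j (e.chart.symm z.1) : ℂ) • derComp (C.H e k z) Z z +
        derComp (vec (C.vcoef e i j z)) Z z := by
    funext a
    rw [Pi.add_apply, Finset.sum_apply]
    exact C.der_H_commutator e i j hz ((hZ a).contDiffAt (e.isOpen_dom.mem_nhds hz))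
  have h4 := congrArg (fun g => lAct g (Z z)) (C.curvKind_eq e z i j)
  rw [lAct_add_left, lAct_sub_left, lAct_commutator, lAct_add_left, lAct_sum_left] at h4
  simp only [lAct_smul_left] at h4
  simp only [h1, C.nablaComp_eq e _ Z z, smul_add, Finset.sum_add_distrib]
  linear_combination h3 + h4

/-- Repeated covariant differentiation in components. -/
theorem nabla_nabla_rep {X Y : ExtField S ty tyVector} (hY : Y.Smooth 𝓢) {Z : ExtField S ty t}
    (hZ : Z.Smooth 𝓢) (e : EquippedChart 𝓢) {z : Coord ty} (hz : z ∈ e.dom ty) :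
    (C.nabla X (C.nabla Y Z)).rep e z =
      ∑ i, vecComp (X.rep e z) i • (∑ j, der (C.H e i z) (fun w => vecComp (Y.rep e w) j) z •
        C.nablaComp e j (Z.rep e) z + ∑ j, vecComp (Y.rep e z) j •
          C.nablaComp e i (C.nablaComp e j (Z.rep e)) z) := by
  have h1 : (C.nabla Y Z).rep e =ᶠ[nhds z] fun w =>
      ∑ j, vecComp (Y.rep e w) j • C.nablaComp e j (Z.rep e) w :=
    Filter.mem_of_superset (e.isOpen_dom.mem_nhds hz) fun w hw => by
      show (C.nabla Y Z).rep e w = _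
      rw [C.nabla_isRep Y hZ e w hw]
      funext a
      simp [nablaLocal]
  rw [C.nabla_isRep X (C.nabla_smooth hY hZ) e z hz]
  have h2 : ∀ i, C.nablaComp e i ((C.nabla Y Z).rep e) z = _ := fun i =>
    (C.nablaComp_congr h1).trans (C.nablaComp_sum_smul e i
      (fun j => (contDiffOn_rep hY e _).diffAt e.isOpen_dom hz)
      fun j a => (C.contDiffOn_nablaComp (contDiffOn_rep hZ e) j a).diffAt e.isOpen_dom hz)
  funext a
  simp only [nablaLocal, h2, Finset.sum_apply, Pi.smul_apply, smul_eq_mul]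

/-- The action by the Leibniz rule on vectors is the product of a matrix and a column. -/
theorem vecComp_lAct (g : KindMat) (X : Idx tyVector → ℂ) (k : Fin 4) :
    vecComp (lAct g X) k = ∑ v : Fin 4, g .vector k v * vecComp X v := by
  simp only [vecComp, lAct]
  rw [Finset.sum_eq_single Kind.vector]
  · refine (Fin.sum_univ_one _).trans (Finset.sum_congr rfl fun v _ => ?_)
    congr 2
    funext κ
    cases κ
    case vector =>
      funext μ
      obtain rfl : μ = (0 : Fin 1) := Subsingleton.elim (α := Fin 1) _ _
      simp only [replaceIdx, Function.update_self]
      exact Function.update_self (0 : Fin 1) _ _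
    all_goals rfl
  · intro κ _ hκ
    cases κ
    case vector => exact absurd rfl hκ
    all_goals exact Fintype.sum_empty (ι := Fin 0) _
  · simp

/-- The components of `∇_X Y - ∇_Y X - T(X, Y)`: the terms with the connection cancel. -/
theorem vecComp_torsion_rep {X Y : ExtField S ty tyVector} (hX : X.Smooth 𝓢) (hY : Y.Smooth 𝓢)
    (e : EquippedChart 𝓢) {z : Coord ty} (hz : z ∈ e.dom ty) (k : Fin 4) :
    vecComp (ExtField.rep (C.nabla X Y - C.nabla Y X - evalTorsion 𝓢 C.torsion X Y) e z) k =
      ∑ j, vecComp (X.rep e z) j * der (C.H e j z) (fun w => vecComp (Y.rep e w) k) z -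
      ∑ j, vecComp (Y.rep e z) j * der (C.H e j z) (fun w => vecComp (X.rep e w) k) z +
      ∑ i, ∑ j, (e.structC k i j (e.chart.symm z.1) : ℂ) * vecComp (X.rep e z) i *
        vecComp (Y.rep e z) j := by
  have h1 : ∀ X Y : ExtField S ty tyVector, Y.Smooth 𝓢 → vecComp ((C.nabla X Y).rep e z) k =
      ∑ j, vecComp (X.rep e z) j * der (C.H e j z) (fun w => vecComp (Y.rep e w) k) z +
      ∑ i, ∑ j, C.Γ e z i k j * vecComp (X.rep e z) i * vecComp (Y.rep e z) j := by
    intro X Y hY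
    rw [C.nabla_isRep X hY e z hz, ← Finset.sum_add_distrib]
    show ∑ i, vecComp (X.rep e z) i * vecComp (C.nablaComp e i (Y.rep e) z) k = _
    refine Finset.sum_congr rfl fun i _ => ?_
    have h2 : vecComp (lAct (C.conn e i z) (Y.rep e z)) k =
        ∑ v : Fin 4, C.Γ e z i k v * vecComp (Y.rep e z) v := vecComp_lAct _ _ _
    have h3 : ∀ x y : Idx tyVector → ℂ, vecComp (x + y) k = vecComp x k + vecComp y k :=
      fun _ _ => rfl
    rw [C.nablaComp_eq, h3, mul_add]
    congr 1
    refine (congrArg (fun x => vecComp (X.rep e z) i * x) h2).trans ?_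
    rw [Finset.mul_sum]
    exact Finset.sum_congr rfl fun j _ => by ring
  have h3 : vecComp ((evalTorsion 𝓢 C.torsion X Y).rep e z) k =
      ∑ i, ∑ j, (C.Γ e z i k j - C.Γ e z j k i - (e.structC k i j (e.chart.symm z.1) : ℂ)) *
        vecComp (X.rep e z) i * vecComp (Y.rep e z) j := by
    rw [evalTorsion_isRep C.torsion X Y e z hz]
    show ∑ i, ∑ j, C.torsion.rep e z (mkIdx ![] ![] ![] ![] ![k] ![i, j]) *
      vecComp (X.rep e z) i * vecComp (Y.rep e z) j = _
    refine Finset.sum_congr rfl fun i _ => Finset.sum_congr rfl fun j _ => ?_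
    rw [C.torsion_isRep e z hz]
    rfl
  have h4 : ∑ i, ∑ j, C.Γ e z i k j * vecComp (Y.rep e z) i * vecComp (X.rep e z) j =
      ∑ i, ∑ j, C.Γ e z j k i * vecComp (X.rep e z) i * vecComp (Y.rep e z) j := by
    rw [Finset.sum_comm]
    exact Finset.sum_congr rfl fun i _ => Finset.sum_congr rfl fun j _ => by ring
  have h5 : ∀ (x y : Idx tyVector → ℂ), vecComp (x - y) k = vecComp x k - vecComp y k :=
    fun _ _ => rfl
  rw [ExtField.rep_sub, ExtField.rep_sub, h5, h5, h1 X Y hY, h1 Y X hX, h3, h4]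
  simp only [sub_mul, Finset.sum_sub_distrib]
  ring

/-- The matrices of the degenerate differentiation in the commutation relationship. -/
theorem kindMatrix_curv_rep (X Y : ExtField S ty tyVector) (e : EquippedChart 𝓢) {z : Coord ty}
    (hz : z ∈ e.dom ty) :
    kindMatrix (spinOpMatrix ((evalS 𝓢 C.curvS X Y).rep e z))
      (barOpMatrix ((evalS' 𝓢 C.curvS' X Y).rep e z))
      (vecOpMatrix ((evalR 𝓢 C.curvR X Y).rep e z)) =
    ∑ i, ∑ j, (vecComp (X.rep e z) i * vecComp (Y.rep e z) j) • C.curvKind e z i j := by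
  have h1 : spinOpMatrix ((evalS 𝓢 C.curvS X Y).rep e z) =
      ∑ i, ∑ j, (vecComp (X.rep e z) i * vecComp (Y.rep e z) j) •
        C.curvMat (C.A e) e z i j := by
    rw [evalS_isRep C.curvS X Y e z hz]
    ext p q
    simp only [Matrix.sum_apply, Matrix.smul_apply, smul_eq_mul, ← curvComp_eq]
    show ∑ i, ∑ j, C.curvS.rep e z (mkIdx ![p] ![q] ![] ![] ![] ![i, j]) *
      vecComp (X.rep e z) i * vecComp (Y.rep e z) j = _
    refine Finset.sum_congr rfl fun i _ => Finset.sum_congr rfl fun j _ => ?_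
    rw [C.curvS_isRep e z hz, mul_assoc, mul_comm]
    rfl
  have h2 : barOpMatrix ((evalS' 𝓢 C.curvS' X Y).rep e z) =
      ∑ i, ∑ j, (vecComp (X.rep e z) i * vecComp (Y.rep e z) j) •
        C.curvMat (C.A' e) e z i j := by
    rw [evalS'_isRep C.curvS' X Y e z hz]
    ext p q
    simp only [Matrix.sum_apply, Matrix.smul_apply, smul_eq_mul, ← curvComp_eq]
    show ∑ i, ∑ j, C.curvS'.rep e z (mkIdx ![] ![] ![p] ![q] ![] ![i, j]) *
      vecComp (X.rep e z) i * vecComp (Y.rep e z) j = _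
    refine Finset.sum_congr rfl fun i _ => Finset.sum_congr rfl fun j _ => ?_
    rw [C.curvS'_isRep e z hz, mul_assoc, mul_comm]
    rfl
  have h3 : vecOpMatrix ((evalR 𝓢 C.curvR X Y).rep e z) =
      ∑ i, ∑ j, (vecComp (X.rep e z) i * vecComp (Y.rep e z) j) •
        C.curvMat (C.Γ e) e z i j := by
    rw [evalR_isRep C.curvR X Y e z hz]
    ext p q
    simp only [Matrix.sum_apply, Matrix.smul_apply, smul_eq_mul, ← curvComp_eq]
    show ∑ i, ∑ j, C.curvR.rep e z (mkIdx ![] ![] ![] ![] ![p] ![q, i, j]) *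
      vecComp (X.rep e z) i * vecComp (Y.rep e z) j = _
    refine Finset.sum_congr rfl fun i _ => Finset.sum_congr rfl fun j _ => ?_
    rw [C.curvR_isRep e z hz, mul_assoc, mul_comm]
    rfl
  have h4 : ∀ {n : ℕ} (c : Fin 4 → Fin 4 → ℂ) (m : Fin 4 → Fin 4 → Matrix (Fin n) (Fin n) ℂ),
      -(∑ i, ∑ j, c i j • m i j).transpose = ∑ i, ∑ j, c i j • -(m i j).transpose := by
    intro n c m
    simp only [Matrix.transpose_sum, Matrix.transpose_smul, smul_neg, Finset.sum_neg_distrib]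
  rw [h1, h2, h3]
  funext k
  simp only [Finset.sum_apply, Pi.smul_apply]
  cases k
  · rfl
  · exact h4 _ _
  · rfl
  · exact h4 _ _
  · rfl
  · exact h4 _ _

/-- The vertical vector field given by the action of a combination of the curvature matrices. -/
theorem vec_vertical_curvKind (e : EquippedChart 𝓢) (z : Coord ty) (c : Fin 4 → Fin 4 → ℂ) :
    vec (vertical (fun P => -lAct (∑ i, ∑ j, c i j • C.curvKind e z i j) (z.2 P))
      fun P => -lAct (∑ i, ∑ j, c i j • C.curvKind e z i j) (tauComp (z.2 P))) =
      ∑ i, ∑ j, c i j • vec (C.vcoef e i j z) := by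
  refine vec_ext fun α => ?_
  simp only [LinearMap.sum_apply, LinearMap.smul_apply, vec_coordL, smul_eq_mul]
  rcases α with k | ⟨P, b⟩ | ⟨P, b⟩
  · simp [vertical, vcoef]
  · simp [vertical, vcoef, lAct_sum_left, lAct_smul_left]
  · simp [vertical, vcoef, lAct_sum_left, lAct_smul_left]

/-- The commutator of two differentiations along `x` and `y` whose components `N j` have the second
derivatives `D i j`. -/
theorem sum_commutator {V : Type*} [AddCommGroup V] [Module ℂ V] {n : ℕ} {x y : Fin n → ℂ}
    (dX dY : Fin n → Fin n → ℂ) {c : Fin n → Fin n → Fin n → ℂ} {N : Fin n → V}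
    {D E : Fin n → Fin n → V} (hD : ∀ i j, D i j - D j i = ∑ k, c k i j • N k + E i j) :
    ∑ i, x i • (∑ j, dY i j • N j + ∑ j, y j • D i j) -
      ∑ i, y i • (∑ j, dX i j • N j + ∑ j, x j • D i j) =
    ∑ k, (∑ j, x j * dY j k - ∑ j, y j * dX j k + ∑ i, ∑ j, c k i j * x i * y j) • N k +
      ∑ i, ∑ j, (x i * y j) • E i j := by
  have h1 : ∀ (x : Fin n → ℂ) (dY : Fin n → Fin n → ℂ),
      ∑ i, x i • ∑ j, dY i j • N j = ∑ k, (∑ j, x j * dY j k) • N k := by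
    intro x dY
    simp only [Finset.smul_sum, Finset.sum_smul, smul_smul]
    exact Finset.sum_comm
  have h2 := sum_smul_antisymm x y D
  rw [Finset.sum_congr rfl fun c _ => Finset.smul_sum (s := Finset.univ) (r := y c),
    Finset.sum_comm,
    Finset.sum_congr rfl fun c _ => Finset.smul_sum (s := Finset.univ) (r := x c),
    Finset.sum_comm (f := fun c d => x c • y d • D d c)] at h2
  have h3 : ∑ i, x i • ∑ j, y j • D i j = ∑ d, ∑ c, y c • x d • D d c := by
    simp only [Finset.smul_sum, smul_comm (x _)]
  have h4 : ∑ i, y i • ∑ j, x j • D i j = ∑ d, ∑ c, x c • y d • D d c := by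
    simp only [Finset.smul_sum, smul_comm (y _)]
  have h5 : ∑ i, ∑ j, (x i * y j) • ∑ k, c k i j • N k =
      ∑ k, (∑ i, ∑ j, c k i j * x i * y j) • N k := by
    simp only [Finset.smul_sum, Finset.sum_smul, smul_smul]
    rw [← sum_swap_triple]
    refine Finset.sum_congr rfl fun k _ => Finset.sum_congr rfl fun i _ =>
      Finset.sum_congr rfl fun j _ => ?_
    congr 1
    ring
  simp only [hD, smul_add, Finset.sum_add_distrib, h5] at h2
  simp only [smul_add, Finset.sum_add_distrib, add_smul, sub_smul, Finset.sum_sub_distrib, h1, h3,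
    h4]
  rw [sub_eq_iff_eq_add] at h2
  rw [h2]
  abel

theorem commutation_relationship {X Y : ExtField S ty tyVector} (hX : X.Smooth 𝓢)
    (hY : Y.Smooth 𝓢) {Z : ExtField S ty t} (hZ : Z.Smooth 𝓢) :
    C.nabla X (C.nabla Y Z) - C.nabla Y (C.nabla X Z) =
      C.nabla (C.nabla X Y - C.nabla Y X - evalTorsion 𝓢 C.torsion X Y) Z
      + ∑ Q : Fin J, vert 𝓢 Q (-deg 𝓢 (evalS 𝓢 C.curvS X Y) (evalS' 𝓢 C.curvS' X Y)
          (evalR 𝓢 C.curvR X Y) (nativeField Q)) Z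
      + ∑ Q : Fin J, vertBar 𝓢 Q (-deg 𝓢 (evalS 𝓢 C.curvS X Y) (evalS' 𝓢 C.curvS' X Y)
          (evalR 𝓢 C.curvR X Y) (tau 𝓢 (nativeField Q))) Z
      + deg 𝓢 (evalS 𝓢 C.curvS X Y) (evalS' 𝓢 C.curvS' X Y) (evalR 𝓢 C.curvR X Y) Z := by
  refine ext_of_rep (𝓢 := 𝓢) (fun e z hz => ?_) fun q hq => ?_
  · set 𝔑 := evalS 𝓢 C.curvS X Y
    set 𝔑' := evalS' 𝓢 C.curvS' X Y
    set N := evalR 𝓢 C.curvR X Y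
    set x := fun i => vecComp (X.rep e z) i with hx
    set y := fun i => vecComp (Y.rep e z) i with hy
    have hdeg : ∀ {t : SType} (W : ExtField S ty t), (deg 𝓢 𝔑 𝔑' N W).rep e z =
        lAct (∑ i, ∑ j, (x i * y j) • C.curvKind e z i j) (W.rep e z) := by
      intro t W
      rw [deg_isRep 𝔑 𝔑' N W e z hz, degLocal, degComp_eq_lAct,
        C.kindMatrix_curv_rep X Y e hz]
    -- the native differentiations combine to the vertical part of `[H_i, H_j]`
    have hvert : ∑ Q : Fin J, (vert 𝓢 Q (-deg 𝓢 𝔑 𝔑' N (nativeField Q)) Z).rep e z +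
        ∑ Q : Fin J, (vertBar 𝓢 Q (-deg 𝓢 𝔑 𝔑' N (tau 𝓢 (nativeField Q))) Z).rep e z =
        ∑ i, ∑ j, (x i * y j) • derComp (vec (C.vcoef e i j z)) (Z.rep e) z := by
      have h1 : ∀ Q : Fin J, (vert 𝓢 Q (-deg 𝓢 𝔑 𝔑' N (nativeField Q)) Z).rep e z = fun a =>
          ∑ b, (-lAct (∑ i, ∑ j, (x i * y j) • C.curvKind e z i j) (z.2 Q)) b *
            dS Q b (fun w => Z.rep e w a) z := by
        intro Q
        rw [vert_isRep Q (-deg 𝓢 𝔑 𝔑' N (nativeField Q)) hZ e z hz]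
        unfold vertLocal
        rw [ExtField.rep_neg, hdeg, rep_nativeField]
      have h2 : ∀ Q : Fin J,
          (vertBar 𝓢 Q (-deg 𝓢 𝔑 𝔑' N (tau 𝓢 (nativeField Q))) Z).rep e z = fun a =>
          ∑ b, (-lAct (∑ i, ∑ j, (x i * y j) • C.curvKind e z i j) (tauComp (z.2 Q))) b *
            dSbar Q (swapIdx b) (fun w => Z.rep e w a) z := by
        intro Q
        rw [vertBar_isRep Q (-deg 𝓢 𝔑 𝔑' N (tau 𝓢 (nativeField Q))) hZ e z hz]
        unfold vertBarLocal
        rw [ExtField.rep_neg, hdeg, tau_isRep (nativeField Q) e z hz, tauLocal, rep_nativeField]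
      have h3 := congrArg (fun Λ => derComp Λ (Z.rep e) z)
        (C.vec_vertical_curvKind e z fun i j => x i * y j)
      have h4 : ∀ Λ : Fin 4 → Fin 4 → (Coord ty →L[ℝ] ℂ) →ₗ[ℂ] ℂ,
          derComp (∑ i, ∑ j, (x i * y j) • Λ i j) (Z.rep e) z =
            ∑ i, ∑ j, (x i * y j) • derComp (Λ i j) (Z.rep e) z := by
        intro Λ
        funext a
        simp [derComp, der_sum_left, der_smul_left]
      rw [← h4, ← C.vec_vertical_curvKind e z fun i j => x i * y j]
      funext a
      simp only [h1, h2, Pi.add_apply, Finset.sum_apply]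
      rw [derComp, der_vertical]
    rw [ExtField.rep_add, ExtField.rep_add, ExtField.rep_add, ExtField.rep_sub, ExtField.rep_sum,
      ExtField.rep_sum, hdeg, add_assoc (ExtField.rep (C.nabla _ Z) e z), hvert,
      C.nabla_nabla_rep hY hZ e hz, C.nabla_nabla_rep hX hZ e hz, C.nabla_isRep _ hZ e z hz]
    have hU : C.nablaLocal (C.nabla X Y - C.nabla Y X - evalTorsion 𝓢 C.torsion X Y) Z e z =
        ∑ k, (∑ j, x j * der (C.H e j z) (fun w => vecComp (Y.rep e w) k) z -
          ∑ j, y j * der (C.H e j z) (fun w => vecComp (X.rep e w) k) z +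
          ∑ i, ∑ j, (e.structC k i j (e.chart.symm z.1) : ℂ) * x i * y j) •
            C.nablaComp e k (Z.rep e) z := by
      funext a
      simp only [nablaLocal, C.vecComp_torsion_rep hX hY e hz, Finset.sum_apply, Pi.smul_apply,
        smul_eq_mul, hx, hy]
    have hD : ∀ i j, C.nablaComp e i (C.nablaComp e j (Z.rep e)) z -
        C.nablaComp e j (C.nablaComp e i (Z.rep e)) z = _ := fun i j =>
      (C.nablaComp_commutator e i j hz (contDiffOn_rep hZ e)).trans (add_assoc _ _ _)
    rw [sum_commutator (fun i j => der (C.H e i z) (fun w => vecComp (X.rep e w) j) z)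
      (fun i j => der (C.H e i z) (fun w => vecComp (Y.rep e w) j) z) hD, hU]
    simp only [smul_add, Finset.sum_add_distrib, lAct_sum_left, lAct_smul_left, add_assoc]
    rfl
  -- all operations have the value zero at points outside of the equipped charts
  · simp [nabla, vert, vertBar, deg, ofLocal_eq_zero _ hq]

end SpinorConnection

end Main

end

end SpinExt

theorem mainTheorem1 {M : Type*} [TopologicalSpace M]
    [ChartedSpace (EuclideanSpace ℝ (Fin 4)) M] [IsManifold (𝓡 4) ∞ M]
    {S : M → Type*} [∀ p, AddCommGroup (S p)] [∀ p, Module ℂ (S p)]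
    [∀ p, TopologicalSpace (S p)] [TopologicalSpace (TotalSpace (Fin 2 → ℂ) S)]
    [FiberBundle (Fin 2 → ℂ) S] [VectorBundle ℂ (Fin 2 → ℂ) S]
    [ContMDiffVectorBundle ∞ (Fin 2 → ℂ) S (𝓡 4)]
    (𝓢 : SpinorSpacetime M S) {J : ℕ} (ty : Fin J → SType) (C : SpinorConnection 𝓢 ty) :
    -- the torsion and the curvatures are smooth spin-tensorial fields with the given components
    (C.torsion.Smooth 𝓢 ∧ IsRep C.torsionLocal C.torsion) ∧
    (C.curvS.Smooth 𝓢 ∧ IsRep C.curvSLocal C.curvS) ∧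
    (C.curvS'.Smooth 𝓢 ∧ IsRep C.curvS'Local C.curvS') ∧
    (C.curvR.Smooth 𝓢 ∧ IsRep C.curvRLocal C.curvR) ∧
    -- the operations on fields are given by their coordinate expressions in all equipped charts
    (∀ (t : SType) (X : ExtField S ty tyVector) (Z : ExtField S ty t), Z.Smooth 𝓢 →
      IsRep (C.nablaLocal X Z) (C.nabla X Z)) ∧
    (∀ (t : SType) (P : Fin J) (Y : ExtField S ty (ty P)) (Z : ExtField S ty t), Z.Smooth 𝓢 →
      IsRep (𝓢 := 𝓢) (vertLocal P Y Z) (vert 𝓢 P Y Z)) ∧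
    (∀ (t : SType) (P : Fin J) (Y : ExtField S ty (conjType (ty P))) (Z : ExtField S ty t),
      Z.Smooth 𝓢 → IsRep (𝓢 := 𝓢) (vertBarLocal P Y Z) (vertBar 𝓢 P Y Z)) ∧
    (∀ (t : SType) (𝔖 : ExtField S ty tySpinOp) (𝔖' : ExtField S ty tyBarOp)
      (R : ExtField S ty tyVecOp) (Z : ExtField S ty t),
      IsRep (𝓢 := 𝓢) (degLocal 𝔖 𝔖' R Z) (deg 𝓢 𝔖 𝔖' R Z)) ∧
    (∀ (t : SType) (Z : ExtField S ty t), IsRep (𝓢 := 𝓢) (tauLocal Z) (tau 𝓢 Z)) ∧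
    (∀ (T : ExtField S ty (mkType 0 0 0 0 1 2)) (X Y : ExtField S ty tyVector),
      IsRep (𝓢 := 𝓢) (evalTorsionLocal T X Y) (evalTorsion 𝓢 T X Y)) ∧
    (∀ (R : ExtField S ty (mkType 1 1 0 0 0 2)) (X Y : ExtField S ty tyVector),
      IsRep (𝓢 := 𝓢) (evalSLocal R X Y) (evalS 𝓢 R X Y)) ∧
    (∀ (R : ExtField S ty (mkType 0 0 1 1 0 2)) (X Y : ExtField S ty tyVector),
      IsRep (𝓢 := 𝓢) (evalS'Local R X Y) (evalS' 𝓢 R X Y)) ∧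
    (∀ (R : ExtField S ty (mkType 0 0 0 0 1 3)) (X Y : ExtField S ty tyVector),
      IsRep (𝓢 := 𝓢) (evalRLocal R X Y) (evalR 𝓢 R X Y)) ∧
    -- the commutation relationship
    (∀ X Y : ExtField S ty tyVector, X.Smooth 𝓢 → Y.Smooth 𝓢 →
      ∀ (t : SType) (Z : ExtField S ty t), Z.Smooth 𝓢 →
        let 𝔑 := evalS 𝓢 C.curvS X Y
        let 𝔑' := evalS' 𝓢 C.curvS' X Y
        let N := evalR 𝓢 C.curvR X Y
        let U := C.nabla X Y - C.nabla Y X - evalTorsion 𝓢 C.torsion X Y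
        C.nabla X (C.nabla Y Z) - C.nabla Y (C.nabla X Z) =
          C.nabla U Z
          + ∑ Q : Fin J, vert 𝓢 Q (-deg 𝓢 𝔑 𝔑' N (nativeField Q)) Z
          + ∑ Q : Fin J, vertBar 𝓢 Q (-deg 𝓢 𝔑 𝔑' N (tau 𝓢 (nativeField Q))) Z
          + deg 𝓢 𝔑 𝔑' N Z) :=
  ⟨⟨C.torsion_smooth, C.torsion_isRep⟩, ⟨C.curvS_smooth, C.curvS_isRep⟩,
    ⟨C.curvS'_smooth, C.curvS'_isRep⟩, ⟨C.curvR_smooth, C.curvR_isRep⟩,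
    fun _ X _ hZ => C.nabla_isRep X hZ, fun _ P Y _ hZ => vert_isRep P Y hZ,
    fun _ P Y _ hZ => vertBar_isRep P Y hZ, fun _ 𝔖 𝔖' R Z => deg_isRep 𝔖 𝔖' R Z,
    fun _ Z => tau_isRep Z, evalTorsion_isRep, evalS_isRep, evalS'_isRep, evalR_isRep,
    fun _ _ hX hY _ _ hZ => C.commutation_relationship hX hY hZ⟩
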